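/- For $p,q\in\mathbb R$ let $\mathcal G_{p,q}$ be the weighted Gini mean on $(0,\infty)$: for $x\in(0,\infty)^n$ and weights $\lambda\in[0,\infty)^n$, not all zero, $$\mathcal G_{p,q}(x,\lambda)=\Big(\frac{\sum_i\lambda_ix_i^p}{\sum_i\lambda_ix_i^q}\Big)^{\frac1{p-q}}\ (p\neq q),\qquad \mathcal G_{p,p}(x,\lambda)=\exp\Big(\frac{\sum_i\lambda_ix_i^p\ln x_i}{\sum_i\lambda_ix_i^p}\Big).$$ For a bounded interval $J$ of positive length and an integrable $f\colon J\to(0,\infty)$ put $$\mathcal G^0_{p,q}(f)=\Big(\frac{\int_Jf^p}{\int_Jf^q}\Big)^{\frac1{p-q}}\ (p\neq q),\qquad \mathcal G^0_{p,p}(f)=\exp\Big(\frac{\int_Jf^p\ln f}{\int_Jf^p}\Big),$$ whenever $f^p,f^q$ (resp. $f^p,\ f^p\ln f$) are integrable on $J$; let $X_{p,q}$ be the set of these $f$. For a weighted mean $\mathcal M$ on $(0,\infty)$ and a simple function $g$ (equal to $v_i$ on consecutive intervals $D_i$ of positive length that partition its domain) put $\mathcal M(g)=\mathcal M((v_i),(|D_i|))$.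 Write $\overline{\mathrm{Rg}}(f)$ for the smallest closed interval containing the range of $f$. For an integrable $f\colon J\to (0,\infty)$ let $\tilde f$ be the function obtained by transporting $f$ to an interval with endpoints $0,1$ by the increasing affine map, and let $B_\varepsilon(\tilde f)$ be the set of positive simple functions $g$ on the domain of $\tilde f$ with $|\overline{\mathrm{Rg}}(g)\setminus\overline{\mathrm{Rg}}(\tilde f)|<\varepsilon$ and $\|\tilde f-g\|_1<\varepsilon$. The lower and upper means are $$\mathcal M^L(f)=\lim_{\varepsilon\to0}\inf_{g\in B_\varepsilon(\tilde f)}\mathcal M(g),\qquad \mathcal M^U(f)=\lim_{\varepsilon\to0}\sup_{g\in B_\varepsilon(\tilde f)}\mathcal M(g).$$ The Hardy constant $\mathrm{Hc}(\mathcal M)$ is the smallest $C\in[0,+\infty]$ with $\sum_{n\ge1}\lambda_n\mathcal M((x_1,\dots,x_n),(\lambda_1,\dots,\lambda_n))\le C\sum_{n\ge1}\lambda_nx_n$ for all sequences $x_n,\lambda_n>0$. The integral Hardy constant $\mathrm{iHc}(\mathcal G^0_{p,q})$ is the smallest $C\in[0,+\infty]$ with $\int_0^\infty\mathcal G^0_{p,q}(f|_{[0,t)})\,dt\le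 C\int_0^\infty f(t)\,dt$ for all integrable $f\colon[0,\infty)\to(0,\infty)$ with $f|_{[0,t)}\in X_{p,q}$ for all $t>0$. Then the following hold. 1. For all $p,q\in\mathbb R$, $\mathcal G^0_{p,q}$ is an integral mean on $X_{p,q}$: $\mathcal G^0_{p,q}(f)\in(0,\infty)\cap\overline{\mathrm{Rg}}(f)$, and if $g\colon J\to(0,\infty)$ is integrable and equal to $f\in X_{p,q}$ almost everywhere, then $g\in X_{p,q}$ and $\mathcal G^0_{p,q}(g)=\mathcal G^0_{p,q}(f)$. Every positive simple function $g$ on a bounded interval of positive length belongs to $X_{p,q}$, and $\mathcal G^0_{p,q}(g)=\mathcal G_{p,q}(g)$. 2. For all $p,q\in\mathbb R$, $\mathcal G^0_{p,q}$ is the unique function $N$ on $X_{p,q}$ such that $\mathcal G_{p,q}^L(f)=\mathcal G_{p,q}^U(f)=N(f)$ for all integrable $f$ on a bounded interval of positive length with values in some compact subinterval of $(0,\infty)$, and such that $N(f_n)\to N(f)$ whenever $f_n,f\in X_{p,q}$ have the same domain $J$ and $f_n\to f$, $f_n^p\to f^p$, and $f_n^q\to f^q$ if $p\neq q$ (resp.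 $f_n^p\ln f_n\to f^p\ln f$ if $p=q$), all in $L^1(J)$. 3. If $pq\le0$ or $\min(p,q)>0$, then $$\mathrm{iHc}(\mathcal G^0_{p,q})=\mathrm{Hc}(\mathcal G_{p,q})=\begin{cases}\left(\dfrac{1-q}{1-p}\right)^{\frac1{p-q}}& p\ne q\text{ and }\min(p,q)\le0\le\max(p,q)<1,\\ e& p=q=0,\\ +\infty&\min(p,q)>0\text{ or }\max(p,q)\ge1.\end{cases}$$ 4. If $\max(p,q)\le0$, then $\mathrm{iHc}(\mathcal G^0_{p,q})\le e$; in particular $\mathrm{iHc}(\mathcal G^0_{p,q})<+\infty$. -/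

import Mathlib

open Set Filter Topology MeasureTheory
open scoped ENNReal

namespace GiniHardy

noncomputable section

/-! ### Weighted means and discrete Gini means -/

/-- An operation `(n, x, w) ↦ M n x w` on `n` entries `x` with `n` real weights `w`. -/
abbrev WeightedOp : Type := (n : ℕ) → (Fin n → ℝ) → (Fin n → ℝ) → ℝ

/-- The weighted Gini mean with parameters `p, q` (used for positive entries and nonnegative
weights, not all zero). -/
def gini (p q : ℝ) : WeightedOp := fun _ x w =>
  if p = q then
    Real.exp ((∑ i, w i * (x i ^ p * Real.log (x i))) / (∑ i, w i * x i ^ p))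
  else
    ((∑ i, w i * x i ^ p) / (∑ i, w i * x i ^ q)) ^ (1 / (p - q))

/-! ### Functional means

A functional mean is given by its domain `X` (a predicate on a bounded interval `J` and a function
`f`, of which only the restriction to `J` matters) and by its value `m J f`. -/

/-- Bounded intervals of positive length. -/
def IsBddInterval (J : Set ℝ) : Prop :=
  J.OrdConnected ∧ Bornology.IsBounded J ∧ (interior J).Nonempty

/-- `f` restricts to an integrable function from `J` to `I`. -/
def InL (I J : Set ℝ) (f : ℝ → ℝ) : Prop := IntegrableOn f J ∧ MapsTo f J I

/-- The smallest closed interval that contains the range of `f` on `J`. -/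
def RG (J : Set ℝ) (f : ℝ → ℝ) : Set ℝ := closure (convexHull ℝ (f '' J))

/-- `m` with domain `X` is an integral mean on `I`: all members of `X` are integrable functions from
a bounded interval to `I`, the value is an element of `I` that satisfies the mean value property,
and the domain and the value do not see changes on null sets. -/
structure IsIntegralMean (I : Set ℝ) (X : Set ℝ → (ℝ → ℝ) → Prop) (m : Set ℝ → (ℝ → ℝ) → ℝ) :
    Prop where
  dom : ∀ J f, X J f → IsBddInterval J ∧ InL I J f
  mem : ∀ J f, X J f → m J f ∈ I
  mean_value : ∀ J f, X J f → m J f ∈ RG J f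
  ae_invariant : ∀ J f g, X J f → InL I J g → f =ᵐ[volume.restrict J] g → X J g ∧ m J f = m J g

/-! ### Simple functions, lower and upper means -/

/-- `g` is an (`ℝ`-)simple function on the interval `J`: there are points
`inf J = c 0 < ⋯ < c n = sup J` such that `g` is equal to `v i` on the part of `J` in
`[c i, c (i + 1))` (for the last piece, `sup J` is included if it belongs to `J`). -/
def IsSimpleOn (J : Set ℝ) (g : ℝ → ℝ) (n : ℕ) (c : Fin (n + 1) → ℝ) (v : Fin n → ℝ) : Prop :=
  StrictMono c ∧ c 0 = sInf J ∧ c (Fin.last n) = sSup J ∧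
    ∀ i : Fin n, ∀ x ∈ J, c i.castSucc ≤ x →
      (x < c i.succ ∨ (i.succ = Fin.last n ∧ x = c (Fin.last n))) → g x = v i

/-- The lengths of the pieces of a partition. -/
def lengths {n : ℕ} (c : Fin (n + 1) → ℝ) : Fin n → ℝ := fun i => c i.succ - c i.castSucc

/-- The values of the weighted mean `M` at all simple functions `g : J → I` with
`|RG g \ RG f| < ε` and `‖f - g‖₁ < ε`. -/
def approxValues (I : Set ℝ) (M : WeightedOp) (J : Set ℝ) (f : ℝ → ℝ) (ε : ℝ) : Set ℝ :=
  {y | ∃ (g : ℝ → ℝ) (n : ℕ) (c : Fin (n + 1) → ℝ) (v : Fin n → ℝ),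
    IsSimpleOn J g n c v ∧ MapsTo g J I ∧
    volume (RG J g \ RG J f) < ENNReal.ofReal ε ∧
    ∫⁻ x in J, ‖f x - g x‖ₑ < ENNReal.ofReal ε ∧
    y = M n v (lengths c)}

/-- The increasing affine map that takes `0` to `inf J` and `1` to `sup J`. -/
def kappa (J : Set ℝ) (s : ℝ) : ℝ := sInf J + s * (sSup J - sInf J)

/-- The lower mean: the limit as `ε → 0` (a supremum, by monotonicity) of the infimum of `M` over
the simple functions that are `ε`-close to `f`, transported to the unit interval. -/
def lowerMean (I : Set ℝ) (M : WeightedOp) (J : Set ℝ) (f : ℝ → ℝ) : EReal :=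
  ⨆ (ε : ℝ) (_ : 0 < ε), ⨅ y ∈ approxValues I M (kappa J ⁻¹' J) (f ∘ kappa J) ε, (y : EReal)

/-- The upper mean. -/
def upperMean (I : Set ℝ) (M : WeightedOp) (J : Set ℝ) (f : ℝ → ℝ) : EReal :=
  ⨅ (ε : ℝ) (_ : 0 < ε), ⨆ y ∈ approxValues I M (kappa J ⁻¹' J) (f ∘ kappa J) ε, (y : EReal)

/-- `f` is an integrable function on a bounded interval `J` whose values lie in some compact
interval `[a, b]` contained in `(0, ∞)`. -/
def InLC (J : Set ℝ) (f : ℝ → ℝ) : Prop :=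
  IsBddInterval J ∧ ∃ a b : ℝ, 0 < a ∧ InL (Icc a b) J f

/-! ### Integral Gini means -/

/-- The explicit integral Gini mean of `f` on `J`. -/
def integralGini (p q : ℝ) (J : Set ℝ) (f : ℝ → ℝ) : ℝ :=
  if p = q then
    Real.exp ((∫ t in J, f t ^ p * Real.log (f t)) / (∫ t in J, f t ^ p))
  else
    ((∫ t in J, f t ^ p) / (∫ t in J, f t ^ q)) ^ (1 / (p - q))

/-- The domain of the integral Gini mean: integrable positive functions on bounded intervals for
which the integrals in the explicit formula exist (and are finite). -/
def giniDom (p q : ℝ) (J : Set ℝ) (f : ℝ → ℝ) : Prop :=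
  IsBddInterval J ∧ InL (Ioi 0) J f ∧ IntegrableOn (fun t => f t ^ p) J ∧
    (p ≠ q → IntegrableOn (fun t => f t ^ q) J) ∧
    (p = q → IntegrableOn (fun t => f t ^ p * Real.log (f t)) J)

/-- Convergence in `L¹ ∩ Lᵖ ∩ L^q` (for `p = q`: in `L¹ ∩ Lᵖ ∩ Lᵖ log L`): the functions themselves
and all the integrands in the explicit formula converge in `L¹(J)`. -/
def GiniTendsto (p q : ℝ) (J : Set ℝ) (F : ℕ → ℝ → ℝ) (f : ℝ → ℝ) : Prop :=
  Tendsto (fun n => ∫⁻ t in J, ‖F n t - f t‖ₑ) atTop (𝓝 0) ∧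
  Tendsto (fun n => ∫⁻ t in J, ‖F n t ^ p - f t ^ p‖ₑ) atTop (𝓝 0) ∧
  (p ≠ q → Tendsto (fun n => ∫⁻ t in J, ‖F n t ^ q - f t ^ q‖ₑ) atTop (𝓝 0)) ∧
  (p = q → Tendsto
    (fun n => ∫⁻ t in J, ‖F n t ^ p * Real.log (F n t) - f t ^ p * Real.log (f t)‖ₑ)
    atTop (𝓝 0))

/-- `N` is a continuous extension of the weighted Gini mean to the domain `giniDom p q`: on functions
with range in a compact part of `(0, ∞)` the lower and the upper mean coincide and are equal to `N`,
and `N` is sequentially continuous on its domain. -/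
def IsContinuousExtension (p q : ℝ) (N : Set ℝ → (ℝ → ℝ) → ℝ) : Prop :=
  (∀ J f, InLC J f →
    lowerMean (Ioi 0) (gini p q) J f = (N J f : EReal) ∧
    upperMean (Ioi 0) (gini p q) J f = (N J f : EReal)) ∧
  (∀ J (F : ℕ → ℝ → ℝ) f, (∀ n, giniDom p q J (F n)) → giniDom p q J f →
    GiniTendsto p q J F f → Tendsto (fun n => N J (F n)) atTop (𝓝 (N J f)))

/-! ### Hardy constants -/

/-- `C` is the (weighted) Hardy constant of `M` on `I`: the smallest extended real with
`∑ wₙ M((x₁,…,xₙ),(w₁,…,wₙ)) ≤ C ∑ wₙ xₙ` for all positive sequences `x` in `I` and `w`. -/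
def IsHardyConst (I : Set ℝ) (M : WeightedOp) (C : ℝ≥0∞) : Prop :=
  IsLeast {H : ℝ≥0∞ | ∀ x w : ℕ → ℝ, (∀ n, 0 < x n ∧ x n ∈ I) → (∀ n, 0 < w n) →
    ∑' n : ℕ, ENNReal.ofReal
        (w n * M (n + 1) (fun i : Fin (n + 1) => x i) (fun i : Fin (n + 1) => w i)) ≤
      H * ∑' n : ℕ, ENNReal.ofReal (w n * x n)} C

/-- `C` is the integral Hardy constant of the functional mean `m` with domain `X` on `I`: the
smallest extended real with `∫₀^∞ m(f|[0,t)) dt ≤ C ∫₀^∞ f(t) dt` for all integrable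
`f : [0, ∞) → I` all of whose restrictions `f|[0,t)` belong to the domain. -/
def IsIntegralHardyConst (I : Set ℝ) (X : Set ℝ → (ℝ → ℝ) → Prop) (m : Set ℝ → (ℝ → ℝ) → ℝ)
    (C : ℝ≥0∞) : Prop :=
  IsLeast {H : ℝ≥0∞ | ∀ f : ℝ → ℝ, InL I (Ici 0) f → (∀ t : ℝ, 0 < t → X (Ico 0 t) f) →
    ∫⁻ t in Ioi (0 : ℝ), ENNReal.ofReal (m (Ico 0 t) f) ≤
      H * ∫⁻ t in Ioi (0 : ℝ), ENNReal.ofReal (f t)} C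

end

end GiniHardy

namespace GiniHardy

/-! ### Bounded intervals -/

section Intervals

variable {J : Set ℝ}

/-! The mean value property comes from integrating pointwise bounds such as `a^(p-q) f^q ≤ f^p` for
`a ≤ f`, `q < p`. On a simple function every integral in the formula is a finite weighted sum over
the pieces, so the integral mean reduces to the discrete one (`IsSimpleOn.integralGini_eq`).

For the extension, let `f` take values in `[a, b] ⊂ (0, ∞)`. After transport to an interval of
length one, a simple function that is close in range and in `L¹` has values in a slightly larger
compact subinterval of `(0, ∞)` (`mapsTo_Icc_of_close`). There `x^p`, `x^q` and `x^p log x` are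
Lipschitz, so its mean is close to that of `f`, and the lower and upper means both equal the
explicit formula. A general `f` is the limit of its truncations to `[1/(n+1), n+1]` in every
required sense (`giniDom.giniTendsto_clip`), and continuity then leaves no choice for `N`.

Upper Hardy bounds: for `q ≤ 0 ≤ p < 1`, `q ≠ p`, the Gini mean is at most `C U^θ V^(1-θ) ≤ C (θ U +
(1-θ) V)` with `θ = p/(p-q)` and `C` the claimed constant (`div_rpow_le_of_powerMean_le`). Each of
`U` and `V` has total mass at most that of the data. In the discrete case they are power means
divided by their own Hardy constants, and the mass bound follows from a telescoping recursion
(`powerMean_step`, `sum_mul_le_of_recursion`). In the integral case they are the averages `(1-r)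
t^(r-2) ∫₀ᵗ s^(1-r) f(s) ds`: Tonelli preserves the mass exactly, and Hölder against `1/s` bounds
the integrals of powers (`mul_integral_rpow_le`). The case `p = q = 0` is the same with logarithms.

Lower Hardy bounds: the harmonic sequence, cut off at a large index, and the functions `s^(-a)` near
`0` with `a → 1` reach the constant. If `max p q ≥ 1` and `min p q ≤ 0`, the exponents can be tuned
so that the bound blows up. If `p, q > 0`, the means of an exponentially decaying input tend to a
positive limit, so their total is infinite while the input is summable.

For `p, q ≤ 0` the Gini mean is at most the geometric mean, which gives the bound `e`. -/

lemma IsBddInterval.measurableSet (hJ : IsBddInterval J) : MeasurableSet J :=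
  hJ.1.measurableSet

lemma IsBddInterval.volume_lt_top (hJ : IsBddInterval J) : volume J < ⊤ :=
  hJ.2.1.measure_lt_top

lemma IsBddInterval.volume_pos (hJ : IsBddInterval J) : 0 < volume J :=
  Measure.measure_pos_of_nonempty_interior volume hJ.2.2

lemma IsBddInterval.nonempty (hJ : IsBddInterval J) : J.Nonempty :=
  hJ.2.2.mono interior_subset

lemma IsBddInterval.subset_Icc (hJ : IsBddInterval J) : J ⊆ Icc (sInf J) (sSup J) :=
  fun _ hx => ⟨csInf_le hJ.2.1.bddBelow hx, le_csSup hJ.2.1.bddAbove hx⟩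

lemma IsBddInterval.Ioo_subset (hJ : IsBddInterval J) : Ioo (sInf J) (sSup J) ⊆ J := by
  intro x hx
  obtain ⟨y, hy, hyx⟩ := exists_lt_of_csInf_lt hJ.nonempty hx.1
  obtain ⟨z, hz, hxz⟩ := exists_lt_of_lt_csSup hJ.nonempty hx.2
  exact hJ.1.out hy hz ⟨hyx.le, hxz.le⟩

lemma IsBddInterval.sInf_lt_sSup (hJ : IsBddInterval J) : sInf J < sSup J := by
  by_contra! h
  have h1 : volume J ≤ volume (Icc (sInf J) (sSup J)) := measure_mono hJ.subset_Icc
  rw [Real.volume_Icc, ENNReal.ofReal_of_nonpos (by linarith)] at h1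
  exact absurd hJ.volume_pos (not_lt.2 h1)

/-- Whether `J` contains its endpoints is invisible to integrals, so every integral over `J` may be
treated as an interval integral. -/
lemma IsBddInterval.ae_eq_Ioc (hJ : IsBddInterval J) : J =ᵐ[volume] Ioc (sInf J) (sSup J) := by
  have h1 : J ≤ᵐ[volume] Icc (sInf J) (sSup J) := hJ.subset_Icc.eventuallyLE
  have h2 : Ioo (sInf J) (sSup J) ≤ᵐ[volume] J := hJ.Ioo_subset.eventuallyLE
  exact (h1.trans Ioc_ae_eq_Icc.symm.le).antisymm (Ioo_ae_eq_Ioc.symm.le.trans h2)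

lemma isBddInterval_of_Ioo_subset {a b : ℝ} (hab : a < b) (hJ : J.OrdConnected)
    (h1 : Ioo a b ⊆ J) (h2 : J ⊆ Icc a b) :
    IsBddInterval J ∧ sInf J = a ∧ sSup J = b := by
  have hne : J.Nonempty := (nonempty_Ioo.2 hab).mono h1
  have hb : Bornology.IsBounded J := (Metric.isBounded_Icc a b).subset h2
  refine ⟨⟨hJ, hb, ?_⟩, ?_, ?_⟩
  · exact (nonempty_Ioo.2 hab).mono (interior_maximal h1 isOpen_Ioo)
  · refine le_antisymm ?_ (le_csInf hne fun x hx => (h2 hx).1)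
    calc sInf J ≤ sInf (Ioo a b) := csInf_le_csInf hb.bddBelow (nonempty_Ioo.2 hab) h1
      _ = a := csInf_Ioo hab
  · refine le_antisymm (csSup_le hne fun x hx => (h2 hx).2) ?_
    calc b = sSup (Ioo a b) := (csSup_Ioo hab).symm
      _ ≤ sSup J := csSup_le_csSup hb.bddAbove (nonempty_Ioo.2 hab) h1

lemma isBddInterval_Ico {a b : ℝ} (hab : a < b) : IsBddInterval (Ico a b) :=
  (isBddInterval_of_Ioo_subset hab ordConnected_Ico Ioo_subset_Ico_self Ico_subset_Icc_self).1

end Intervals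

/-! ### The explicit integral Gini mean -/

section IntegralGini

variable {J : Set ℝ} {p q : ℝ} {f : ℝ → ℝ}

lemma setIntegral_pos_of_pos (hJ : IsBddInterval J) (hf : IntegrableOn f J)
    (hpos : ∀ t ∈ J, 0 < f t) : 0 < ∫ t in J, f t := by
  rw [setIntegral_pos_iff_support_of_nonneg_ae]
  · have : Function.support f ∩ J = J := inter_eq_right.2 fun t ht => (hpos t ht).ne'
    rw [this]; exact hJ.volume_pos
  · exact (ae_restrict_iff' hJ.measurableSet).2 (ae_of_all _ fun t ht => (hpos t ht).le)
  · exact hf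

lemma giniDom.interval (h : giniDom p q J f) : IsBddInterval J := h.1

lemma giniDom.pos (h : giniDom p q J f) : ∀ t ∈ J, 0 < f t := fun _ ht => h.2.1.2 ht

lemma giniDom.integrable_left (h : giniDom p q J f) : IntegrableOn (fun t => f t ^ p) J := h.2.2.1

lemma giniDom.integrable_right (h : giniDom p q J f) : IntegrableOn (fun t => f t ^ q) J := by
  by_cases hpq : p = q
  · exact hpq ▸ h.2.2.1
  · exact h.2.2.2.1 hpq

lemma giniDom.integral_left_pos (h : giniDom p q J f) : 0 < ∫ t in J, f t ^ p :=
  setIntegral_pos_of_pos h.interval h.integrable_left fun t ht => Real.rpow_pos_of_pos (h.pos t ht) _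

lemma giniDom.integral_right_pos (h : giniDom p q J f) : 0 < ∫ t in J, f t ^ q :=
  setIntegral_pos_of_pos h.interval h.integrable_right
    fun t ht => Real.rpow_pos_of_pos (h.pos t ht) _

lemma giniDom.symm (h : giniDom p q J f) : giniDom q p J f := by
  refine ⟨h.1, h.2.1, h.integrable_right, fun _ => h.integrable_left, fun hqp => ?_⟩
  subst hqp
  exact h.2.2.2.2 rfl

lemma div_rpow_one_div_sub_comm {a b : ℝ} (ha : 0 ≤ a) (hb : 0 ≤ b) :
    (a / b) ^ (1 / (p - q)) = (b / a) ^ (1 / (q - p)) := by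
  rw [← inv_div b a, Real.inv_rpow (by positivity), ← Real.rpow_neg (by positivity)]
  congr 1
  rw [← neg_sub q p, one_div, one_div, inv_neg, neg_neg]

/-- Because of this symmetry the estimates with `p ≠ q` need a proof only for `q < p`. -/
lemma integralGini_comm (h : giniDom p q J f) :
    integralGini p q J f = integralGini q p J f := by
  by_cases hpq : p = q
  · subst hpq; rfl
  · rw [integralGini, integralGini, if_neg hpq, if_neg (Ne.symm hpq)]
    exact div_rpow_one_div_sub_comm h.integral_left_pos.le h.integral_right_pos.le

lemma integralGini_pos (h : giniDom p q J f) : 0 < integralGini p q J f := by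
  unfold integralGini
  split_ifs
  · exact Real.exp_pos _
  · exact Real.rpow_pos_of_pos (div_pos h.integral_left_pos h.integral_right_pos) _

/-- Since `p - q > 0`, `f^p = f^(p-q) f^q ≥ a^(p-q) f^q`; integrate and take the root. -/
lemma le_integralGini_of_lt (hqp : q < p) (h : giniDom p q J f) {a : ℝ} (ha : 0 < a)
    (hf : ∀ t ∈ J, a ≤ f t) : a ≤ integralGini p q J f := by
  have hB := h.integral_right_pos
  have key : a ^ (p - q) * ∫ t in J, f t ^ q ≤ ∫ t in J, f t ^ p := by
    rw [← integral_const_mul]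
    refine setIntegral_mono_on (h.integrable_right.const_mul _) h.integrable_left
      h.interval.measurableSet fun t ht => ?_
    have hft := h.pos t ht
    calc a ^ (p - q) * f t ^ q ≤ f t ^ (p - q) * f t ^ q := by
          gcongr
          exact hf t ht
      _ = f t ^ p := by rw [← Real.rpow_add hft]; ring_nf
  rw [integralGini, if_neg hqp.ne']
  have hpq : p - q ≠ 0 := (sub_pos.2 hqp).ne'
  calc a = (a ^ (p - q)) ^ (1 / (p - q)) := by
        rw [← Real.rpow_mul ha.le, mul_one_div_cancel hpq, Real.rpow_one]
    _ ≤ _ := by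
        have := sub_pos.2 hqp
        gcongr
        rwa [le_div_iff₀ hB]

lemma integralGini_le_of_lt (hqp : q < p) (h : giniDom p q J f) {b : ℝ}
    (hf : ∀ t ∈ J, f t ≤ b) : integralGini p q J f ≤ b := by
  have hB := h.integral_right_pos
  have hA := h.integral_left_pos
  obtain ⟨t₀, ht₀⟩ := h.interval.nonempty
  have hb : 0 < b := (h.pos t₀ ht₀).trans_le (hf t₀ ht₀)
  have key : ∫ t in J, f t ^ p ≤ b ^ (p - q) * ∫ t in J, f t ^ q := by
    rw [← integral_const_mul]
    refine setIntegral_mono_on h.integrable_left (h.integrable_right.const_mul _)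
      h.interval.measurableSet fun t ht => ?_
    have hft := h.pos t ht
    calc f t ^ p = f t ^ (p - q) * f t ^ q := by rw [← Real.rpow_add hft]; ring_nf
      _ ≤ b ^ (p - q) * f t ^ q := by
          gcongr
          exact hf t ht
  rw [integralGini, if_neg hqp.ne']
  have hpq : p - q ≠ 0 := (sub_pos.2 hqp).ne'
  calc _ ≤ (b ^ (p - q)) ^ (1 / (p - q)) := by
        have := sub_pos.2 hqp
        gcongr
        rwa [div_le_iff₀ hB]
    _ = b := by rw [← Real.rpow_mul hb.le, mul_one_div_cancel hpq, Real.rpow_one]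

lemma le_integralGini (h : giniDom p q J f) {a : ℝ} (hf : ∀ t ∈ J, a ≤ f t) :
    a ≤ integralGini p q J f := by
  rcases le_or_gt a 0 with ha | ha
  · exact ha.trans (integralGini_pos h).le
  rcases lt_trichotomy p q with hpq | rfl | hpq
  · rw [integralGini_comm h]
    exact le_integralGini_of_lt hpq h.symm ha hf
  · have hA := h.integral_left_pos
    rw [integralGini, if_pos rfl]
    calc a = Real.exp (Real.log a) := (Real.exp_log ha).symm
      _ ≤ _ := by
        gcongr
        rw [le_div_iff₀ hA, ← integral_const_mul]
        refine setIntegral_mono_on (h.integrable_left.const_mul _) (h.2.2.2.2 rfl)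
          h.interval.measurableSet fun t ht => ?_
        rw [mul_comm]
        have := h.pos t ht
        gcongr
        exact hf t ht
  · exact le_integralGini_of_lt hpq h ha hf

lemma integralGini_le (h : giniDom p q J f) {b : ℝ} (hf : ∀ t ∈ J, f t ≤ b) :
    integralGini p q J f ≤ b := by
  rcases lt_trichotomy p q with hpq | rfl | hpq
  · rw [integralGini_comm h]
    exact integralGini_le_of_lt hpq h.symm hf
  · have hA := h.integral_left_pos
    obtain ⟨t₀, ht₀⟩ := h.interval.nonempty
    have hb : 0 < b := (h.pos t₀ ht₀).trans_le (hf t₀ ht₀)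
    rw [integralGini, if_pos rfl]
    calc _ ≤ Real.exp (Real.log b) := by
          gcongr
          rw [div_le_iff₀ hA, ← integral_const_mul]
          refine setIntegral_mono_on (h.2.2.2.2 rfl) (h.integrable_left.const_mul _)
            h.interval.measurableSet fun t ht => ?_
          rw [mul_comm (Real.log b)]
          have := h.pos t ht
          gcongr
          exact hf t ht
      _ = b := Real.exp_log hb
  · exact integralGini_le_of_lt hpq h hf

/-- A number between the bounds of a nonempty set of reals is in the closure of its convex hull. -/
lemma mem_closure_convexHull {S : Set ℝ} {m : ℝ} (hS : S.Nonempty)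
    (hl : ∀ a, (∀ x ∈ S, a ≤ x) → a ≤ m) (hu : ∀ b, (∀ x ∈ S, x ≤ b) → m ≤ b) :
    m ∈ closure (convexHull ℝ S) := by
  have hsub : S ⊆ closure (convexHull ℝ S) := (subset_convexHull ℝ S).trans subset_closure
  have hconn : (closure (convexHull ℝ S)).OrdConnected :=
    ((convex_convexHull ℝ S).closure).ordConnected
  by_cases h1 : ∀ x ∈ S, x ≤ m
  · have hm : IsLUB S m := ⟨h1, fun b hb => hu b fun x hx => hb hx⟩
    exact closure_mono (subset_convexHull ℝ S) (hm.mem_closure hS)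
  by_cases h2 : ∀ x ∈ S, m ≤ x
  · have hm : IsGLB S m := ⟨h2, fun b hb => hl b fun x hx => hb hx⟩
    exact closure_mono (subset_convexHull ℝ S) (hm.mem_closure hS)
  push Not at h1 h2
  obtain ⟨y, hy, hmy⟩ := h1
  obtain ⟨z, hz, hzm⟩ := h2
  exact hconn.out (hsub hz) (hsub hy) ⟨hzm.le, hmy.le⟩

theorem isIntegralMean_integralGini (p q : ℝ) :
    IsIntegralMean (Ioi 0) (giniDom p q) (integralGini p q) where
  dom _ _ h := ⟨h.1, h.2.1⟩
  mem _ _ h := integralGini_pos h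
  mean_value J f h := by
    refine mem_closure_convexHull (h.interval.nonempty.image f) (fun a ha => ?_) fun b hb => ?_
    · exact le_integralGini h fun t ht => ha _ (mem_image_of_mem f ht)
    · exact integralGini_le h fun t ht => hb _ (mem_image_of_mem f ht)
  ae_invariant J f g h hg hfg := by
    have e1 (r : ℝ) : (fun t => f t ^ r) =ᵐ[volume.restrict J] fun t => g t ^ r :=
      hfg.fun_comp (· ^ r)
    have e2 : (fun t => f t ^ p * Real.log (f t)) =ᵐ[volume.restrict J]
        fun t => g t ^ p * Real.log (g t) := hfg.fun_comp fun x => x ^ p * Real.log x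
    refine ⟨⟨h.1, hg, h.2.2.1.congr (e1 p), fun hpq => (h.2.2.2.1 hpq).congr (e1 q),
      fun hpq => (h.2.2.2.2 hpq).congr e2⟩, ?_⟩
    unfold integralGini
    rw [integral_congr_ae (e1 p), integral_congr_ae (e1 q), integral_congr_ae e2]

end IntegralGini

/-! ### Simple functions -/

section Simple

variable {J : Set ℝ} {g : ℝ → ℝ} {n : ℕ} {c : Fin (n + 1) → ℝ} {v : Fin n → ℝ}

/-- The partition does not change, so one formula for the integral of a simple function serves for
`x^p`, `x^q` and `x^p log x`. -/
lemma IsSimpleOn.comp (h : IsSimpleOn J g n c v) (φ : ℝ → ℝ) :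
    IsSimpleOn J (fun t => φ (g t)) n c (fun i => φ (v i)) :=
  ⟨h.1, h.2.1, h.2.2.1, fun i x hx h1 h2 => congrArg φ (h.2.2.2 i x hx h1 h2)⟩

lemma IsSimpleOn.eq_of_mem_Ioo (hJ : IsBddInterval J) (h : IsSimpleOn J g n c v) (i : Fin n)
    {x : ℝ} (hx : x ∈ Ioo (c i.castSucc) (c i.succ)) : x ∈ J ∧ g x = v i := by
  have h0 : sInf J ≤ c i.castSucc := h.2.1 ▸ h.1.monotone (Fin.zero_le _)
  have h1 : c i.succ ≤ sSup J := h.2.2.1 ▸ h.1.monotone (Fin.le_last _)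
  have hxJ : x ∈ J := hJ.Ioo_subset ⟨h0.trans_lt hx.1, hx.2.trans_le h1⟩
  exact ⟨hxJ, h.2.2.2 i x hxJ hx.1.le (Or.inl hx.2)⟩

lemma IsSimpleOn.integrableOn_and_integral_eq (hJ : IsBddInterval J) (h : IsSimpleOn J g n c v) :
    IntegrableOn g J ∧ ∫ t in J, g t = ∑ i, lengths c i * v i := by
  have hae (i : Fin n) : ∀ᵐ x ∂volume.restrict (Ioc (c i.castSucc) (c i.succ)), v i = g x := by
    rw [← restrict_Ioo_eq_restrict_Ioc]
    exact (ae_restrict_iff' measurableSet_Ioo).2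
      (ae_of_all _ fun x hx => (h.eq_of_mem_Ioo hJ i hx).2.symm)
  have hle (i : Fin n) : c i.castSucc ≤ c i.succ := (h.1 (Fin.castSucc_lt_succ (i := i))).le
  have hint (i : Fin n) : IntervalIntegrable g volume (c i.castSucc) (c i.succ) := by
    rw [intervalIntegrable_iff_integrableOn_Ioc_of_le (hle i)]
    exact (integrableOn_const (C := v i) (by simp) (by simp)).congr (hae i)
  have hval (i : Fin n) : ∫ t in c i.castSucc..c i.succ, g t = lengths c i * v i := by
    rw [intervalIntegral.integral_of_le (hle i), ← integral_congr_ae (hae i)]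
    simp [lengths, hle i]
  -- The telescoping of adjacent interval integrals is indexed by `ℕ`. `Fin.ofNat` wraps around
  -- modulo `n + 1`, but only indices at most `n` occur.
  let a : ℕ → ℝ := fun k => c (Fin.ofNat (n + 1) k)
  have ha (i : Fin n) : a i = c i.castSucc := by
    simp only [a]; congr 1; ext; simp
  have ha' (i : Fin n) : a (i + 1) = c i.succ := by
    simp only [a]; congr 1; ext; simp
  have ha0 : a 0 = sInf J := by rw [← h.2.1]; rfl
  have han : a n = sSup J := by
    rw [← h.2.2.1]; simp only [a]; congr 1; ext; simp
  have hint' : ∀ k < n, IntervalIntegrable g volume (a k) (a (k + 1)) := fun k hk => by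
    have := hint ⟨k, hk⟩
    rwa [← ha, ← ha'] at this
  have hJle := hJ.sInf_lt_sSup.le
  constructor
  · have := IntervalIntegrable.trans_iterate hint'
    rw [ha0, han, intervalIntegrable_iff_integrableOn_Ioc_of_le hJle] at this
    exact this.congr_set_ae hJ.ae_eq_Ioc
  · rw [setIntegral_congr_set hJ.ae_eq_Ioc, ← intervalIntegral.integral_of_le hJle, ← ha0, ← han,
      ← intervalIntegral.sum_integral_adjacent_intervals hint', Finset.sum_range]
    exact Finset.sum_congr rfl fun i _ => by rw [ha, ha', hval]

lemma IsSimpleOn.giniDom (p q : ℝ) (hJ : IsBddInterval J) (hg : MapsTo g J (Ioi 0))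
    (h : IsSimpleOn J g n c v) : giniDom p q J g :=
  ⟨hJ, ⟨(h.integrableOn_and_integral_eq hJ).1, hg⟩,
    ((h.comp (· ^ p)).integrableOn_and_integral_eq hJ).1,
    fun _ => ((h.comp (· ^ q)).integrableOn_and_integral_eq hJ).1,
    fun _ => ((h.comp fun x => x ^ p * Real.log x).integrableOn_and_integral_eq hJ).1⟩

lemma IsSimpleOn.integralGini_eq (p q : ℝ) (hJ : IsBddInterval J) (h : IsSimpleOn J g n c v) :
    integralGini p q J g = gini p q n v (lengths c) := by
  unfold integralGini gini
  rw [((h.comp (· ^ p)).integrableOn_and_integral_eq hJ).2,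
    ((h.comp (· ^ q)).integrableOn_and_integral_eq hJ).2,
    ((h.comp fun x => x ^ p * Real.log x).integrableOn_and_integral_eq hJ).2]

end Simple

/-! ### Sequential continuity of the integral Gini mean -/

section Continuity

variable {J : Set ℝ} {p q : ℝ} {f : ℝ → ℝ}

/-- The formula is a continuous function of two integrals whose limits are known; positivity of the
limits of the integrals of powers excludes the singularities of division and of `rpow`. -/
lemma tendsto_integralGini {F : ℕ → ℝ → ℝ} (hF : ∀ n, giniDom p q J (F n)) (hf : giniDom p q J f)
    (h : GiniTendsto p q J F f) :
    Tendsto (fun n => integralGini p q J (F n)) atTop (𝓝 (integralGini p q J f)) := by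
  have hA : Tendsto (fun n => ∫ t in J, F n t ^ p) atTop (𝓝 (∫ t in J, f t ^ p)) :=
    tendsto_integral_of_L1 _ hf.integrable_left.aestronglyMeasurable
      (Eventually.of_forall fun n => (hF n).integrable_left) h.2.1
  by_cases hpq : p = q
  · simp only [integralGini, if_pos hpq]
    have hB := tendsto_integral_of_L1 _ (hf.2.2.2.2 hpq).aestronglyMeasurable
      (Eventually.of_forall fun n => (hF n).2.2.2.2 hpq) (h.2.2.2 hpq)
    exact (Real.continuous_exp.tendsto _).comp (hB.div hA hf.integral_left_pos.ne')
  · simp only [integralGini, if_neg hpq]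
    have hB := tendsto_integral_of_L1 _ hf.integrable_right.aestronglyMeasurable
      (Eventually.of_forall fun n => (hF n).integrable_right) (h.2.2.1 hpq)
    exact (hA.div hB hf.integral_right_pos.ne').rpow_const
      (Or.inl (div_pos hf.integral_left_pos hf.integral_right_pos).ne')

lemma IsBddInterval.integrableOn_of_bound (hJ : IsBddInterval J)
    (hf : AEStronglyMeasurable f (volume.restrict J)) {K : ℝ} (hK : ∀ t ∈ J, |f t| ≤ K) :
    IntegrableOn f J := by
  have : IsFiniteMeasure (volume.restrict J) := ⟨by simpa using hJ.volume_lt_top⟩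
  exact Integrable.of_bound hf K ((ae_restrict_iff' hJ.measurableSet).2 (ae_of_all _ hK))

lemma InLC.integrableOn_comp {φ : ℝ → ℝ} (hφ : Measurable φ)
    (hφb : ∀ a b : ℝ, 0 < a → ∃ K, ∀ x ∈ Icc a b, |φ x| ≤ K) (h : InLC J f) :
    IntegrableOn (fun t => φ (f t)) J := by
  obtain ⟨hJ, a, b, ha, hf, hmaps⟩ := h
  obtain ⟨K, hK⟩ := hφb a b ha
  exact hJ.integrableOn_of_bound
    (hφ.comp_aemeasurable hf.aestronglyMeasurable.aemeasurable).aestronglyMeasurable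
    fun t ht => hK _ (hmaps ht)

lemma exists_abs_le_of_continuousOn_Ioi {φ : ℝ → ℝ} (hφ : ContinuousOn φ (Ioi 0)) (a b : ℝ)
    (ha : 0 < a) : ∃ K, ∀ x ∈ Icc a b, |φ x| ≤ K :=
  isCompact_Icc.exists_bound_of_continuousOn
    (hφ.mono fun _ hx => ha.trans_le hx.1)

/-- `C¹` rather than mere continuity, since it also yields Lipschitz bounds on compact subintervals.
-/
lemma contDiffOn_rpow (p : ℝ) : ContDiffOn ℝ 1 (fun x : ℝ => x ^ p) (Ioi 0) :=
  contDiffOn_id.rpow_const_of_ne fun _ hx => (mem_Ioi.1 hx).ne'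

lemma contDiffOn_rpow_mul_log (p : ℝ) :
    ContDiffOn ℝ 1 (fun x : ℝ => x ^ p * Real.log x) (Ioi 0) :=
  (contDiffOn_rpow p).mul (contDiffOn_id.log fun _ hx => (mem_Ioi.1 hx).ne')

lemma measurable_rpow (p : ℝ) : Measurable fun x : ℝ => x ^ p := measurable_id.pow_const p

lemma measurable_rpow_mul_log (p : ℝ) : Measurable fun x : ℝ => x ^ p * Real.log x :=
  (measurable_rpow p).mul Real.measurable_log

lemma InLC.giniDom (p q : ℝ) (h : InLC J f) : giniDom p q J f := by
  have hr (r : ℝ) : IntegrableOn (fun t => f t ^ r) J :=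
    h.integrableOn_comp (measurable_rpow r)
      (exists_abs_le_of_continuousOn_Ioi (contDiffOn_rpow r).continuousOn)
  refine ⟨h.1, ?_, hr p, fun _ => hr q, fun _ => ?_⟩
  · obtain ⟨-, a, b, ha, hf, hmaps⟩ := h
    exact ⟨hf, fun t ht => ha.trans_le (hmaps ht).1⟩
  · exact h.integrableOn_comp (measurable_rpow_mul_log p)
      (exists_abs_le_of_continuousOn_Ioi (contDiffOn_rpow_mul_log p).continuousOn)

end Continuity

/-! ### Truncation -/

section Truncation

/-- The projection onto `[1 / (n + 1), n + 1]`. -/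
noncomputable def clip (n : ℕ) (x : ℝ) : ℝ := max (1 / (n + 1)) (min x (n + 1))

lemma clip_mem (n : ℕ) (x : ℝ) : clip n x ∈ Icc (1 / ((n : ℝ) + 1)) (n + 1) := by
  refine ⟨le_max_left _ _, max_le ?_ (min_le_right _ _)⟩
  rw [div_le_iff₀ (by positivity)]
  nlinarith [(Nat.cast_nonneg n : (0 : ℝ) ≤ n)]

lemma measurable_clip (n : ℕ) : Measurable (clip n) :=
  measurable_const.max (measurable_id.min measurable_const)

/-- Truncation moves a number towards `1` and never past it. Together with the next lemma this gives
dominating functions that do not depend on `n`. -/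
lemma clip_mem_of_one_le (n : ℕ) {x : ℝ} (hx : 1 ≤ x) : 1 ≤ clip n x ∧ clip n x ≤ x := by
  have hn : (0 : ℝ) ≤ n := Nat.cast_nonneg n
  refine ⟨le_max_of_le_right (le_min hx (by linarith)), max_le ?_ (min_le_left _ _)⟩
  exact le_trans (by rw [div_le_one (by positivity)]; linarith) hx

lemma clip_mem_of_le_one (n : ℕ) {x : ℝ} (hx : x ≤ 1) : x ≤ clip n x ∧ clip n x ≤ 1 := by
  have hn : (0 : ℝ) ≤ n := Nat.cast_nonneg n
  refine ⟨le_max_of_le_right (le_min le_rfl (by linarith)), max_le ?_ ((min_le_left _ _).trans hx)⟩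
  rw [div_le_one (by positivity)]; linarith

lemma eventually_clip_eq {x : ℝ} (hx : 0 < x) : ∀ᶠ n in atTop, clip n x = x := by
  have h1 : ∀ᶠ n : ℕ in atTop, x ≤ n + 1 :=
    (tendsto_natCast_atTop_atTop.atTop_add tendsto_const_nhds).eventually_ge_atTop x
  have h2 : ∀ᶠ n : ℕ in atTop, 1 / ((n : ℝ) + 1) < x :=
    tendsto_one_div_add_atTop_nhds_zero_nat.eventually_lt_const hx
  filter_upwards [h1, h2] with n h1 h2
  rw [clip, min_eq_left h1, max_eq_right h2.le]

/-- By monotonicity of `x^r`, the truncated power lies between `x^r` and `1`. -/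
lemma clip_rpow_le (n : ℕ) (r : ℝ) {x : ℝ} (hx : 0 < x) : clip n x ^ r ≤ x ^ r + 1 := by
  have hc : 0 < clip n x := lt_of_lt_of_le (by positivity) (clip_mem n x).1
  have hxr := Real.rpow_nonneg hx.le r
  rcases le_total 1 x with h | h
  · obtain ⟨h1, h2⟩ := clip_mem_of_one_le n h
    rcases le_total 0 r with hr | hr
    · linarith [Real.rpow_le_rpow hc.le h2 hr]
    · linarith [Real.rpow_le_one_of_one_le_of_nonpos h1 hr]
  · obtain ⟨h1, h2⟩ := clip_mem_of_le_one n h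
    rcases le_total 0 r with hr | hr
    · linarith [Real.rpow_le_one hc.le h2 hr]
    · linarith [Real.rpow_le_rpow_of_nonpos hx h1 hr]

/-- The extra terms cover the cases where truncation can enlarge the value: `x` for `x ≥ 1`, `r ≤
0`, through `log y ≤ y`, and `|1 / r|` for `x ≤ 1`, `r > 0`, through `y^r |log y| < 1/r`. -/
lemma abs_clip_rpow_mul_log_le (n : ℕ) (r : ℝ) {x : ℝ} (hx : 0 < x) :
    |clip n x ^ r * Real.log (clip n x)| ≤ |x ^ r * Real.log x| + x + |1 / r| := by
  have hc : 0 < clip n x := lt_of_lt_of_le (by positivity) (clip_mem n x).1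
  set y := clip n x
  have hyr := Real.rpow_pos_of_pos hc r
  have hxr := Real.rpow_pos_of_pos hx r
  rw [abs_mul, abs_mul, abs_of_pos hyr, abs_of_pos hxr]
  have n1 : 0 ≤ x ^ r * |Real.log x| := by positivity
  have n2 : 0 ≤ |1 / r| := abs_nonneg _
  rcases le_total 1 x with h | h
  · obtain ⟨h1, h2⟩ := clip_mem_of_one_le n h
    have hlog : |Real.log y| ≤ |Real.log x| := by
      rw [abs_of_nonneg (Real.log_nonneg h1), abs_of_nonneg (Real.log_nonneg h)]
      exact Real.log_le_log hc h2
    rcases le_total 0 r with hr | hr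
    · have : y ^ r * |Real.log y| ≤ x ^ r * |Real.log x| := by
        have := Real.rpow_le_rpow hc.le h2 hr
        gcongr
      linarith
    · have : y ^ r * |Real.log y| ≤ 1 * x := by
        have h3 := Real.rpow_le_one_of_one_le_of_nonpos h1 hr
        have h4 : |Real.log y| ≤ x := by
          rw [abs_of_nonneg (Real.log_nonneg h1)]
          linarith [Real.log_le_sub_one_of_pos hc]
        gcongr
      linarith
  · obtain ⟨h1, h2⟩ := clip_mem_of_le_one n h
    have hlog : |Real.log y| ≤ |Real.log x| := by
      rw [abs_of_nonpos (Real.log_nonpos hc.le h2), abs_of_nonpos (Real.log_nonpos hx.le h)]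
      exact neg_le_neg (Real.log_le_log hx h1)
    rcases le_or_gt r 0 with hr | hr
    · have : y ^ r * |Real.log y| ≤ x ^ r * |Real.log x| := by
        have := Real.rpow_le_rpow_of_nonpos hx h1 hr
        gcongr
      linarith
    · have := Real.abs_log_mul_self_rpow_lt y r hc h2 hr
      rw [abs_mul, abs_of_pos hyr, mul_comm] at this
      rw [abs_of_pos (show 0 < 1 / r by positivity)]
      linarith

variable {J : Set ℝ} {p q : ℝ} {f : ℝ → ℝ}

lemma giniDom.inLC_clip (h : giniDom p q J f) (n : ℕ) : InLC J (fun t => clip n (f t)) := by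
  refine ⟨h.1, 1 / ((n : ℝ) + 1), n + 1, by positivity, ?_, fun t _ => clip_mem n _⟩
  refine h.1.integrableOn_of_bound (K := (n : ℝ) + 1) ((measurable_clip n).comp_aemeasurable
    h.2.1.1.aestronglyMeasurable.aemeasurable).aestronglyMeasurable fun t _ => ?_
  have := clip_mem n (f t)
  rw [abs_of_nonneg (le_trans (by positivity) this.1)]
  exact this.2

lemma giniDom.tendsto_lintegral_clip (h : giniDom p q J f) {φ bound : ℝ → ℝ} (hφ : Measurable φ)
    (hb : IntegrableOn bound J)
    (hle : ∀ n, ∀ t ∈ J, |φ (clip n (f t))| ≤ bound t) :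
    Tendsto (fun n => ∫⁻ t in J, ‖φ (clip n (f t)) - φ (f t)‖ₑ) atTop (𝓝 0) := by
  have hJ := h.1.measurableSet
  simp_rw [← ofReal_norm]
  refine tendsto_lintegral_norm_of_dominated_convergence (bound := bound) (fun n => ?_)
    hb.hasFiniteIntegral (fun n => ?_) ?_
  · exact (hφ.comp_aemeasurable ((measurable_clip n).comp_aemeasurable
      h.2.1.1.aestronglyMeasurable.aemeasurable)).aestronglyMeasurable
  · exact (ae_restrict_iff' hJ).2 (ae_of_all _ fun t ht => hle n t ht)
  · refine (ae_restrict_iff' hJ).2 (ae_of_all _ fun t ht => ?_)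
    refine tendsto_const_nhds.congr' ?_
    filter_upwards [eventually_clip_eq (h.pos t ht)] with n hn
    rw [hn]

/-- This density statement is what forces uniqueness: truncations have values in a compact
subinterval of `(0, ∞)`, where the lower and upper means already fix the value. -/
lemma giniDom.giniTendsto_clip (h : giniDom p q J f) :
    GiniTendsto p q J (fun n t => clip n (f t)) f := by
  have hconst (K : ℝ) : IntegrableOn (fun _ : ℝ => K) J :=
    integrableOn_const h.1.volume_lt_top.ne
  have hpow (r : ℝ) (hr : IntegrableOn (fun t => f t ^ r) J) :
      Tendsto (fun n => ∫⁻ t in J, ‖clip n (f t) ^ r - f t ^ r‖ₑ) atTop (𝓝 0) := by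
    refine h.tendsto_lintegral_clip (φ := (· ^ r)) (measurable_rpow r) (hr.add (hconst 1))
      fun n t ht => ?_
    have hc : 0 < clip n (f t) := lt_of_lt_of_le (by positivity) (clip_mem n _).1
    simp only [Pi.add_apply]
    rw [abs_of_pos (Real.rpow_pos_of_pos hc r)]
    exact clip_rpow_le n r (h.pos t ht)
  refine ⟨?_, hpow p h.integrable_left, fun _ => hpow q h.integrable_right, fun hpq => ?_⟩
  · have := hpow 1 (by simpa using h.2.1.1)
    simpa using this
  · exact h.tendsto_lintegral_clip (φ := fun x => x ^ p * Real.log x) (measurable_rpow_mul_log p)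
      (((h.2.2.2.2 hpq).abs.add h.2.1.1).add (hconst |1 / p|))
      fun n t ht => abs_clip_rpow_mul_log_le n p (h.pos t ht)

end Truncation

/-! ### Transport to the unit interval -/

section Transport

variable {J : Set ℝ} {p q : ℝ} {f : ℝ → ℝ}

lemma IsBddInterval.preimage_kappa (hJ : IsBddInterval J) :
    IsBddInterval (kappa J ⁻¹' J) ∧ sInf (kappa J ⁻¹' J) = 0 ∧ sSup (kappa J ⁻¹' J) = 1 := by
  have hL := sub_pos.2 hJ.sInf_lt_sSup
  refine isBddInterval_of_Ioo_subset one_pos ?_ (fun s hs => ?_) fun s hs => ?_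
  · refine hJ.1.preimage_mono fun s t hst => ?_
    unfold kappa
    gcongr
  · apply hJ.Ioo_subset
    constructor <;> unfold kappa <;> nlinarith [hs.1, hs.2]
  · have := hJ.subset_Icc hs
    unfold kappa at this
    constructor
    · exact nonneg_of_mul_nonneg_left (by linarith [this.1]) hL
    · by_contra! h
      nlinarith [this.2]

lemma IsBddInterval.ae_eq_Ioc_preimage_kappa (hJ : IsBddInterval J) :
    kappa J ⁻¹' J =ᵐ[volume] Ioc (0 : ℝ) 1 := by
  obtain ⟨h, h0, h1⟩ := hJ.preimage_kappa
  simpa only [h0, h1] using h.ae_eq_Ioc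

lemma kappa_eq (J : Set ℝ) (s : ℝ) : kappa J s = sInf J + (sSup J - sInf J) * s := by
  rw [kappa, mul_comm]

lemma IsBddInterval.setIntegral_comp_kappa (hJ : IsBddInterval J) (h : ℝ → ℝ) :
    ∫ s in kappa J ⁻¹' J, h (kappa J s) = (sSup J - sInf J)⁻¹ * ∫ t in J, h t := by
  have hL := sub_pos.2 hJ.sInf_lt_sSup
  rw [setIntegral_congr_set hJ.ae_eq_Ioc_preimage_kappa, setIntegral_congr_set hJ.ae_eq_Ioc,
    ← intervalIntegral.integral_of_le zero_le_one,
    ← intervalIntegral.integral_of_le hJ.sInf_lt_sSup.le]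
  simp_rw [kappa_eq]
  rw [intervalIntegral.integral_comp_add_mul h hL.ne']
  simp

lemma IsBddInterval.integrableOn_comp_kappa (hJ : IsBddInterval J) (hf : IntegrableOn f J) :
    IntegrableOn (f ∘ kappa J) (kappa J ⁻¹' J) := by
  have hL := sub_pos.2 hJ.sInf_lt_sSup
  have h1 : IntervalIntegrable f volume (sInf J) (sSup J) := by
    rw [intervalIntegrable_iff_integrableOn_Ioc_of_le hJ.sInf_lt_sSup.le]
    exact hf.congr_set_ae hJ.ae_eq_Ioc.symm
  have h2 := (h1.comp_add_left (sInf J)).comp_mul_left (c := sSup J - sInf J)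
  rw [sub_self, zero_div, div_self hL.ne',
    intervalIntegrable_iff_integrableOn_Ioc_of_le zero_le_one] at h2
  refine IntegrableOn.congr_set_ae ?_ hJ.ae_eq_Ioc_preimage_kappa
  have e : f ∘ kappa J = fun s => f (sInf J + (sSup J - sInf J) * s) := by
    ext s; rw [Function.comp_apply, kappa_eq]
  rwa [e]

lemma InLC.comp_kappa (h : InLC J f) : InLC (kappa J ⁻¹' J) (f ∘ kappa J) := by
  obtain ⟨hJ, a, b, ha, hf, hmaps⟩ := h
  exact ⟨hJ.preimage_kappa.1, a, b, ha, hJ.integrableOn_comp_kappa hf, fun s hs => hmaps hs⟩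

/-- The change of variables multiplies every integral by the same factor, which cancels in the
quotient. -/
lemma IsBddInterval.integralGini_comp_kappa (hJ : IsBddInterval J) (p q : ℝ) (f : ℝ → ℝ) :
    integralGini p q (kappa J ⁻¹' J) (f ∘ kappa J) = integralGini p q J f := by
  have hL := inv_ne_zero (sub_pos.2 hJ.sInf_lt_sSup).ne'
  simp only [integralGini, Function.comp_apply]
  rw [hJ.setIntegral_comp_kappa (fun t => f t ^ p * Real.log (f t)),
    hJ.setIntegral_comp_kappa (fun t => f t ^ p), hJ.setIntegral_comp_kappa (fun t => f t ^ q),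
    mul_div_mul_left _ _ hL, mul_div_mul_left _ _ hL]

lemma IsBddInterval.volume_preimage_kappa (hJ : IsBddInterval J) :
    volume (kappa J ⁻¹' J) = 1 := by
  rw [measure_congr hJ.ae_eq_Ioc_preimage_kappa]; simp

end Transport

/-! ### Approximation by simple functions -/

section Approximation

variable {J : Set ℝ} {p q : ℝ} {f : ℝ → ℝ}

/-- The index of the cell that contains `x`, in the partition of `[m, m + L]` into `k + 1` cells. -/
noncomputable def cellIndex (m L : ℝ) (k : ℕ) (x : ℝ) : ℕ := min ⌊(x - m) * (k + 1) / L⌋₊ k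

lemma isSimpleOn_cellIndex (hJ : IsBddInterval J) (h : ℝ → ℝ) (k : ℕ) :
    IsSimpleOn J (fun x => h (cellIndex (sInf J) (sSup J - sInf J) k x)) (k + 1)
      (fun i => sInf J + (sSup J - sInf J) * i / (k + 1)) (fun i => h (i : ℕ)) := by
  have hL := sub_pos.2 hJ.sInf_lt_sSup
  set L := sSup J - sInf J with hLdef
  have hk : (0 : ℝ) < k + 1 := by positivity
  refine ⟨fun i j hij => ?_, by simp, ?_, fun i x hx h1 h2 => ?_⟩
  · have : ((i : ℕ) : ℝ) < (j : ℕ) := by exact_mod_cast hij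
    simp only
    gcongr
  · simp only [Fin.val_last, Nat.cast_add, Nat.cast_one]
    rw [mul_div_assoc, div_self hk.ne']; linarith
  · simp only [Fin.val_castSucc, Fin.val_succ, Nat.cast_add, Nat.cast_one] at h1 h2
    suffices hidx : cellIndex (sInf J) L k x = i by simp only [hidx]
    have h1' : ((i : ℕ) : ℝ) ≤ (x - sInf J) * (k + 1) / L := by
      have : L * i / (k + 1) ≤ x - sInf J := by linarith
      rw [div_le_iff₀ hk] at this
      rw [le_div_iff₀ hL]; linarith
    have hi := i.2
    rcases h2 with h2 | ⟨h2, -⟩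
    · have h2' : (x - sInf J) * (k + 1) / L < (i : ℕ) + 1 := by
        have : x - sInf J < L * (i + 1) / (k + 1) := by linarith
        rw [lt_div_iff₀ hk] at this
        rw [div_lt_iff₀ hL]; linarith
      rw [cellIndex, (Nat.floor_eq_iff ((Nat.cast_nonneg _).trans h1')).2 ⟨h1', h2'⟩]
      omega
    -- At the right end of `J` the floor is `k + 1`; the cap in `cellIndex` assigns this point to
    -- the last cell.
    · have h3 : (i : ℕ) = k := by
        have := congrArg Fin.val h2
        simpa using this
      rw [cellIndex, min_eq_right, h3]
      rw [h3] at h1'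
      exact Nat.le_floor h1'

lemma abs_sub_cellIndex_le {m L : ℝ} (hL : 0 < L) (k : ℕ) {x : ℝ} (hx : x ∈ Icc m (m + L)) :
    |x - (m + L * cellIndex m L k x / (k + 1))| ≤ L / (k + 1) := by
  have hk : (0 : ℝ) < k + 1 := by positivity
  have hy0 : 0 ≤ (x - m) * (k + 1) / L := by
    have := sub_nonneg.2 hx.1
    positivity
  have h1 : (cellIndex m L k x : ℝ) ≤ (x - m) * (k + 1) / L :=
    (Nat.cast_le.2 (min_le_left _ _)).trans (Nat.floor_le hy0)
  have h2 : (x - m) * (k + 1) / L ≤ cellIndex m L k x + 1 := by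
    rcases le_total ⌊(x - m) * (k + 1) / L⌋₊ k with h | h
    · rw [cellIndex, min_eq_left h]; exact (Nat.lt_floor_add_one _).le
    · rw [cellIndex, min_eq_right h, div_le_iff₀ hL, mul_comm]
      gcongr
      linarith [hx.2]
  rw [le_div_iff₀ hL] at h1
  rw [div_le_iff₀ hL] at h2
  rw [abs_le]
  constructor
  · have : (m + L * cellIndex m L k x / (k + 1)) - x ≤ L / (k + 1) := by
      have e : (m + L * cellIndex m L k x / (k + 1)) - x
        = (L * cellIndex m L k x - (x - m) * (k + 1)) / (k + 1) := by field_simp; ring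
      rw [e]
      gcongr
      linarith
    linarith
  · have e : x - (m + L * cellIndex m L k x / (k + 1))
        = ((x - m) * (k + 1) - L * cellIndex m L k x) / (k + 1) := by field_simp; ring
    rw [e]
    gcongr
    linarith

lemma abs_sub_clamp_le {α β x : ℝ} (hx : x ∈ Icc α β) (y : ℝ) :
    |x - max α (min β y)| ≤ |x - y| := by
  have h := abs_max_sub_max_le_abs (min β x) (min β y) α
  have h' := abs_min_sub_min_le_max β x β y
  rw [min_eq_right hx.2, max_eq_left hx.1, max_comm _ α] at h
  refine h.trans ?_
  rw [min_eq_right hx.2] at h'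
  simpa using h'

lemma abs_clamp_sub_clamp_le (α β x y : ℝ) :
    |max α (min β x) - max α (min β y)| ≤ |x - y| := by
  rw [max_comm α, max_comm α]
  refine (abs_max_sub_max_le_abs _ _ _).trans ?_
  simpa using abs_min_sub_min_le_max β x β y

/-- On a bounded interval an integrable bounded function is close in `L¹` to a simple function whose
values lie between the bounds. -/
lemma exists_isSimpleOn_lintegral_sub_lt (hJ : IsBddInterval J) (hf : IntegrableOn f J) {α β : ℝ}
    (hmaps : MapsTo f J (Icc α β)) {ε : ℝ} (hε : 0 < ε) :
    ∃ (g : ℝ → ℝ) (n : ℕ) (c : Fin (n + 1) → ℝ) (v : Fin n → ℝ), IsSimpleOn J g n c v ∧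
      MapsTo g J (Icc α β) ∧ ∫⁻ x in J, ‖f x - g x‖ₑ < ENNReal.ofReal ε := by
  have hL := sub_pos.2 hJ.sInf_lt_sSup
  set m := sInf J with hm
  set L := sSup J - m with hLdef
  have hJm := hJ.measurableSet
  have hvol : volume J = ENNReal.ofReal L := by
    rw [measure_congr hJ.ae_eq_Ioc, Real.volume_Ioc]
  obtain ⟨t₀, ht₀⟩ := hJ.nonempty
  have hαβ : α ≤ β := (hmaps ht₀).1.trans (hmaps ht₀).2
  obtain ⟨φ, hφs, hφ, hφc, -⟩ := ((integrable_indicator_iff hJm).2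
    hf).exists_hasCompactSupport_lintegral_sub_le (ε := ENNReal.ofReal (ε / 4)) (by simpa using hε)
  have hφu : UniformContinuous φ := hφs.uniformContinuous_of_continuous hφc
  -- Sampling `φ` with error `ε / (4 * L)` on an interval of length `L` costs `ε / 4` in `L¹`, as
  -- much as replacing `f` by `φ`.
  obtain ⟨η, hη, hφη⟩ := Metric.uniformContinuous_iff.1 hφu (ε / (4 * L)) (by positivity)
  obtain ⟨k, hk⟩ := exists_nat_gt (L / η)
  have hkη : L / (k + 1) < η := by
    rw [div_lt_iff₀ (by positivity)]
    rw [div_lt_iff₀ hη] at hk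
    nlinarith
  -- Clamping keeps the values in `[α, β]`; it is a contraction that fixes the values of `f`, so no
  -- distance grows.
  let h : ℝ → ℝ := fun x => max α (min β (φ x))
  refine ⟨fun x => h (m + L * cellIndex m L k x / (k + 1)), k + 1, _, _,
    isSimpleOn_cellIndex hJ (fun j => h (m + L * j / (k + 1))) k, fun x _ => ?_, ?_⟩
  · exact ⟨le_max_left _ _, max_le hαβ (min_le_left _ _)⟩
  · have hpt : ∀ x ∈ J, ‖f x - h (m + L * cellIndex m L k x / (k + 1))‖ₑ ≤
        ‖J.indicator f x - φ x‖ₑ + ENNReal.ofReal (ε / (4 * L)) := fun x hx => by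
      rw [indicator_of_mem hx, ← ofReal_norm, ← ofReal_norm, ← ENNReal.ofReal_add (norm_nonneg _)
        (by positivity)]
      refine ENNReal.ofReal_le_ofReal ?_
      have hxI : x ∈ Icc m (m + L) := by
        have := hJ.subset_Icc hx
        rwa [hLdef, add_sub_cancel]
      have h1 := abs_sub_clamp_le (hmaps hx) (φ x)
      have h2 := abs_clamp_sub_clamp_le α β (φ x) (φ (m + L * cellIndex m L k x / (k + 1)))
      have h3 := hφη ((abs_sub_cellIndex_le hL k hxI).trans_lt hkη)
      rw [Real.dist_eq] at h3
      rw [Real.norm_eq_abs, Real.norm_eq_abs]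
      have h4 := abs_sub_le (f x) (h x) (h (m + L * cellIndex m L k x / (k + 1)))
      simp only [h] at h4 ⊢
      linarith
    calc _ ≤ ∫⁻ x in J, (‖J.indicator f x - φ x‖ₑ + ENNReal.ofReal (ε / (4 * L))) :=
          setLIntegral_mono' hJm hpt
      _ = (∫⁻ x in J, ‖J.indicator f x - φ x‖ₑ) + ENNReal.ofReal (ε / (4 * L)) * volume J := by
          rw [lintegral_add_right _ measurable_const, setLIntegral_const]
      _ ≤ ENNReal.ofReal (ε / 4) + ENNReal.ofReal (ε / (4 * L)) * ENNReal.ofReal L := by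
          rw [hvol]
          gcongr
          exact (setLIntegral_le_lintegral _ _).trans hφ
      _ = ENNReal.ofReal (ε / 2) := by
          rw [← ENNReal.ofReal_mul (by positivity), ← ENNReal.ofReal_add (by positivity)
            (by positivity)]
          congr 1
          field_simp
          norm_num
      _ < ENNReal.ofReal ε := (ENNReal.ofReal_lt_ofReal_iff hε).2 (by linarith)

lemma RG_subset_Icc {α β : ℝ} (h : MapsTo f J (Icc α β)) : RG J f ⊆ Icc α β :=
  closure_minimal (convexHull_min (mapsTo_iff_image_subset.1 h) (convex_Icc α β)) isClosed_Icc

lemma ordConnected_RG : (RG J f).OrdConnected :=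
  ((convex_convexHull ℝ _).closure).ordConnected

lemma mem_RG {x : ℝ} (hx : x ∈ J) : f x ∈ RG J f :=
  subset_closure (subset_convexHull ℝ _ (mem_image_of_mem f hx))

/-- The approximation is taken between the exact infimum and supremum of `f` on `J`, not between `a`
and `b`, so that the range of `g` adds nothing to that of `f`. -/
lemma InLC.approxValues_nonempty (h : InLC J f) (M : WeightedOp) {ε : ℝ} (hε : 0 < ε) :
    (approxValues (Ioi 0) M J f ε).Nonempty := by
  obtain ⟨hJ, a, b, ha, hf, hmaps⟩ := h
  have hne : (f '' J).Nonempty := hJ.nonempty.image f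
  have hbb : BddBelow (f '' J) := ⟨a, by rintro _ ⟨x, hx, rfl⟩; exact (hmaps hx).1⟩
  have hba : BddAbove (f '' J) := ⟨b, by rintro _ ⟨x, hx, rfl⟩; exact (hmaps hx).2⟩
  have hα : a ≤ sInf (f '' J) :=
    le_csInf hne (by rintro _ ⟨x, hx, rfl⟩; exact (hmaps hx).1)
  have hmaps' : MapsTo f J (Icc (sInf (f '' J)) (sSup (f '' J))) := fun x hx =>
    ⟨csInf_le hbb (mem_image_of_mem f hx), le_csSup hba (mem_image_of_mem f hx)⟩
  obtain ⟨g, n, c, v, hg, hgm, hfg⟩ := exists_isSimpleOn_lintegral_sub_lt hJ hf hmaps' hε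
  refine ⟨_, g, n, c, v, hg, fun x hx => (ha.trans_le hα).trans_le (hgm hx).1, ?_, hfg, rfl⟩
  have hsub : RG J g ⊆ RG J f := (RG_subset_Icc hgm).trans fun y hy =>
    mem_closure_convexHull hne (fun u hu => (le_csInf hne hu).trans hy.1)
      fun u hu => hy.2.trans (csSup_le hne hu)
  rw [sdiff_eq_empty.2 hsub, measure_empty]
  simpa using hε

lemma approxValues_mono (I : Set ℝ) (M : WeightedOp) (J : Set ℝ) (f : ℝ → ℝ) :
    Monotone (approxValues I M J f) := by
  rintro ε δ hεδ y ⟨g, n, c, v, h1, h2, h3, h4, h5⟩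
  have := ENNReal.ofReal_le_ofReal hεδ
  exact ⟨g, n, c, v, h1, h2, h3.trans_le this, h4.trans_le this, h5⟩

/-- On an interval of unit length, a function that is `ε`-close to a function with values in
`[a, b]`, in `L¹` and in the sense of the range, has values in `[a - 2ε, b + 2ε]`. -/
lemma mapsTo_Icc_of_close (hJ : MeasurableSet J) (hvol : volume J = 1) {g : ℝ → ℝ} {a b ε : ℝ}
    (hf : MapsTo f J (Icc a b)) (hRG : volume (RG J g \ RG J f) < ENNReal.ofReal ε)
    (hfg : ∫⁻ x in J, ‖f x - g x‖ₑ < ENNReal.ofReal ε) :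
    MapsTo g J (Icc (a - 2 * ε) (b + 2 * ε)) := by
  have hε : 0 < ε := by
    by_contra! h
    rw [ENNReal.ofReal_of_nonpos h] at hfg
    exact not_lt_bot hfg
  -- On a set of measure one, a mean deviation below `ε` forces a pointwise deviation below `ε`
  -- somewhere.
  obtain ⟨x, hx, hxε⟩ : ∃ x ∈ J, |f x - g x| < ε := by
    by_contra! h
    have : ∫⁻ _ in J, ENNReal.ofReal ε ≤ ∫⁻ x in J, ‖f x - g x‖ₑ :=
      setLIntegral_mono' hJ fun x hx => by
        rw [← ofReal_norm]; exact ENNReal.ofReal_le_ofReal (h x hx)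
    rw [setLIntegral_const, hvol, mul_one] at this
    exact absurd hfg (not_lt.2 this)
  rw [abs_lt] at hxε
  have hfx := hf hx
  have hRGf := RG_subset_Icc hf
  intro y hy
  constructor
  · by_contra! hlt
    -- If `g y < a - 2ε`, this segment of length `ε` lies between `g y` and `g x > a - ε`, hence in
    -- the range interval of `g`, but it misses that of `f`.
    have hsub : Icc (a - 2 * ε) (a - ε) ⊆ RG J g \ RG J f := fun z hz =>
      ⟨ordConnected_RG.out (mem_RG hy) (mem_RG hx) ⟨hlt.le.trans hz.1, by linarith [hz.2, hfx.1]⟩,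
        fun hzf => by linarith [(hRGf hzf).1, hz.2]⟩
    have := measure_mono (μ := volume) hsub
    rw [Real.volume_Icc, show a - ε - (a - 2 * ε) = ε by ring] at this
    exact absurd hRG (not_lt.2 this)
  · by_contra! hlt
    have hsub : Icc (b + ε) (b + 2 * ε) ⊆ RG J g \ RG J f := fun z hz =>
      ⟨ordConnected_RG.out (mem_RG hx) (mem_RG hy) ⟨by linarith [hz.1, hfx.2], hz.2.trans hlt.le⟩,
        fun hzf => by linarith [(hRGf hzf).2, hz.1]⟩
    have := measure_mono (μ := volume) hsub
    rw [Real.volume_Icc, show b + 2 * ε - (b + ε) = ε by ring] at this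
    exact absurd hRG (not_lt.2 this)

/-- On the compact interval `[a, b]` the function `φ` is Lipschitz, so it transmits `L¹`
convergence. -/
lemma tendsto_lintegral_comp_sub (hJ : MeasurableSet J) {φ : ℝ → ℝ}
    (hφ : ContDiffOn ℝ 1 φ (Ioi 0)) {a b : ℝ} (ha : 0 < a) {F : ℕ → ℝ → ℝ}
    (hF : ∀ n, MapsTo (F n) J (Icc a b)) (hf : MapsTo f J (Icc a b))
    (h : Tendsto (fun n => ∫⁻ t in J, ‖F n t - f t‖ₑ) atTop (𝓝 0)) :
    Tendsto (fun n => ∫⁻ t in J, ‖φ (F n t) - φ (f t)‖ₑ) atTop (𝓝 0) := by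
  obtain ⟨K, hK⟩ := (hφ.mono fun x (hx : x ∈ Icc a b) => ha.trans_le hx.1).exists_lipschitzOnWith
    one_ne_zero (convex_Icc a b) isCompact_Icc
  have hlim : Tendsto (fun n => (K : ℝ≥0∞) * ∫⁻ t in J, ‖F n t - f t‖ₑ) atTop (𝓝 0) := by
    simpa using ENNReal.Tendsto.const_mul h (Or.inr (ENNReal.coe_ne_top (r := K)))
  refine tendsto_of_tendsto_of_tendsto_of_le_of_le tendsto_const_nhds hlim (fun _ => zero_le)
    fun n => ?_
  simp only
  rw [← lintegral_const_mul' _ _ ENNReal.coe_ne_top]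
  refine setLIntegral_mono' hJ fun t ht => ?_
  have := hK (hF n ht) (hf ht)
  rwa [edist_eq_enorm_sub, edist_eq_enorm_sub] at this

lemma giniTendsto_of_mapsTo_Icc (p q : ℝ) (hJ : MeasurableSet J) {a b : ℝ} (ha : 0 < a)
    {F : ℕ → ℝ → ℝ} (hF : ∀ n, MapsTo (F n) J (Icc a b)) (hf : MapsTo f J (Icc a b))
    (h : Tendsto (fun n => ∫⁻ t in J, ‖F n t - f t‖ₑ) atTop (𝓝 0)) : GiniTendsto p q J F f :=
  ⟨h, tendsto_lintegral_comp_sub hJ (contDiffOn_rpow p) ha hF hf h,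
    fun _ => tendsto_lintegral_comp_sub hJ (contDiffOn_rpow q) ha hF hf h,
    fun _ => tendsto_lintegral_comp_sub hJ (contDiffOn_rpow_mul_log p) ha hF hf h⟩

lemma InLC.approxValues_close (h : InLC J f) (hvol : volume J = 1) (p q : ℝ) {δ : ℝ}
    (hδ : 0 < δ) : ∃ ε > 0, ∀ y ∈ approxValues (Ioi 0) (gini p q) J f ε,
      |y - integralGini p q J f| < δ := by
  obtain ⟨hJ, a, b, ha, hf, hmaps⟩ := id h
  by_contra! hcon
  -- Counterexamples along a null sequence reduce the claim to sequential continuity; the factor `a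
  -- / 4` keeps all approximating functions above `a / 2`.
  choose y hy hyδ using fun n : ℕ => hcon (a / 4 * (1 / ((n : ℝ) + 1))) (by positivity)
  choose g k c v hg hpos hRG hfg hval using hy
  have hε (n : ℕ) : a / 4 * (1 / ((n : ℝ) + 1)) ≤ a / 4 := by
    have : 1 / ((n : ℝ) + 1) ≤ 1 := by
      rw [div_le_one (by positivity)]; linarith [(Nat.cast_nonneg n : (0 : ℝ) ≤ n)]
    nlinarith
  have hgm (n : ℕ) : MapsTo (g n) J (Icc (a / 2) (b + a / 2)) := fun x hx => by
    have := mapsTo_Icc_of_close hJ.measurableSet hvol hmaps (hRG n) (hfg n) hx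
    constructor <;> linarith [this.1, this.2, hε n]
  have hlim : Tendsto (fun n => ∫⁻ t in J, ‖g n t - f t‖ₑ) atTop (𝓝 0) := by
    have h0 : Tendsto (fun n : ℕ => ENNReal.ofReal (a / 4 * (1 / ((n : ℝ) + 1)))) atTop (𝓝 0) := by
      have := (tendsto_one_div_add_atTop_nhds_zero_nat (𝕜 := ℝ)).const_mul (a / 4)
      simpa [Function.comp_def] using (ENNReal.continuous_ofReal.tendsto _).comp this
    refine tendsto_of_tendsto_of_tendsto_of_le_of_le tendsto_const_nhds h0 (fun _ => zero_le)
      fun n => ?_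
    simp_rw [enorm_sub_rev (g n _)]
    exact (hfg n).le
  have hG := giniTendsto_of_mapsTo_Icc p q hJ.measurableSet (half_pos ha) hgm
    (fun x hx => ⟨by linarith [(hmaps hx).1], by linarith [(hmaps hx).2]⟩) hlim
  have ht := tendsto_integralGini (fun n => (hg n).giniDom p q hJ (hpos n)) (h.giniDom p q) hG
  obtain ⟨n, hn⟩ := ((Metric.tendsto_nhds.1 ht) δ hδ).exists
  rw [Real.dist_eq, (hg n).integralGini_eq p q hJ, ← hval] at hn
  exact absurd hn (not_lt.2 (hyδ n))

/-- Lower and upper limits along a family of nonempty sets of reals that shrinks to a point. -/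
lemma iSup_iInf_eq_and_iInf_iSup_eq {S : ℝ → Set ℝ} (hmono : Monotone S)
    (hne : ∀ ε, 0 < ε → (S ε).Nonempty) {m : ℝ}
    (hm : ∀ δ, 0 < δ → ∃ ε > 0, ∀ y ∈ S ε, |y - m| < δ) :
    (⨆ (ε : ℝ) (_ : 0 < ε), ⨅ y ∈ S ε, (y : EReal)) = m ∧
      (⨅ (ε : ℝ) (_ : 0 < ε), ⨆ y ∈ S ε, (y : EReal)) = m := by
  have key (ε : ℝ) (hε : 0 < ε) (δ : ℝ) (hδ : 0 < δ) : ∃ y ∈ S ε, |y - m| < δ := by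
    obtain ⟨ε', hε', h⟩ := hm δ hδ
    obtain ⟨y, hy⟩ := hne (min ε ε') (lt_min hε hε')
    exact ⟨y, hmono (min_le_left _ _) hy, h y (hmono (min_le_right _ _) hy)⟩
  refine ⟨le_antisymm ?_ ?_, le_antisymm ?_ ?_⟩
  · refine iSup₂_le fun ε hε => le_of_forall_gt_imp_ge_of_dense fun c hc => ?_
    obtain ⟨r, hmr, hrc⟩ := EReal.lt_iff_exists_real_btwn.1 hc
    obtain ⟨y, hy, hym⟩ := key ε hε (r - m) (sub_pos.2 (EReal.coe_lt_coe_iff.1 hmr))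
    refine (iInf₂_le y hy).trans (le_trans ?_ hrc.le)
    exact EReal.coe_le_coe_iff.2 (by linarith [(abs_lt.1 hym).2])
  · refine le_of_forall_lt_imp_le_of_dense fun c hc => ?_
    obtain ⟨r, hcr, hrm⟩ := EReal.lt_iff_exists_real_btwn.1 hc
    obtain ⟨ε, hε, h⟩ := hm (m - r) (sub_pos.2 (EReal.coe_lt_coe_iff.1 hrm))
    refine hcr.le.trans (le_iSup₂_of_le ε hε (le_iInf₂ fun y hy => ?_))
    exact EReal.coe_le_coe_iff.2 (by linarith [(abs_lt.1 (h y hy)).1])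
  · refine le_of_forall_gt_imp_ge_of_dense fun c hc => ?_
    obtain ⟨r, hmr, hrc⟩ := EReal.lt_iff_exists_real_btwn.1 hc
    obtain ⟨ε, hε, h⟩ := hm (r - m) (sub_pos.2 (EReal.coe_lt_coe_iff.1 hmr))
    refine (iInf₂_le_of_le ε hε (iSup₂_le fun y hy => ?_)).trans hrc.le
    exact EReal.coe_le_coe_iff.2 (by linarith [(abs_lt.1 (h y hy)).2])
  · refine le_iInf₂ fun ε hε => le_of_forall_lt_imp_le_of_dense fun c hc => ?_
    obtain ⟨r, hcr, hrm⟩ := EReal.lt_iff_exists_real_btwn.1 hc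
    obtain ⟨y, hy, hym⟩ := key ε hε (m - r) (sub_pos.2 (EReal.coe_lt_coe_iff.1 hrm))
    refine le_trans (le_trans hcr.le ?_) (le_iSup₂ y hy)
    exact EReal.coe_le_coe_iff.2 (by linarith [(abs_lt.1 hym).1])

theorem InLC.lowerMean_eq_and_upperMean_eq (h : InLC J f) (p q : ℝ) :
    lowerMean (Ioi 0) (gini p q) J f = (integralGini p q J f : EReal) ∧
      upperMean (Ioi 0) (gini p q) J f = (integralGini p q J f : EReal) := by
  refine iSup_iInf_eq_and_iInf_iSup_eq (approxValues_mono _ _ _ _)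
    (fun ε hε => h.comp_kappa.approxValues_nonempty _ hε) fun δ hδ => ?_
  rw [← h.1.integralGini_comp_kappa]
  exact h.comp_kappa.approxValues_close h.1.volume_preimage_kappa p q hδ

theorem isContinuousExtension_iff (p q : ℝ) (N : Set ℝ → (ℝ → ℝ) → ℝ) :
    IsContinuousExtension p q N ↔ ∀ J f, giniDom p q J f → N J f = integralGini p q J f := by
  constructor
  · rintro ⟨h1, h2⟩ J f hf
    have hF (n : ℕ) : giniDom p q J fun t => clip n (f t) := (hf.inLC_clip n).giniDom p q
    have hlim := h2 J (fun n t => clip n (f t)) f hF hf hf.giniTendsto_clip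
    have hlim' := tendsto_integralGini hF hf hf.giniTendsto_clip
    refine tendsto_nhds_unique hlim (hlim'.congr fun n => ?_)
    have hn := hf.inLC_clip n
    exact EReal.coe_injective ((hn.lowerMean_eq_and_upperMean_eq p q).1.symm.trans (h1 J _ hn).1)
  · intro h
    refine ⟨fun J f hf => ?_, fun J F f hF hf hFf => ?_⟩
    · rw [h J f (hf.giniDom p q)]
      exact hf.lowerMean_eq_and_upperMean_eq p q
    · simp_rw [h J f hf, h J _ (hF _)]
      exact tendsto_integralGini hF hf hFf

end Approximation

/-! ### Power inequalities -/

section Powers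

variable {p q : ℝ}

/-- Bernoulli's inequality, in a form that covers negative exponents. -/
lemma mul_rpow_le_mul_one_add (hp : p ≤ 1) {z : ℝ} (hz : 0 < z) :
    p * z ^ p ≤ p * (1 + p * (z - 1)) := by
  rcases le_total 0 p with h | h
  · have := rpow_one_add_le_one_add_mul_self (s := z - 1) (by linarith) h hp
    rw [add_sub_cancel] at this
    exact mul_le_mul_of_nonneg_left this h
  · refine mul_le_mul_of_nonpos_left ?_ h
    -- For `p ≤ 0`: `z^p = exp (p log z) ≥ 1 + p log z ≥ 1 + p (z - 1)`.
    have h1 := Real.log_le_sub_one_of_pos hz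
    have h2 := Real.add_one_le_exp (Real.log z * p)
    rw [Real.rpow_def_of_pos hz]
    nlinarith

/-- The tangent line of `z^p` at `m`. The factor `p` on both sides lets one inequality cover the
concave case `0 < p ≤ 1` and the convex case `p < 0`. -/
lemma mul_rpow_le_tangent (hp : p ≤ 1) {z m : ℝ} (hz : 0 < z) (hm : 0 < m) :
    p * z ^ p ≤ p * (m ^ p * (1 + p * (z / m - 1))) := by
  have h := mul_rpow_le_mul_one_add hp (div_pos hz hm)
  rw [Real.div_rpow hz.le hm.le] at h
  have hmp := Real.rpow_pos_of_pos hm p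
  calc p * z ^ p = m ^ p * (p * (z ^ p / m ^ p)) := by field_simp
    _ ≤ m ^ p * (p * (1 + p * (z / m - 1))) := by gcongr
    _ = _ := by ring

lemma le_of_mul_rpow_le (hp : p ≠ 0) {u v : ℝ} (hu : 0 < u) (hv : 0 < v)
    (h : p * u ^ p ≤ p * v ^ p) : u ≤ v := by
  rcases lt_or_gt_of_ne hp with h0 | h0
  · exact (Real.rpow_le_rpow_iff_of_neg hv hu h0).1 ((mul_le_mul_left_of_neg h0).1 h)
  · exact (Real.rpow_le_rpow_iff hu.le hv.le h0).1 (le_of_mul_le_mul_left h h0)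

/-- Jensen for two points: in the sum of the tangent bounds at the weighted mean `m` the linear
terms cancel. -/
lemma mul_add_rpow_le (hp : p ≤ 1) {α β x y : ℝ} (hα : 0 ≤ α) (hβ : 0 < β) (hx : 0 < x)
    (hy : 0 < y) :
    p * (α * y ^ p + β * x ^ p) ≤ p * ((α + β) * ((α * y + β * x) / (α + β)) ^ p) := by
  set m := (α * y + β * x) / (α + β) with hm
  have hαβ : 0 < α + β := by positivity
  have hm0 : 0 < m := by positivity
  have h1 := mul_le_mul_of_nonneg_left (mul_rpow_le_tangent hp hy hm0) hα
  have h2 := mul_le_mul_of_nonneg_left (mul_rpow_le_tangent hp hx hm0) hβ.le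
  have h3 : α * (y / m) + β * (x / m) = α + β := by
    rw [hm]; field_simp
  calc _ = α * (p * y ^ p) + β * (p * x ^ p) := by ring
    _ ≤ α * (p * (m ^ p * (1 + p * (y / m - 1)))) + β * (p * (m ^ p * (1 + p * (x / m - 1)))) :=
        add_le_add h1 h2
    _ = p * (m ^ p * ((α + β) + p * ((α * (y / m) + β * (x / m)) - (α + β)))) := by ring
    _ = _ := by rw [h3]; ring

/-- One step of the recursion behind Hardy's inequality for power means. -/
lemma powerMean_step (hp : p < 1) (hp0 : p ≠ 0) {σ τ x y u : ℝ} (hσ : 0 ≤ σ) (hτ : 0 < τ)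
    (hx : 0 < x) (hy : 0 < y) (hu : 0 < u) (hστ : σ + τ = 1)
    (h : u ^ p = σ * y ^ p + (1 - p) * τ * x ^ p) :
    (1 + (1 - p) * τ) * u ≤ σ * y + (1 - p) * τ * x := by
  have hp1 : 0 < 1 - p := by linarith
  set R := σ * y + (1 - p) * τ * x with hR
  set Z := σ + (1 - p) * τ with hZ
  set D := 1 + (1 - p) * τ with hD
  have hR0 : 0 < R := by positivity
  have hZ0 : 0 < Z := by positivity
  have hD0 : 0 < D := by positivity
  have h1 := mul_add_rpow_le hp.le hσ (mul_pos hp1 hτ) hx hy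
  rw [← h, ← hR, ← hZ] at h1
  -- Jensen compares `u` with the mean `R / Z` of total weight `Z`. Bernoulli at `D / Z` turns this
  -- into a comparison with `R / D`, the factor being exact because `Z + p (D - Z) = σ + τ = 1`.
  have h2 := mul_rpow_le_mul_one_add hp.le (div_pos hD0 hZ0)
  have h3 : Z * (p * (1 + p * (D / Z - 1))) = p := by
    have : D - Z = τ := by rw [hD, hZ]; linarith
    have h4 : Z + p * (D - Z) = 1 := by rw [this, hZ]; linarith
    calc _ = p * (Z + p * (D - Z)) := by field_simp
      _ = p := by rw [h4, mul_one]
  have h5 : p * u ^ p ≤ p * (R / D) ^ p := by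
    have e : R / Z = R / D * (D / Z) := by field_simp
    rw [e, Real.mul_rpow (by positivity) (by positivity)] at h1
    calc p * u ^ p ≤ (R / D) ^ p * (Z * (p * (D / Z) ^ p)) := by linarith
      _ ≤ (R / D) ^ p * (Z * (p * (1 + p * (D / Z - 1)))) := by gcongr
      _ = p * (R / D) ^ p := by rw [h3]; ring
  have := le_of_mul_rpow_le hp0 hu (div_pos hR0 hD0) h5
  rwa [le_div_iff₀ hD0, mul_comm] at this

/-- One step of the recursion behind Carleman's inequality. -/
lemma geomMean_step {σ τ x y u : ℝ} (hσ : 0 ≤ σ) (hτ : 0 < τ) (hx : 0 < x) (hy : 0 < y)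
    (hu : 0 < u) (hστ : σ + τ = 1) (h : Real.log u = σ * Real.log y + τ * (Real.log x - 1)) :
    (1 + τ) * u ≤ σ * y + τ * x := by
  set R := σ * y + τ * x with hR
  have hR0 : 0 < R := by positivity
  have h1 (z : ℝ) (hz : 0 < z) : Real.log z ≤ Real.log R + (z / R - 1) := by
    have := Real.log_le_sub_one_of_pos (div_pos hz hR0)
    rw [Real.log_div hz.ne' hR0.ne'] at this
    linarith
  have h2 : σ * (y / R) + τ * (x / R) = 1 := by
    calc _ = R / R := by rw [hR]; ring
      _ = 1 := div_self hR0.ne'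
  -- The `-τ` in the recursion for `log u` pays for the factor `1 + τ`.
  have h3 : Real.log (1 + τ) ≤ τ := by
    have := Real.log_le_sub_one_of_pos (show 0 < 1 + τ by linarith)
    linarith
  have h4 : Real.log ((1 + τ) * u) ≤ Real.log R := by
    rw [Real.log_mul (by positivity) hu.ne', h]
    have ha := mul_le_mul_of_nonneg_left (h1 y hy) hσ
    have hb := mul_le_mul_of_nonneg_left (h1 x hx) hτ.le
    have hc : Real.log R = (σ + τ) * Real.log R := by rw [hστ, one_mul]
    nlinarith
  exact (Real.log_le_log_iff (by positivity) hR0).1 h4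

/-- The Gini mean is a geometric mean of power means. -/
lemma div_rpow_le_of_powerMean_le (hp0 : 0 ≤ p) (hp : p < 1) (hq : q ≤ 0) (hqp : q < p)
    {A B T U V : ℝ} (hA : 0 ≤ A) (hT : 0 < T) (hU : 0 < U) (hV : 0 < V)
    (h1 : A ≤ T * U ^ p / (1 - p)) (h2 : T * V ^ q / (1 - q) ≤ B) :
    (A / B) ^ (1 / (p - q)) ≤
      ((1 - q) / (1 - p)) ^ (1 / (p - q)) * (p / (p - q) * U + -q / (p - q) * V) := by
  have hs : 0 < p - q := sub_pos.2 hqp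
  have hp1 : 0 < 1 - p := by linarith
  have hq1 : 0 < 1 - q := by linarith
  have hUp := Real.rpow_pos_of_pos hU p
  have hVq := Real.rpow_pos_of_pos hV q
  have h3 : A / B ≤ (1 - q) / (1 - p) * (U ^ p * V ^ (-q)) := by
    calc A / B ≤ (T * U ^ p / (1 - p)) / (T * V ^ q / (1 - q)) := by gcongr
      _ = _ := by rw [Real.rpow_neg hV.le]; field_simp
  calc (A / B) ^ (1 / (p - q)) ≤ ((1 - q) / (1 - p) * (U ^ p * V ^ (-q))) ^ (1 / (p - q)) := by
        have hB : 0 ≤ B := le_trans (by positivity) h2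
        gcongr
    _ = ((1 - q) / (1 - p)) ^ (1 / (p - q)) * (U ^ (p / (p - q)) * V ^ (-q / (p - q))) := by
        rw [Real.mul_rpow (by positivity) (by positivity),
          Real.mul_rpow (by positivity) (by positivity), ← Real.rpow_mul hU.le,
          ← Real.rpow_mul hV.le, mul_one_div, mul_one_div]
    _ ≤ _ := by
        gcongr
        refine Real.geom_mean_le_arith_mean2_weighted (by positivity) ?_ hU.le hV.le ?_
        · exact div_nonneg (by linarith) hs.le
        · field_simp
          ring

end Powers

/-! ### The discrete Hardy inequality -/

section DiscreteUpper

variable {p q : ℝ} {x w : ℕ → ℝ}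

/-- With `Λ n` the sum of the first `n` weights, the hypothesis reads `Λ (n+1) U (n+1) - Λ n U n ≤ k
w n (x n - U (n+1))`. Summation telescopes, and the boundary term `Λ N U N` is nonnegative. -/
lemma sum_mul_le_of_recursion {k : ℝ} (hk : 0 < k) {U : ℕ → ℝ} (hw : ∀ n, 0 < w n)
    (hU : ∀ n, 0 ≤ U n)
    (h : ∀ n, (∑ i ∈ Finset.range (n + 1), w i + k * w n) * U (n + 1) ≤
      (∑ i ∈ Finset.range n, w i) * U n + k * w n * x n) (N : ℕ) :
    ∑ n ∈ Finset.range N, w n * U (n + 1) ≤ ∑ n ∈ Finset.range N, w n * x n := by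
  have key : k * ∑ n ∈ Finset.range N, w n * U (n + 1) + (∑ i ∈ Finset.range N, w i) * U N ≤
      k * ∑ n ∈ Finset.range N, w n * x n := by
    induction N with
    | zero => simp
    | succ N ih =>
      have := h N
      rw [Finset.sum_range_succ _ N, Finset.sum_range_succ (fun n => w n * x n) N]
      linarith
  have h0 : 0 ≤ (∑ i ∈ Finset.range N, w i) * U N :=
    mul_nonneg (Finset.sum_nonneg fun i _ => (hw i).le) (hU N)
  exact le_of_mul_le_mul_left (by linarith) hk

/-- The power mean of order `p` of the first `n` terms, divided by its Hardy constant. -/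
noncomputable def scaledPowerMean (p : ℝ) (x w : ℕ → ℝ) (n : ℕ) : ℝ :=
  ((1 - p) * (∑ i ∈ Finset.range n, w i * x i ^ p) / ∑ i ∈ Finset.range n, w i) ^ (1 / p)

lemma sum_range_succ_pos {y : ℕ → ℝ} (hy : ∀ n, 0 < y n) (n : ℕ) :
    0 < ∑ i ∈ Finset.range (n + 1), y i :=
  Finset.sum_pos (fun i _ => hy i) ⟨0, by simp⟩

lemma scaledPowerMean_pos (hp : p < 1) (hx : ∀ n, 0 < x n) (hw : ∀ n, 0 < w n) (n : ℕ) :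
    0 < scaledPowerMean p x w (n + 1) :=
  Real.rpow_pos_of_pos (div_pos (mul_pos (by linarith) (sum_range_succ_pos
    (fun i => mul_pos (hw i) (Real.rpow_pos_of_pos (hx i) p)) n)) (sum_range_succ_pos hw n)) _

lemma scaledPowerMean_nonneg (hp : p < 1) (hx : ∀ n, 0 < x n) (hw : ∀ n, 0 < w n) (n : ℕ) :
    0 ≤ scaledPowerMean p x w n :=
  Real.rpow_nonneg (div_nonneg (mul_nonneg (by linarith) (Finset.sum_nonneg
    fun i _ => (mul_pos (hw i) (Real.rpow_pos_of_pos (hx i) p)).le))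
    (Finset.sum_nonneg fun i _ => (hw i).le)) _

lemma sum_eq_scaledPowerMean (hp : p < 1) (hx : ∀ n, 0 < x n) (hw : ∀ n, 0 < w n) (n : ℕ) :
    ∑ i ∈ Finset.range (n + 1), w i * x i ^ p =
      (∑ i ∈ Finset.range (n + 1), w i) * scaledPowerMean p x w (n + 1) ^ p / (1 - p) := by
  have hp1 : 0 < 1 - p := by linarith
  have hS := sum_range_succ_pos (fun i => mul_pos (hw i) (Real.rpow_pos_of_pos (hx i) p)) n
  have hΛ := sum_range_succ_pos hw n
  -- For `p = 0` both sides are the total weight, whatever value `scaledPowerMean` has there.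
  rcases eq_or_ne p 0 with rfl | hp0
  · simp
  · rw [scaledPowerMean, ← Real.rpow_mul (by positivity), one_div_mul_cancel hp0, Real.rpow_one]
    field_simp

/-- The `p`-th powers of consecutive scaled means satisfy exactly the linear relation that
`powerMean_step` requires, with `σ` and `τ` the shares of the old weights and of the new one. -/
lemma sum_mul_scaledPowerMean_le (hp : p < 1) (hp0 : p ≠ 0) (hx : ∀ n, 0 < x n)
    (hw : ∀ n, 0 < w n) (N : ℕ) :
    ∑ n ∈ Finset.range N, w n * scaledPowerMean p x w (n + 1) ≤
      ∑ n ∈ Finset.range N, w n * x n := by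
  have hp1 : 0 < 1 - p := by linarith
  refine sum_mul_le_of_recursion hp1 hw (scaledPowerMean_nonneg hp hx hw) (fun n => ?_) N
  set Λ := ∑ i ∈ Finset.range n, w i with hΛ
  have hΛ0 : 0 ≤ Λ := Finset.sum_nonneg fun i _ => (hw i).le
  have hΛ' : ∑ i ∈ Finset.range (n + 1), w i = Λ + w n := Finset.sum_range_succ _ _
  have hwn := hw n
  have hpos : 0 < Λ + w n := by positivity
  set u := scaledPowerMean p x w (n + 1) with hu
  have hS := sum_eq_scaledPowerMean hp hx hw n
  rw [hΛ', ← hu, Finset.sum_range_succ] at hS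
  have hu0 : 0 < u := scaledPowerMean_pos hp hx hw n
  -- The predecessor `y` is left free because for `n = 0` there is none: then `Λ = 0` and any
  -- positive `y` will do.
  have step (y : ℝ) (hy : 0 < y)
      (hS' : ∑ i ∈ Finset.range n, w i * x i ^ p = Λ * y ^ p / (1 - p)) :
      (Λ + w n + (1 - p) * w n) * u ≤ Λ * y + (1 - p) * w n * x n := by
    have hup : u ^ p = Λ / (Λ + w n) * y ^ p + (1 - p) * (w n / (Λ + w n)) * x n ^ p := by
      rw [hS'] at hS
      field_simp at hS ⊢
      linarith
    have := powerMean_step hp hp0 (div_nonneg hΛ0 hpos.le) (div_pos hwn hpos) (hx n) hy hu0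
      (by field_simp) hup
    calc _ = (Λ + w n) * ((1 + (1 - p) * (w n / (Λ + w n))) * u) := by field_simp
      _ ≤ (Λ + w n) * (Λ / (Λ + w n) * y + (1 - p) * (w n / (Λ + w n)) * x n) := by gcongr
      _ = _ := by field_simp
  rw [hΛ']
  cases n with
  | zero =>
    have : Λ = 0 := by simp [hΛ]
    simpa [this] using step 1 one_pos (by simp [this])
  | succ n => exact step _ (scaledPowerMean_pos hp hx hw n) (sum_eq_scaledPowerMean hp hx hw n)

/-- The geometric mean of the first `n` terms, divided by `e`. -/
noncomputable def scaledGeomMean (x w : ℕ → ℝ) (n : ℕ) : ℝ :=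
  Real.exp ((∑ i ∈ Finset.range n, w i * Real.log (x i)) / (∑ i ∈ Finset.range n, w i) - 1)

lemma sum_mul_scaledGeomMean_le (hx : ∀ n, 0 < x n) (hw : ∀ n, 0 < w n) (N : ℕ) :
    ∑ n ∈ Finset.range N, w n * scaledGeomMean x w (n + 1) ≤ ∑ n ∈ Finset.range N, w n * x n := by
  refine sum_mul_le_of_recursion (U := scaledGeomMean x w) one_pos hw
    (fun n => (Real.exp_pos _).le) (fun n => ?_) N
  set Λ := ∑ i ∈ Finset.range n, w i with hΛ
  have hΛ0 : 0 ≤ Λ := Finset.sum_nonneg fun i _ => (hw i).le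
  have hΛ' : ∑ i ∈ Finset.range (n + 1), w i = Λ + w n := Finset.sum_range_succ _ _
  have hwn := hw n
  have hpos : 0 < Λ + w n := by positivity
  have hlog : Real.log (scaledGeomMean x w (n + 1)) =
      Λ / (Λ + w n) * Real.log (scaledGeomMean x w n) +
        w n / (Λ + w n) * (Real.log (x n) - 1) := by
    rw [scaledGeomMean, scaledGeomMean, Real.log_exp, Real.log_exp, hΛ', ← hΛ,
      Finset.sum_range_succ]
    rcases hΛ0.eq_or_lt with h | h
    · have hn : n = 0 := by
        by_contra hn
        obtain ⟨m, rfl⟩ := Nat.exists_eq_succ_of_ne_zero hn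
        exact (sum_range_succ_pos hw m).ne h
      subst hn
      simp [← h]
      field_simp
    · field_simp
      ring
  have := geomMean_step (div_nonneg hΛ0 hpos.le) (div_pos hwn hpos) (hx n) (Real.exp_pos _)
    (Real.exp_pos _) (by field_simp) hlog
  rw [hΛ', one_mul]
  calc _ = (Λ + w n) * ((1 + w n / (Λ + w n)) * scaledGeomMean x w (n + 1)) := by field_simp
    _ ≤ (Λ + w n) * (Λ / (Λ + w n) * scaledGeomMean x w n + w n / (Λ + w n) * x n) := by
        gcongr
        exact this
    _ = _ := by field_simp

lemma tsum_ofReal_le_of_sum_le {a b : ℕ → ℝ} {C : ℝ} (hC : 0 ≤ C) (ha : ∀ n, 0 ≤ a n)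
    (hb : ∀ n, 0 ≤ b n)
    (h : ∀ N, ∑ n ∈ Finset.range N, a n ≤ C * ∑ n ∈ Finset.range N, b n) :
    ∑' n, ENNReal.ofReal (a n) ≤ ENNReal.ofReal C * ∑' n, ENNReal.ofReal (b n) := by
  refine ENNReal.tsum_le_of_sum_range_le fun N => ?_
  rw [← ENNReal.ofReal_sum_of_nonneg fun i _ => ha i]
  calc _ ≤ ENNReal.ofReal (C * ∑ n ∈ Finset.range N, b n) := ENNReal.ofReal_le_ofReal (h N)
    _ = ENNReal.ofReal C * ∑ n ∈ Finset.range N, ENNReal.ofReal (b n) := by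
        rw [ENNReal.ofReal_mul hC, ENNReal.ofReal_sum_of_nonneg fun i _ => hb i]
    _ ≤ _ := by
        gcongr
        exact ENNReal.sum_le_tsum _

/-- The set of all constants in the discrete Hardy inequality. -/
def hardyBounds (M : WeightedOp) : Set ℝ≥0∞ :=
  {H : ℝ≥0∞ | ∀ x w : ℕ → ℝ, (∀ n, 0 < x n ∧ x n ∈ Ioi (0 : ℝ)) → (∀ n, 0 < w n) →
    ∑' n : ℕ, ENNReal.ofReal
        (w n * M (n + 1) (fun i : Fin (n + 1) => x i) (fun i : Fin (n + 1) => w i)) ≤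
      H * ∑' n : ℕ, ENNReal.ofReal (w n * x n)}

lemma gini_of_ne (hpq : p ≠ q) (x w : ℕ → ℝ) (n : ℕ) :
    gini p q n (fun i : Fin n => x i) (fun i : Fin n => w i) =
      ((∑ i ∈ Finset.range n, w i * x i ^ p) / ∑ i ∈ Finset.range n, w i * x i ^ q) ^
        (1 / (p - q)) := by
  rw [gini, if_neg hpq, Finset.sum_range, Finset.sum_range]

lemma gini_self (p : ℝ) (x w : ℕ → ℝ) (n : ℕ) :
    gini p p n (fun i : Fin n => x i) (fun i : Fin n => w i) =
      Real.exp ((∑ i ∈ Finset.range n, w i * (x i ^ p * Real.log (x i))) /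
        ∑ i ∈ Finset.range n, w i * x i ^ p) := by
  rw [gini, if_pos rfl, Finset.sum_range, Finset.sum_range]

theorem mem_hardyBounds_gini (hp0 : 0 ≤ p) (hp : p < 1) (hq : q ≤ 0) (hqp : q < p) :
    ENNReal.ofReal (((1 - q) / (1 - p)) ^ (1 / (p - q))) ∈ hardyBounds (gini p q) := by
  intro x w hx hw
  replace hx : ∀ n, 0 < x n := fun n => (hx n).1
  have hs : 0 < p - q := sub_pos.2 hqp
  have hp1 : 0 < 1 - p := by linarith
  have hq1 : 0 < 1 - q := by linarith
  simp_rw [gini_of_ne hqp.ne']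
  have hS (r : ℝ) (n : ℕ) : 0 < ∑ i ∈ Finset.range (n + 1), w i * x i ^ r :=
    sum_range_succ_pos (fun i => mul_pos (hw i) (Real.rpow_pos_of_pos (hx i) r)) n
  refine tsum_ofReal_le_of_sum_le (by positivity)
    (fun n => mul_nonneg (hw n).le (Real.rpow_nonneg (div_pos (hS p n) (hS q n)).le _))
    (fun n => (mul_pos (hw n) (hx n)).le) fun N => ?_
  set C := ((1 - q) / (1 - p)) ^ (1 / (p - q)) with hC
  have hC0 : 0 ≤ C := by positivity
  -- The power mean inequality is not available for `r = 0`, but then the coefficient `s` vanishes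
  -- too.
  have hsum (r : ℝ) (hr : r < 1) (s : ℝ) (hs0 : 0 ≤ s) (hrs : r = 0 → s = 0) :
      s * ∑ n ∈ Finset.range N, w n * scaledPowerMean r x w (n + 1) ≤
        s * ∑ n ∈ Finset.range N, w n * x n := by
    rcases eq_or_ne r 0 with h | h
    · rw [hrs h, zero_mul, zero_mul]
    · exact mul_le_mul_of_nonneg_left (sum_mul_scaledPowerMean_le hr h hx hw N) hs0
  have h1 := hsum p hp (p / (p - q)) (by positivity) fun h => by rw [h, zero_div]
  have h2 := hsum q (by linarith) (-q / (p - q)) (div_nonneg (by linarith) hs.le)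
    fun h => by rw [h, neg_zero, zero_div]
  calc _ ≤ ∑ n ∈ Finset.range N, w n * (C * (p / (p - q) * scaledPowerMean p x w (n + 1) +
        -q / (p - q) * scaledPowerMean q x w (n + 1))) := by
        refine Finset.sum_le_sum fun n _ => mul_le_mul_of_nonneg_left ?_ (hw n).le
        exact div_rpow_le_of_powerMean_le hp0 hp hq hqp (hS p n).le (sum_range_succ_pos hw n)
          (scaledPowerMean_pos hp hx hw n) (scaledPowerMean_pos (by linarith) hx hw n)
          (sum_eq_scaledPowerMean hp hx hw n).le
          (sum_eq_scaledPowerMean (by linarith) hx hw n).ge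
    _ = C * (p / (p - q) * ∑ n ∈ Finset.range N, w n * scaledPowerMean p x w (n + 1) +
        -q / (p - q) * ∑ n ∈ Finset.range N, w n * scaledPowerMean q x w (n + 1)) := by
        rw [Finset.mul_sum, Finset.mul_sum, ← Finset.sum_add_distrib, Finset.mul_sum]
        exact Finset.sum_congr rfl fun n _ => by ring
    _ ≤ C * (p / (p - q) * ∑ n ∈ Finset.range N, w n * x n +
        -q / (p - q) * ∑ n ∈ Finset.range N, w n * x n) := by gcongr
    _ = C * ∑ n ∈ Finset.range N, w n * x n := by
        have : p / (p - q) + -q / (p - q) = 1 := by field_simp; ring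
        rw [← add_mul, this, one_mul]

theorem mem_hardyBounds_gini_zero_zero :
    ENNReal.ofReal (Real.exp 1) ∈ hardyBounds (gini 0 0) := by
  intro x w hx hw
  replace hx : ∀ n, 0 < x n := fun n => (hx n).1
  simp_rw [gini_self]
  refine tsum_ofReal_le_of_sum_le (Real.exp_pos _).le
    (fun n => mul_nonneg (hw n).le (Real.exp_pos _).le)
    (fun n => (mul_pos (hw n) (hx n)).le) fun N => ?_
  have := mul_le_mul_of_nonneg_left (sum_mul_scaledGeomMean_le hx hw N) (Real.exp_pos 1).le
  refine le_trans (le_of_eq ?_) this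
  rw [Finset.mul_sum]
  refine Finset.sum_congr rfl fun n _ => ?_
  simp only [Real.rpow_zero, one_mul, mul_one]
  rw [scaledGeomMean, mul_left_comm, ← Real.exp_add, add_sub_cancel]

end DiscreteUpper

/-! ### Lower bounds for the discrete Hardy constant -/

section DiscreteLower

variable {p q : ℝ}

/-- If the means of the harmonic sequence are asymptotically at least `C` times the sequence, then
no constant below `C` is admissible in Hardy's inequality. -/
lemma le_of_mem_hardyBounds {M : WeightedOp} {H : ℝ≥0∞} (hH : H ∈ hardyBounds M) {C : ℝ}
    {L : ℕ → ℝ} (hL : Tendsto L atTop (𝓝 C))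
    (hM : ∀ n : ℕ, L n ≤ (n + 1) *
      M (n + 1) (fun i : Fin (n + 1) => 1 / ((i : ℕ) + 1 : ℝ)) (fun _ => 1)) :
    ENNReal.ofReal C ≤ H := by
  by_contra! hlt
  have hHtop : H ≠ ⊤ := hlt.ne_top
  obtain ⟨h, hh, rfl⟩ : ∃ h : ℝ, 0 ≤ h ∧ H = ENNReal.ofReal h :=
    ⟨H.toReal, ENNReal.toReal_nonneg, (ENNReal.ofReal_toReal hHtop).symm⟩
  have hhC : h < C := (ENNReal.ofReal_lt_ofReal_iff_of_nonneg hh).1 hlt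
  set c := (C + h) / 2 with hc
  have hc0 : 0 ≤ c := by rw [hc]; linarith
  have hch : h < c := by rw [hc]; linarith
  obtain ⟨n₀, hn₀⟩ := eventually_atTop.1 (hL.eventually_const_lt (show c < C by rw [hc]; linarith))
  have hMc (n : ℕ) (hn : n₀ ≤ n) : c * (1 / ((n : ℝ) + 1)) ≤
      M (n + 1) (fun i : Fin (n + 1) => 1 / ((i : ℕ) + 1 : ℝ)) (fun _ => 1) := by
    rw [mul_one_div, div_le_iff₀ (by positivity), mul_comm]
    exact (hn₀ n hn).le.trans (hM n)
  have key (N : ℕ) (hN : n₀ ≤ N) :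
      c * ∑ n ∈ Finset.Ico n₀ N, 1 / ((n : ℝ) + 1) ≤
        h * (∑ n ∈ Finset.range N, 1 / ((n : ℝ) + 1) + 2) := by
    -- The harmonic sequence up to `N`, continued by a geometric tail that keeps it positive and
    -- adds at most `2` to the sum.
    let x : ℕ → ℝ := fun n => if n < N then 1 / ((n : ℝ) + 1) else (1 / 2) ^ n
    have hx (n : ℕ) : 0 < x n := by
      simp only [x]; split_ifs <;> positivity
    have h1 := hH x (fun _ => 1) (fun n => ⟨hx n, hx n⟩) (fun _ => one_pos)
    simp only [one_mul] at h1
    have h2 : ∑' n, ENNReal.ofReal (x n) ≤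
        ENNReal.ofReal (∑ n ∈ Finset.range N, 1 / ((n : ℝ) + 1) + 2) := by
      calc _ ≤ ∑' n, ((if n ∈ Finset.range N then ENNReal.ofReal (1 / ((n : ℝ) + 1)) else 0) +
            ENNReal.ofReal ((1 / 2) ^ n)) := by
            refine ENNReal.tsum_le_tsum fun n => ?_
            by_cases hn : n < N <;> simp [x, hn]
        _ = _ := by
            rw [ENNReal.tsum_add, ENNReal.ofReal_add (by positivity) (by positivity)]
            congr 1
            · rw [tsum_eq_sum (s := Finset.range N) fun n hn => if_neg hn,
                ENNReal.ofReal_sum_of_nonneg fun n _ => by positivity]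
              exact Finset.sum_congr rfl fun n hn => if_pos hn
            · rw [← ENNReal.ofReal_tsum_of_nonneg (fun n => by positivity) summable_geometric_two,
                tsum_geometric_two]
    have h3 : ENNReal.ofReal (c * ∑ n ∈ Finset.Ico n₀ N, 1 / ((n : ℝ) + 1)) ≤
        ∑' n : ℕ, ENNReal.ofReal (M (n + 1) (fun i : Fin (n + 1) => x i) fun _ => 1) := by
      rw [Finset.mul_sum, ENNReal.ofReal_sum_of_nonneg fun n _ => by positivity]
      refine le_trans (Finset.sum_le_sum fun n hn => ?_)
        (ENNReal.sum_le_tsum (Finset.Ico n₀ N))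
      rw [Finset.mem_Ico] at hn
      refine ENNReal.ofReal_le_ofReal ((hMc n hn.1).trans (le_of_eq ?_))
      congr 1
      ext i
      have : (i : ℕ) < N := by omega
      simp [x, this]
    have h4 := (h3.trans h1).trans (mul_le_mul_right h2 _)
    rw [← ENNReal.ofReal_mul hh] at h4
    exact (ENNReal.ofReal_le_ofReal_iff (by positivity)).1 h4
  have hT := Real.tendsto_sum_range_one_div_nat_succ_atTop
  set K := ∑ n ∈ Finset.range n₀, 1 / ((n : ℝ) + 1) with hK
  -- With `S` the harmonic sum up to `N`, `key` says `c (S - K) ≤ h (S + 2)`. As `h < c` and `S` is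
  -- unbounded, this fails for large `N`.
  obtain ⟨N, hN, hNn⟩ := ((hT.eventually_gt_atTop ((2 * h + c * K) / (c - h))).and
    (eventually_ge_atTop n₀)).exists
  have h1 := key N hNn
  have h2 := Finset.sum_range_add_sum_Ico (fun n : ℕ => 1 / ((n : ℝ) + 1)) hNn
  rw [← hK] at h2
  rw [div_lt_iff₀ (sub_pos.2 hch)] at hN
  rw [← h2] at h1 hN
  nlinarith

/-- The left side is the integral of `x^(-p)` over `[1, n + 1]`; each induction step is Bernoulli
with exponent `1 - p ∈ (0, 1]`. -/
lemma sum_rpow_ge (hp0 : 0 ≤ p) (hp : p < 1) (n : ℕ) :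
    (((n : ℝ) + 1) ^ (1 - p) - 1) / (1 - p) ≤
      ∑ i ∈ Finset.range n, (1 / ((i : ℝ) + 1)) ^ p := by
  have hp1 : 0 < 1 - p := by linarith
  rw [div_le_iff₀ hp1]
  induction n with
  | zero => simp
  | succ n ih =>
    rw [Finset.sum_range_succ, add_mul]
    have hm : (0 : ℝ) < n + 1 := by positivity
    have hb := rpow_one_add_le_one_add_mul_self (s := 1 / ((n : ℝ) + 1)) (p := 1 - p)
      (le_trans (by norm_num) (one_div_pos.2 hm).le) hp1.le (by linarith)
    have h1 : ((n : ℝ) + 1 + 1) ^ (1 - p) =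
        (n + 1) ^ (1 - p) * (1 + 1 / ((n : ℝ) + 1)) ^ (1 - p) := by
      rw [← Real.mul_rpow hm.le (by positivity)]
      congr 1
      field_simp
    have h2 : ((n : ℝ) + 1) ^ (1 - p) * (1 / ((n : ℝ) + 1)) = (1 / ((n : ℝ) + 1)) ^ p := by
      rw [Real.div_rpow zero_le_one hm.le, Real.one_rpow, Real.rpow_sub hm, Real.rpow_one]
      field_simp
    have h3 := mul_le_mul_of_nonneg_left hb (Real.rpow_nonneg hm.le (1 - p))
    push_cast
    rw [h1, ← h2]
    linarith

/-- The right side is the integral of `x^(-q)` over `[0, n + 1]`; here Bernoulli has an exponent `1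
- q ≥ 1`. -/
lemma sum_rpow_le (hq : q ≤ 0) (n : ℕ) :
    ∑ i ∈ Finset.range n, (1 / ((i : ℝ) + 1)) ^ q ≤ ((n : ℝ) + 1) ^ (1 - q) / (1 - q) := by
  have hq1 : 0 < 1 - q := by linarith
  rw [le_div_iff₀ hq1]
  induction n with
  | zero => simp
  | succ n ih =>
    rw [Finset.sum_range_succ, add_mul]
    have hm : (0 : ℝ) < n + 1 := by positivity
    have hb := one_add_mul_self_le_rpow_one_add (s := 1 / ((n : ℝ) + 1)) (p := 1 - q)
      (le_trans (by norm_num) (one_div_pos.2 hm).le) (by linarith)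
    have h1 : ((n : ℝ) + 1 + 1) ^ (1 - q) =
        (n + 1) ^ (1 - q) * (1 + 1 / ((n : ℝ) + 1)) ^ (1 - q) := by
      rw [← Real.mul_rpow hm.le (by positivity)]
      congr 1
      field_simp
    have h2 : ((n : ℝ) + 1) ^ (1 - q) * (1 / ((n : ℝ) + 1)) = (1 / ((n : ℝ) + 1)) ^ q := by
      rw [Real.div_rpow zero_le_one hm.le, Real.one_rpow, Real.rpow_sub hm, Real.rpow_one]
      field_simp
    have h3 := mul_le_mul_of_nonneg_left hb (Real.rpow_nonneg hm.le (1 - q))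
    push_cast
    rw [h1, ← h2]
    linarith

/-- Lower bound for the Gini means of the harmonic sequence. -/
lemma le_gini_harmonic {r : ℝ} (hr0 : 0 ≤ r) (hr : r < 1) (hrp : r ≤ p) (hq : q ≤ 0)
    (hqp : q < p) (n : ℕ) :
    ((1 - q) / (1 - r) * ((((n : ℝ) + 1) / (n + 1 + 1)) ^ (r - q) *
        (1 - (((n : ℝ) + 1) + 1) ^ (r - 1)))) ^ (1 / (p - q)) ≤
      (n + 1) * gini p q (n + 1) (fun i : Fin (n + 1) => 1 / ((i : ℕ) + 1 : ℝ)) (fun _ => 1) := by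
  have hs : 0 < p - q := sub_pos.2 hqp
  have hr1 : 0 < 1 - r := by linarith
  have hq1 : 0 < 1 - q := by linarith
  rw [gini_of_ne hqp.ne' (fun i : ℕ => 1 / ((i : ℝ) + 1)) (fun _ => 1) (n + 1)]
  simp only [one_mul]
  have hm : (0 : ℝ) < (n : ℝ) + 1 := by positivity
  have hm2 : (1 : ℝ) ≤ (n : ℝ) + 1 + 1 := by linarith
  -- For `i ≤ n` and `r ≤ p`, `(i+1)^(-p) ≥ (n+1)^(r-p) (i+1)^(-r)`. This brings exponents `p ≥ 1`
  -- within reach of `sum_rpow_ge`.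
  have hA : ((n : ℝ) + 1) ^ (r - p) * ((((n : ℝ) + 1 + 1) ^ (1 - r) - 1) / (1 - r)) ≤
      ∑ i ∈ Finset.range (n + 1), (1 / ((i : ℝ) + 1)) ^ p := by
    have h1 := sum_rpow_ge hr0 hr (n + 1)
    push_cast at h1
    refine (mul_le_mul_of_nonneg_left h1 (Real.rpow_nonneg hm.le _)).trans ?_
    rw [Finset.mul_sum]
    refine Finset.sum_le_sum fun i hi => ?_
    have hi0 : (0 : ℝ) < i + 1 := by positivity
    have hi1 : (i : ℝ) + 1 ≤ n + 1 := by
      have := Finset.mem_range.1 hi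
      exact_mod_cast this
    rw [one_div, Real.inv_rpow hi0.le, Real.inv_rpow hi0.le, ← Real.rpow_neg hi0.le,
      ← Real.rpow_neg hi0.le, show -p = (r - p) + -r by ring, Real.rpow_add hi0]
    gcongr ?_ * _
    exact Real.rpow_le_rpow_of_nonpos hi0 hi1 (by linarith)
  have hB := sum_rpow_le hq (n + 1)
  push_cast at hB
  have hB0 : 0 < ∑ i ∈ Finset.range (n + 1), (1 / ((i : ℝ) + 1)) ^ q :=
    sum_range_succ_pos (fun i => by positivity) n
  have hz : 0 ≤ ((n : ℝ) + 1 + 1) ^ (1 - r) - 1 :=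
    sub_nonneg.2 (Real.one_le_rpow hm2 hr1.le)
  set m := (n : ℝ) + 1 with hmdef
  have hm20 : 0 < m + 1 := by linarith
  have hkey : (1 - q) / (1 - r) * ((m / (m + 1)) ^ (r - q) * (1 - (m + 1) ^ (r - 1))) ≤
      m ^ (p - q) * ((∑ i ∈ Finset.range (n + 1), (1 / ((i : ℝ) + 1)) ^ p) /
        ∑ i ∈ Finset.range (n + 1), (1 / ((i : ℝ) + 1)) ^ q) := by
    have e : (1 - q) / (1 - r) * ((m / (m + 1)) ^ (r - q) * (1 - (m + 1) ^ (r - 1))) =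
        m ^ (p - q) * ((m ^ (r - p) * (((m + 1) ^ (1 - r) - 1) / (1 - r))) /
          ((m + 1) ^ (1 - q) / (1 - q))) := by
      have e1 : m ^ (p - q) * m ^ (r - p) = m ^ (r - q) := by
        rw [← Real.rpow_add hm]; ring_nf
      have e2 : (m + 1) ^ (r - 1) * (m + 1) ^ (1 - r) = 1 := by
        rw [← Real.rpow_add hm20]; simp
      have e3 : (m + 1) ^ (1 - q) = (m + 1) ^ (r - q) * (m + 1) ^ (1 - r) := by
        rw [← Real.rpow_add hm20]; ring_nf
      have := Real.rpow_pos_of_pos hm20 (1 - r)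
      have e4 : (m + 1) ^ (r - 1) = 1 / (m + 1) ^ (1 - r) := by
        rw [eq_div_iff this.ne', e2]
      rw [Real.div_rpow hm.le hm20.le, e3, e4, ← e1]
      field_simp
    rw [e]
    gcongr
  calc _ ≤ (m ^ (p - q) * ((∑ i ∈ Finset.range (n + 1), (1 / ((i : ℝ) + 1)) ^ p) /
        ∑ i ∈ Finset.range (n + 1), (1 / ((i : ℝ) + 1)) ^ q)) ^ (1 / (p - q)) := by
        refine Real.rpow_le_rpow ?_ hkey (by positivity)
        have : (m + 1) ^ (r - 1) ≤ 1 := Real.rpow_le_one_of_one_le_of_nonpos hm2 (by linarith)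
        have := sub_nonneg.2 this
        positivity
    _ = _ := by
        have hA0 : 0 ≤ ∑ i ∈ Finset.range (n + 1), (1 / ((i : ℝ) + 1)) ^ p :=
          Finset.sum_nonneg fun i _ => by positivity
        rw [Real.mul_rpow (by positivity) (by positivity), ← Real.rpow_mul hm.le,
          mul_one_div_cancel hs.ne', Real.rpow_one]

/-- For `p < 1` the choice `r = p` gives the sharp constant; for `p ≥ 1` one lets `r → 1` and the
bound diverges. -/
lemma le_hardyBounds_gini {r : ℝ} (hr0 : 0 ≤ r) (hr : r < 1) (hrp : r ≤ p) (hq : q ≤ 0)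
    (hqp : q < p) {H : ℝ≥0∞} (hH : H ∈ hardyBounds (gini p q)) :
    ENNReal.ofReal (((1 - q) / (1 - r)) ^ (1 / (p - q))) ≤ H := by
  refine le_of_mem_hardyBounds hH ?_ fun n => le_gini_harmonic hr0 hr hrp hq hqp n
  have hK : 0 < (1 - q) / (1 - r) := div_pos (by linarith) (by linarith)
  have hm : Tendsto (fun n : ℕ => (n : ℝ) + 1) atTop atTop :=
    tendsto_natCast_atTop_atTop.atTop_add tendsto_const_nhds
  have hm2 : Tendsto (fun n : ℕ => (n : ℝ) + 1 + 1) atTop atTop :=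
    hm.atTop_add tendsto_const_nhds
  have h1 : Tendsto (fun n : ℕ => ((n : ℝ) + 1) / (n + 1 + 1)) atTop (𝓝 1) := by
    have h := (tendsto_const_nhds (x := (1 : ℝ))).sub (tendsto_inv_atTop_zero.comp hm2)
    rw [sub_zero] at h
    refine h.congr fun n => ?_
    simp only [Function.comp]
    field_simp
    ring
  have h2 : Tendsto (fun n : ℕ => 1 - ((n : ℝ) + 1 + 1) ^ (r - 1)) atTop (𝓝 1) := by
    have h := (tendsto_rpow_neg_atTop (show 0 < 1 - r by linarith)).comp hm2
    have h := (tendsto_const_nhds (x := (1 : ℝ))).sub h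
    rw [sub_zero] at h
    refine h.congr fun n => ?_
    simp only [Function.comp, neg_sub]
  have h3 := ((h1.rpow_const (p := r - q) (Or.inl one_ne_zero)).mul h2).const_mul
    ((1 - q) / (1 - r))
  rw [Real.one_rpow, one_mul, mul_one] at h3
  exact h3.rpow_const (Or.inl hK.ne')

lemma tendsto_div_one_sub_rpow (hq : q ≤ 0) {s : ℝ} (hs : 0 < s) :
    Tendsto (fun n : ℕ => ((1 - q) / (1 - (1 - 1 / ((n : ℝ) + 1)))) ^ s) atTop atTop := by
  have hm : Tendsto (fun n : ℕ => (1 - q) * ((n : ℝ) + 1)) atTop atTop :=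
    (tendsto_natCast_atTop_atTop.atTop_add tendsto_const_nhds).const_mul_atTop (by linarith)
  refine ((tendsto_rpow_atTop hs).comp hm).congr fun n => ?_
  simp only [Function.comp]
  congr 1
  field_simp
  ring

lemma eq_top_of_mem_hardyBounds_gini (hp : 1 ≤ p) (hq : q ≤ 0) {H : ℝ≥0∞}
    (hH : H ∈ hardyBounds (gini p q)) : H = ⊤ := by
  have hqp : q < p := by linarith
  have h := ENNReal.tendsto_ofReal_atTop.comp
    (tendsto_div_one_sub_rpow hq (one_div_pos.2 (sub_pos.2 hqp)))
  refine top_le_iff.1 (le_of_tendsto' h fun n => ?_)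
  have h1 : 1 / ((n : ℝ) + 1) ≤ 1 := by
    rw [div_le_one (by positivity)]; linarith [(Nat.cast_nonneg n : (0 : ℝ) ≤ n)]
  have h2 : 0 < 1 / ((n : ℝ) + 1) := by positivity
  exact le_hardyBounds_gini (by linarith) (by linarith) (by linarith) hq hqp hH

/-- A weak Stirling bound: the right side is the integral of `log` over `[1, n + 1]`. -/
lemma sum_log_le (n : ℕ) :
    ∑ i ∈ Finset.range n, Real.log ((i : ℝ) + 1) ≤ (n + 1) * Real.log (n + 1) - n := by
  induction n with
  | zero => simp
  | succ n ih =>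
    rw [Finset.sum_range_succ]
    have hm : (0 : ℝ) < n + 1 := by positivity
    have h1 := Real.one_sub_inv_le_log_of_pos (show 0 < ((n : ℝ) + 1 + 1) / (n + 1) by positivity)
    rw [inv_div, Real.log_div (by positivity) hm.ne'] at h1
    have h2 : (1 : ℝ) - (n + 1) / (n + 1 + 1) = 1 / (n + 1 + 1) := by field_simp; ring
    rw [h2, div_le_iff₀ (by positivity)] at h1
    push_cast
    linarith

lemma exp_one_le_of_mem_hardyBounds {H : ℝ≥0∞} (hH : H ∈ hardyBounds (gini 0 0)) :
    ENNReal.ofReal (Real.exp 1) ≤ H := by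
  have hm : Tendsto (fun n : ℕ => (n : ℝ) + 1) atTop atTop :=
    tendsto_natCast_atTop_atTop.atTop_add tendsto_const_nhds
  -- This is what `sum_log_le` yields for `n + 1` times the geometric mean of `1, …, 1/(n+1)`; the
  -- exponent tends to `1`.
  refine le_of_mem_hardyBounds hH (L := fun n : ℕ => Real.exp (1 + (Real.log ((n : ℝ) + 1) -
    ((n + 1 + 1) / (n + 1) * Real.log (n + 1 + 1))))) ?_ fun n => ?_
  · have h1 : Tendsto (fun n : ℕ => Real.log (1 + 1 / ((n : ℝ) + 1))) atTop (𝓝 0) := by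
      have := (tendsto_one_div_add_atTop_nhds_zero_nat (𝕜 := ℝ)).const_add 1
      rw [add_zero] at this
      simpa [Function.comp_def] using (Real.continuousAt_log one_ne_zero).tendsto.comp this
    have h2 : Tendsto (fun x : ℝ => Real.log x / x) atTop (𝓝 0) :=
      Real.isLittleO_log_id_atTop.tendsto_div_nhds_zero
    have h3 : Tendsto (fun n : ℕ => Real.log ((n : ℝ) + 1) / (n + 1)) atTop (𝓝 0) := h2.comp hm
    have h4 := (h1.mul ((tendsto_one_div_add_atTop_nhds_zero_nat (𝕜 := ℝ)).const_add 1)).add h3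
    have h5 := (h4.neg.const_add 1)
    rw [zero_mul, add_zero, neg_zero, add_zero] at h5
    refine (Real.continuous_exp.tendsto 1).comp (h5.congr fun n => ?_)
    have hn : (0 : ℝ) < n + 1 := by positivity
    have : 1 + 1 / ((n : ℝ) + 1) = (n + 1 + 1) / (n + 1) := by field_simp
    rw [this, Real.log_div (by positivity) hn.ne']
    field_simp
    ring
  · rw [gini_self 0 (fun i : ℕ => 1 / ((i : ℝ) + 1)) (fun _ => 1) (n + 1)]
    have hn : (0 : ℝ) < n + 1 := by positivity
    have hlog : ∑ i ∈ Finset.range (n + 1), Real.log (1 / ((i : ℝ) + 1)) =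
        -∑ i ∈ Finset.range (n + 1), Real.log ((i : ℝ) + 1) := by
      rw [← Finset.sum_neg_distrib]
      exact Finset.sum_congr rfl fun i _ => by rw [one_div, Real.log_inv]
    simp only [Real.rpow_zero, one_mul, mul_one, Finset.sum_const, Finset.card_range,
      nsmul_eq_mul, hlog]
    have h1 := sum_log_le (n + 1)
    push_cast at h1 ⊢
    calc _ = (n + 1) * Real.exp (-((((n : ℝ) + 1 + 1) * Real.log (n + 1 + 1) - (n + 1)) /
          (n + 1))) := by
          rw [show (1 : ℝ) + (Real.log ((n : ℝ) + 1) -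
            ((n + 1 + 1) / (n + 1) * Real.log (n + 1 + 1))) = Real.log ((n : ℝ) + 1) +
            -((((n : ℝ) + 1 + 1) * Real.log (n + 1 + 1) - (n + 1)) / (n + 1)) by
              field_simp; ring, Real.exp_add, Real.exp_log hn]
      _ ≤ _ := by
          rw [neg_div]
          gcongr

/-- If the means of a summable sequence stay away from zero, no finite constant is admissible. -/
lemma eq_top_of_mem_hardyBounds {M : WeightedOp} {H : ℝ≥0∞} (hH : H ∈ hardyBounds M) {x : ℕ → ℝ}
    (hx : ∀ n, 0 < x n) (hs : Summable x) {m : ℝ} (hm : 0 < m)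
    (hM : Tendsto (fun n => M (n + 1) (fun i : Fin (n + 1) => x i) fun _ => 1) atTop (𝓝 m)) :
    H = ⊤ := by
  have h1 := hH x (fun _ => 1) (fun n => ⟨hx n, hx n⟩) (fun _ => one_pos)
  simp only [one_mul] at h1
  by_contra hHtop
  have h2 : ∑' n, ENNReal.ofReal (x n) ≠ ⊤ := by
    rw [← ENNReal.ofReal_tsum_of_nonneg (fun n => (hx n).le) hs]
    exact ENNReal.ofReal_ne_top
  have h3 := ENNReal.tendsto_atTop_zero_of_tsum_ne_top
    (ne_top_of_le_ne_top (ENNReal.mul_ne_top hHtop h2) h1)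
  have h4 := (ENNReal.continuous_ofReal.tendsto m).comp hM
  have := tendsto_nhds_unique h3 h4
  exact (ENNReal.ofReal_pos.2 hm).ne this

lemma eq_top_of_mem_hardyBounds_gini_of_pos (hp : 0 < p) (hq : 0 < q) {H : ℝ≥0∞}
    (hH : H ∈ hardyBounds (gini p q)) : H = ⊤ := by
  -- All positive powers of this sequence are geometric and summable, so numerator and denominator
  -- of the means converge, the latter to a positive limit.
  let x : ℕ → ℝ := fun n => Real.exp (-n)
  have hx (n : ℕ) : 0 < x n := Real.exp_pos _
  have hxr (r : ℝ) (n : ℕ) : x n ^ r = Real.exp (-r) ^ n := by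
    rw [← Real.exp_mul, ← Real.exp_nat_mul]; ring_nf
  have hlt (r : ℝ) (hr : 0 < r) : Real.exp (-r) < 1 := by simpa using hr
  have hsum (r : ℝ) (hr : 0 < r) : Summable fun n => x n ^ r := by
    simp_rw [hxr]
    exact summable_geometric_of_lt_one (Real.exp_pos _).le (hlt r hr)
  have hpos (r : ℝ) (hr : 0 < r) : 0 < ∑' n, x n ^ r :=
    (hsum r hr).tsum_pos (fun n => (Real.rpow_pos_of_pos (hx n) r).le) 0
      (Real.rpow_pos_of_pos (hx 0) r)
  have hx1 : Summable x := by simpa using hsum 1 one_pos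
  have hlim {y : ℕ → ℝ} (hy : Summable y) :
      Tendsto (fun n => ∑ i ∈ Finset.range (n + 1), y i) atTop (𝓝 (∑' n, y n)) :=
    hy.hasSum.tendsto_sum_nat.comp (tendsto_add_atTop_nat 1)
  rcases eq_or_ne p q with rfl | hpq
  · have hs : Summable fun n => x n ^ p * Real.log (x n) := by
      have : Summable fun n : ℕ => (n : ℝ) ^ 1 * Real.exp (-p) ^ n :=
        summable_pow_mul_geometric_of_norm_lt_one 1 (by
          rw [Real.norm_eq_abs, abs_of_pos (Real.exp_pos _)]; exact hlt p hp)
      refine this.neg.congr fun n => ?_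
      rw [hxr, Real.log_exp]; ring
    have hlim' := (Real.continuous_exp.tendsto _).comp
      ((hlim hs).div (hlim (hsum p hp)) (hpos p hp).ne')
    refine eq_top_of_mem_hardyBounds hH hx hx1 (Real.exp_pos _) (hlim'.congr fun n => ?_)
    simp only [gini_self p x (fun _ => 1), one_mul, Function.comp, Pi.div_apply]
  · have h0 := div_pos (hpos p hp) (hpos q hq)
    refine eq_top_of_mem_hardyBounds hH hx hx1 (Real.rpow_pos_of_pos h0 (1 / (p - q))) ?_
    simp_rw [gini_of_ne hpq x (fun _ => 1), one_mul]
    exact ((hlim (hsum p hp)).div (hlim (hsum q hq)) (hpos q hq).ne').rpow_const (Or.inl h0.ne')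

lemma gini_comm (p q : ℝ) {n : ℕ} {x w : Fin n → ℝ} (hx : ∀ i, 0 < x i) (hw : ∀ i, 0 < w i) :
    gini p q n x w = gini q p n x w := by
  by_cases hpq : p = q
  · subst hpq; rfl
  · have h (r : ℝ) : 0 ≤ ∑ i, w i * x i ^ r :=
      Finset.sum_nonneg fun i _ => (mul_pos (hw i) (Real.rpow_pos_of_pos (hx i) r)).le
    rw [gini, gini, if_neg hpq, if_neg (Ne.symm hpq)]
    exact div_rpow_one_div_sub_comm (h p) (h q)

lemma hardyBounds_gini_comm (p q : ℝ) : hardyBounds (gini p q) = hardyBounds (gini q p) := by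
  have h (p q : ℝ) : hardyBounds (gini p q) ⊆ hardyBounds (gini q p) := fun H hH x w hx hw => by
    refine le_trans (le_of_eq ?_) (hH x w hx hw)
    refine tsum_congr fun n => ?_
    rw [gini_comm q p (fun i => (hx i).1) fun i => hw i]
  exact (h p q).antisymm (h q p)

/-- Since `⊤ * 0 = 0`, this needs the sum on the right to be nonzero. -/
lemma top_mem_hardyBounds (M : WeightedOp) : ⊤ ∈ hardyBounds M := fun x w hx hw => by
  rw [ENNReal.top_mul]
  · exact le_top
  · intro h
    rw [ENNReal.tsum_eq_zero] at h
    have := ENNReal.ofReal_eq_zero.1 (h 0)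
    exact absurd (mul_pos (hw 0) (hx 0).1) (not_lt.2 this)

theorem isHardyConst_gini_aux (hp0 : 0 ≤ p) (hp : p < 1) (hq : q ≤ 0) (hqp : q < p) :
    IsHardyConst (Ioi 0) (gini p q) (ENNReal.ofReal (((1 - q) / (1 - p)) ^ (1 / (p - q)))) :=
  ⟨mem_hardyBounds_gini hp0 hp hq hqp, fun _ hH => le_hardyBounds_gini hp0 hp le_rfl hq hqp hH⟩

lemma isHardyConst_gini_comm {C : ℝ≥0∞} :
    IsHardyConst (Ioi 0) (gini p q) C ↔ IsHardyConst (Ioi 0) (gini q p) C := by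
  change IsLeast (hardyBounds (gini p q)) C ↔ IsLeast (hardyBounds (gini q p)) C
  rw [hardyBounds_gini_comm]

lemma div_one_sub_rpow_comm (hp : p < 1) (hq : q < 1) :
    ((1 - q) / (1 - p)) ^ (1 / (p - q)) = ((1 - p) / (1 - q)) ^ (1 / (q - p)) :=
  div_rpow_one_div_sub_comm (by linarith) (by linarith)

/-- The discrete Hardy constant of a Gini mean with `p ≠ q`, `min p q ≤ 0 ≤ max p q < 1`. -/
theorem isHardyConst_gini (hpq : p ≠ q) (hmin : min p q ≤ 0) (hmax0 : 0 ≤ max p q)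
    (hmax : max p q < 1) :
    IsHardyConst (Ioi 0) (gini p q) (ENNReal.ofReal (((1 - q) / (1 - p)) ^ (1 / (p - q)))) := by
  rcases lt_or_gt_of_ne hpq with h | h
  · rw [min_eq_left h.le] at hmin
    rw [max_eq_right h.le] at hmax0 hmax
    rw [isHardyConst_gini_comm, div_one_sub_rpow_comm (h.trans hmax) hmax]
    exact isHardyConst_gini_aux hmax0 hmax hmin h
  · rw [min_eq_right h.le] at hmin
    rw [max_eq_left h.le] at hmax0 hmax
    exact isHardyConst_gini_aux hmax0 hmax hmin h

/-- Carleman's inequality with weights, and its sharpness. -/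
theorem isHardyConst_gini_zero_zero :
    IsHardyConst (Ioi 0) (gini 0 0) (ENNReal.ofReal (Real.exp 1)) :=
  ⟨mem_hardyBounds_gini_zero_zero, fun _ hH => exp_one_le_of_mem_hardyBounds hH⟩

theorem isHardyConst_gini_top (h : 0 < min p q ∨ 1 ≤ max p q) :
    IsHardyConst (Ioi 0) (gini p q) ⊤ := by
  refine ⟨top_mem_hardyBounds _, fun H (hH : H ∈ hardyBounds (gini p q)) => top_le_iff.2 ?_⟩
  by_cases hmin : 0 < min p q
  · exact eq_top_of_mem_hardyBounds_gini_of_pos (lt_min_iff.1 hmin).1 (lt_min_iff.1 hmin).2 hH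
  · replace h := h.resolve_left hmin
    rw [not_lt] at hmin
    rcases le_total p q with hpq | hpq
    · rw [min_eq_left hpq] at hmin
      rw [max_eq_right hpq] at h
      rw [hardyBounds_gini_comm] at hH
      exact eq_top_of_mem_hardyBounds_gini h hmin hH
    · rw [min_eq_right hpq] at hmin
      rw [max_eq_left hpq] at h
      exact eq_top_of_mem_hardyBounds_gini h hmin hH

end DiscreteLower

/-! ### The integral Hardy inequality -/

section WeightedAverage

variable {r t : ℝ} {f : ℝ → ℝ}

/-- A weighted average of `f` over `[0, t)` whose integral over `t` is the integral of `f`. -/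
noncomputable def weightedAverage (r : ℝ) (f : ℝ → ℝ) (t : ℝ) : ℝ :=
  (1 - r) * t ^ (r - 2) * ∫ s in Ioo 0 t, s ^ (1 - r) * f s

lemma InL.integrableOn_rpow_mul (hf : InL (Ioi 0) (Ici 0) f) (hr : r < 1) (t : ℝ) :
    IntegrableOn (fun s => s ^ (1 - r) * f s) (Ioo 0 t) := by
  refine Integrable.bdd_mul (c := t ^ (1 - r))
    (hf.1.mono_set fun s hs => mem_Ici.2 hs.1.le) (measurable_rpow _).aestronglyMeasurable ?_
  refine (ae_restrict_iff' measurableSet_Ioo).2 (ae_of_all _ fun s hs => ?_)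
  rw [Real.norm_eq_abs, abs_of_nonneg (Real.rpow_nonneg hs.1.le _)]
  exact Real.rpow_le_rpow hs.1.le hs.2.le (by linarith)

lemma isBddInterval_Ioo {a b : ℝ} (hab : a < b) : IsBddInterval (Ioo a b) :=
  (isBddInterval_of_Ioo_subset hab ordConnected_Ioo subset_rfl Ioo_subset_Icc_self).1

lemma weightedAverage_pos (hf : InL (Ioi 0) (Ici 0) f) (hr : r < 1) (ht : 0 < t) :
    0 < weightedAverage r f t := by
  have h := setIntegral_pos_of_pos (isBddInterval_Ioo ht) (hf.integrableOn_rpow_mul hr t)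
    fun s hs => mul_pos (Real.rpow_pos_of_pos hs.1 _) (hf.2 (mem_Ici.2 hs.1.le))
  have : 0 < 1 - r := by linarith
  unfold weightedAverage
  positivity

lemma integral_eq_weightedAverage (hr : r < 1) (ht : 0 < t) (f : ℝ → ℝ) :
    ∫ s in Ioo 0 t, s ^ (1 - r) * f s = weightedAverage r f t * t ^ (2 - r) / (1 - r) := by
  have h1 : 0 < 1 - r := by linarith
  have h2 : t ^ (r - 2) * t ^ (2 - r) = 1 := by rw [← Real.rpow_add ht]; simp
  rw [weightedAverage, eq_div_iff h1.ne']
  linear_combination (-(1 - r) * ∫ s in Ioo 0 t, s ^ (1 - r) * f s) * h2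

/-- The integrand `(1 - r) t ^ (r - 2) s ^ (1 - r) f s` on `s < t`. -/
noncomputable def averageKernel (r : ℝ) (f : ℝ → ℝ) (t s : ℝ) : ℝ≥0∞ :=
  {x : ℝ × ℝ | x.2 < x.1}.indicator (fun x => ENNReal.ofReal ((1 - r) * x.1 ^ (r - 2) *
    x.2 ^ (1 - r)) * ENNReal.ofReal (f x.2)) (t, s)

lemma aemeasurable_averageKernel (hf : InL (Ioi 0) (Ici 0) f) :
    AEMeasurable (Function.uncurry (averageKernel r f))
      ((volume.restrict (Ioi 0)).prod (volume.restrict (Ioi 0))) := by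
  have hf' : AEMeasurable f (volume.restrict (Ioi 0)) :=
    (hf.1.mono_set Ioi_subset_Ici_self).aestronglyMeasurable.aemeasurable
  refine AEMeasurable.indicator (AEMeasurable.mul ?_ hf'.comp_snd.ennreal_ofReal)
    (measurableSet_lt measurable_snd measurable_fst)
  refine (Measurable.ennreal_ofReal ?_).aemeasurable
  exact (measurable_const.mul (measurable_fst.pow_const _)).mul (measurable_snd.pow_const _)

lemma ofReal_weightedAverage (hf : InL (Ioi 0) (Ici 0) f) (hr : r < 1) (ht : 0 < t) :
    ENNReal.ofReal (weightedAverage r f t) = ∫⁻ s in Ioi (0 : ℝ), averageKernel r f t s := by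
  have h1 : 0 < 1 - r := by linarith
  have hk (s : ℝ) : averageKernel r f t s = (Iio t).indicator (fun s => ENNReal.ofReal ((1 - r) *
      t ^ (r - 2) * s ^ (1 - r)) * ENNReal.ofReal (f s)) s := by
    by_cases h : s < t <;> simp [averageKernel, h]
  simp_rw [hk]
  rw [setLIntegral_indicator measurableSet_Iio, Iio_inter_Ioi, weightedAverage,
    ← integral_const_mul, ofReal_integral_eq_lintegral_ofReal]
  · refine setLIntegral_congr_fun measurableSet_Ioo fun s hs => ?_
    have := Real.rpow_nonneg hs.1.le (1 - r)
    rw [← ENNReal.ofReal_mul (by positivity)]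
    ring_nf
  · exact (hf.integrableOn_rpow_mul hr t).const_mul _
  · refine (ae_restrict_iff' measurableSet_Ioo).2 (ae_of_all _ fun s hs => ?_)
    have h2 : 0 < f s := hf.2 (mem_Ici.2 hs.1.le)
    have := Real.rpow_nonneg hs.1.le (1 - r)
    simp only [Pi.zero_apply]
    positivity

/-- The integral of `(1 - r) t^(r-2)` over `t > s` is `s^(r-1)`, which cancels the factor `s^(1-r)`.
-/
lemma lintegral_averageKernel (hr : r < 1) {s : ℝ} (hs : 0 < s) (f : ℝ → ℝ) :
    ∫⁻ t in Ioi (0 : ℝ), averageKernel r f t s = ENNReal.ofReal (f s) := by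
  have h1 : 0 < 1 - r := by linarith
  have hk (t : ℝ) : averageKernel r f t s = (Ioi s).indicator (fun t => ENNReal.ofReal ((1 - r) *
      t ^ (r - 2) * s ^ (1 - r)) * ENNReal.ofReal (f s)) t := by
    by_cases h : s < t <;> simp [averageKernel, h]
  simp_rw [hk]
  rw [setLIntegral_indicator measurableSet_Ioi, Ioi_inter_Ioi, max_eq_left hs.le,
    lintegral_mul_const']
  · rw [← ofReal_integral_eq_lintegral_ofReal]
    · rw [integral_mul_const, integral_const_mul, integral_Ioi_rpow_of_lt (by linarith) hs]
      have h2 : s ^ (r - 2 + 1) * s ^ (1 - r) = 1 := by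
        rw [← Real.rpow_add hs]; ring_nf; simp
      have h3 : (1 - r) * (-s ^ (r - 2 + 1) / (r - 2 + 1)) * s ^ (1 - r) = 1 := by
        have : r - 2 + 1 ≠ 0 := by linarith
        field_simp
        linear_combination (r - 1) * h2
      rw [h3, ENNReal.ofReal_one, one_mul]
    · exact ((integrableOn_Ioi_rpow_of_lt (by linarith) hs).const_mul _).mul_const _
    · refine (ae_restrict_iff' measurableSet_Ioi).2 (ae_of_all _ fun t ht => ?_)
      have : 0 < t := hs.trans ht
      simp only [Pi.zero_apply]
      positivity
  · exact ENNReal.ofReal_ne_top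

/-- Tonelli. This equality replaces the telescoping recursion of the discrete case. -/
lemma lintegral_weightedAverage (hf : InL (Ioi 0) (Ici 0) f) (hr : r < 1) :
    ∫⁻ t in Ioi (0 : ℝ), ENNReal.ofReal (weightedAverage r f t) =
      ∫⁻ t in Ioi (0 : ℝ), ENNReal.ofReal (f t) := by
  rw [setLIntegral_congr_fun measurableSet_Ioi fun t ht => ofReal_weightedAverage hf hr ht,
    lintegral_lintegral_swap (aemeasurable_averageKernel hf)]
  exact setLIntegral_congr_fun measurableSet_Ioi fun s hs => lintegral_averageKernel hr hs f

lemma aemeasurable_weightedAverage (hf : InL (Ioi 0) (Ici 0) f) (hr : r < 1) :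
    AEMeasurable (fun t => ENNReal.ofReal (weightedAverage r f t)) (volume.restrict (Ioi 0)) := by
  refine (aemeasurable_averageKernel (r := r) hf).lintegral_prod_right'.congr ?_
  exact (ae_restrict_iff' measurableSet_Ioi).2
    (ae_of_all _ fun t ht => (ofReal_weightedAverage hf hr ht).symm)

lemma integral_Ioo_rpow (hr : -1 < r) (ht : 0 < t) :
    ∫ s in Ioo 0 t, s ^ r = t ^ (r + 1) / (r + 1) := by
  rw [← integral_Ioc_eq_integral_Ioo, ← intervalIntegral.integral_of_le ht.le,
    integral_rpow (Or.inl hr), Real.zero_rpow (by linarith), sub_zero]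

lemma integrableOn_Ioo_rpow (hr : -1 < r) (ht : 0 < t) :
    IntegrableOn (fun s : ℝ => s ^ r) (Ioo 0 t) := by
  have := intervalIntegral.intervalIntegrable_rpow' (a := 0) (b := t) hr
  rw [intervalIntegrable_iff_integrableOn_Ioc_of_le ht.le] at this
  exact this.mono_set Ioo_subset_Ioc_self

/-- Hölder's inequality (reversed for `r < 0`) against the function `1 / s`. -/
lemma mul_integral_rpow_le (hf : InL (Ioi 0) (Ici 0) f) (hr : r < 1) (ht : 0 < t)
    (hfr : IntegrableOn (fun s => f s ^ r) (Ioo 0 t)) :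
    r * ∫ s in Ioo 0 t, f s ^ r ≤ r * (t * weightedAverage r f t ^ r / (1 - r)) := by
  have h1 : 0 < 1 - r := by linarith
  have hW := weightedAverage_pos hf hr ht
  set W := weightedAverage r f t with hWdef
  have hWt : 0 < W * t := by positivity
  have hi1 := integrableOn_Ioo_rpow (show -1 < -r by linarith) ht
  have hi2 := hf.integrableOn_rpow_mul hr t
  calc r * ∫ s in Ioo 0 t, f s ^ r = ∫ s in Ioo 0 t, r * f s ^ r := (integral_const_mul _ _).symm
    -- The tangent of `z^r` is taken at `z = W t / s`, the multiple of `1 / s` whose weighted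
    -- average at `t` is `W`; such functions are the equality case.
    _ ≤ ∫ s in Ioo 0 t, (r * (W * t) ^ r * (1 - r) * s ^ (-r) +
          r * (W * t) ^ r * r / (W * t) * (s ^ (1 - r) * f s)) := by
        refine setIntegral_mono_on (hfr.const_mul _)
          ((hi1.const_mul _).add (hi2.const_mul _)) measurableSet_Ioo fun s hs => ?_
        have hs0 := hs.1
        have hfs : 0 < f s := hf.2 (mem_Ici.2 hs0.le)
        refine (mul_rpow_le_tangent hr.le hfs (div_pos hWt hs0)).trans (le_of_eq ?_)
        rw [Real.div_rpow hWt.le hs0.le, Real.rpow_neg hs0.le, Real.rpow_sub hs0, Real.rpow_one]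
        have := Real.rpow_pos_of_pos hs0 r
        field_simp
        ring
    _ = r * (W * t) ^ r * (1 - r) * (t ^ (1 - r) / (1 - r)) +
          r * (W * t) ^ r * r / (W * t) * (W * t ^ (2 - r) / (1 - r)) := by
        rw [integral_add (hi1.const_mul _) (hi2.const_mul _), integral_const_mul,
          integral_const_mul, integral_Ioo_rpow (by linarith) ht, integral_eq_weightedAverage hr ht,
          ← hWdef]
        ring_nf
    _ = r * (t * W ^ r / (1 - r)) := by
        rw [Real.mul_rpow hW.le ht.le, Real.rpow_sub ht, Real.rpow_sub ht, Real.rpow_one,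
          Real.rpow_two]
        have := Real.rpow_pos_of_pos ht r
        field_simp
        ring

lemma integral_rpow_le_of_nonneg (hf : InL (Ioi 0) (Ici 0) f) (hr0 : 0 ≤ r) (hr : r < 1)
    (ht : 0 < t) (hfr : IntegrableOn (fun s => f s ^ r) (Ioo 0 t)) :
    ∫ s in Ioo 0 t, f s ^ r ≤ t * weightedAverage r f t ^ r / (1 - r) := by
  rcases hr0.eq_or_lt with rfl | h
  · simp [ht.le]
  · exact le_of_mul_le_mul_left (mul_integral_rpow_le hf hr ht hfr) h

lemma le_integral_rpow_of_nonpos (hf : InL (Ioi 0) (Ici 0) f) (hr : r ≤ 0)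
    (ht : 0 < t) (hfr : IntegrableOn (fun s => f s ^ r) (Ioo 0 t)) :
    t * weightedAverage r f t ^ r / (1 - r) ≤ ∫ s in Ioo 0 t, f s ^ r := by
  rcases hr.eq_or_lt with rfl | h
  · simp [ht.le]
  · exact (mul_le_mul_left_of_neg h).1 (mul_integral_rpow_le hf (by linarith) ht hfr)

lemma integrableOn_Ioo_log (ht : 0 < t) : IntegrableOn Real.log (Ioo 0 t) := by
  have := intervalIntegral.intervalIntegrable_log' (a := 0) (b := t)
  rw [intervalIntegrable_iff_integrableOn_Ioc_of_le ht.le] at this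
  exact this.mono_set Ioo_subset_Ioc_self

lemma integral_Ioo_log (ht : 0 < t) : ∫ s in Ioo 0 t, Real.log s = t * Real.log t - t := by
  rw [← integral_Ioc_eq_integral_Ioo, ← intervalIntegral.integral_of_le ht.le, integral_log]
  simp

/-- The logarithmic counterpart of `mul_integral_rpow_le`, with the tangent of `log` at `W t / s`;
the constant `1` gives rise to the factor `e`. -/
lemma integral_log_le (hf : InL (Ioi 0) (Ici 0) f) (ht : 0 < t)
    (hfl : IntegrableOn (fun s => Real.log (f s)) (Ioo 0 t)) :
    ∫ s in Ioo 0 t, Real.log (f s) ≤ t * (1 + Real.log (weightedAverage 0 f t)) := by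
  have hW := weightedAverage_pos hf zero_lt_one ht
  set W := weightedAverage 0 f t with hWdef
  have hWt : 0 < W * t := by positivity
  have hi1 := integrableOn_Ioo_log ht
  have hi2 := hf.integrableOn_rpow_mul one_pos t
  have hc : IntegrableOn (fun _ : ℝ => Real.log (W * t) - 1) (Ioo 0 t) :=
    integrableOn_const (by simp)
  have hi3 : IntegrableOn (fun s => Real.log (W * t) - 1 - Real.log s) (Ioo 0 t) := hc.sub hi1
  calc ∫ s in Ioo 0 t, Real.log (f s) ≤ ∫ s in Ioo 0 t, ((Real.log (W * t) - 1 - Real.log s) +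
          (W * t)⁻¹ * (s ^ (1 - 0 : ℝ) * f s)) := by
        refine setIntegral_mono_on hfl (hi3.add (hi2.const_mul _))
          measurableSet_Ioo fun s hs => ?_
        have hs0 := hs.1
        have hfs : 0 < f s := hf.2 (mem_Ici.2 hs0.le)
        have h := Real.log_le_sub_one_of_pos (show 0 < (W * t)⁻¹ * (s * f s) by positivity)
        rw [Real.log_mul (by positivity) (by positivity), Real.log_inv,
          Real.log_mul hs0.ne' hfs.ne'] at h
        rw [sub_zero, Real.rpow_one]
        linarith
    _ = t * (Real.log (W * t) - 1) - (t * Real.log t - t) +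
          (W * t)⁻¹ * (W * t ^ (2 - 0 : ℝ) / (1 - 0)) := by
        rw [integral_add hi3 (hi2.const_mul _), integral_sub hc hi1, integral_const_mul,
          integral_Ioo_log ht, integral_eq_weightedAverage one_pos ht, ← hWdef]
        simp [ht.le]
    _ = t * (1 + Real.log W) := by
        rw [Real.log_mul hW.ne' ht.ne', sub_zero, sub_zero, Real.rpow_two]
        field_simp
        ring

end WeightedAverage

/-! ### Upper bounds for the integral Hardy constant -/

section IntegralUpper

variable {p q : ℝ}

/-- The set of all constants in the integral Hardy inequality for a Gini mean. -/
def integralHardyBounds (p q : ℝ) : Set ℝ≥0∞ :=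
  {H : ℝ≥0∞ | ∀ f : ℝ → ℝ, InL (Ioi 0) (Ici 0) f → (∀ t : ℝ, 0 < t → giniDom p q (Ico 0 t) f) →
    ∫⁻ t in Ioi (0 : ℝ), ENNReal.ofReal (integralGini p q (Ico 0 t) f) ≤
      H * ∫⁻ t in Ioi (0 : ℝ), ENNReal.ofReal (f t)}

lemma lintegral_linearComb_weightedAverage {f : ℝ → ℝ} (hf : InL (Ioi 0) (Ici 0) f)
    {r s a b C : ℝ} (hr : r < 1) (hs : s < 1) (ha : 0 ≤ a) (hb : 0 ≤ b) (hab : a + b = 1)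
    (hC : 0 ≤ C) :
    ∫⁻ t in Ioi (0 : ℝ),
        ENNReal.ofReal (C * (a * weightedAverage r f t + b * weightedAverage s f t)) =
      ENNReal.ofReal C * ∫⁻ t in Ioi (0 : ℝ), ENNReal.ofReal (f t) := by
  have h1 : ∀ t ∈ Ioi (0 : ℝ),
      ENNReal.ofReal (C * (a * weightedAverage r f t + b * weightedAverage s f t)) =
        ENNReal.ofReal C * (ENNReal.ofReal a * ENNReal.ofReal (weightedAverage r f t) +
          ENNReal.ofReal b * ENNReal.ofReal (weightedAverage s f t)) := fun t ht => by
    have hr0 := (weightedAverage_pos hf hr ht).le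
    have hs0 := (weightedAverage_pos hf hs ht).le
    rw [ENNReal.ofReal_mul hC, ENNReal.ofReal_add (by positivity) (by positivity),
      ENNReal.ofReal_mul ha, ENNReal.ofReal_mul hb]
  rw [setLIntegral_congr_fun measurableSet_Ioi h1, lintegral_const_mul' _ _ ENNReal.ofReal_ne_top,
    lintegral_add_left' ((aemeasurable_weightedAverage hf hr).const_mul _),
    lintegral_const_mul' _ _ ENNReal.ofReal_ne_top, lintegral_const_mul' _ _ ENNReal.ofReal_ne_top,
    lintegral_weightedAverage hf hr, lintegral_weightedAverage hf hs, ← add_mul,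
    ← ENNReal.ofReal_add ha hb, hab, ENNReal.ofReal_one, one_mul]

theorem mem_integralHardyBounds (hp0 : 0 ≤ p) (hp : p < 1) (hq : q ≤ 0) (hqp : q < p) :
    ENNReal.ofReal (((1 - q) / (1 - p)) ^ (1 / (p - q))) ∈ integralHardyBounds p q := by
  intro f hf hdom
  have hs : 0 < p - q := sub_pos.2 hqp
  have hp1 : 0 < 1 - p := by linarith
  have hq1 : 0 < 1 - q := by linarith
  rw [← lintegral_linearComb_weightedAverage hf hp (show q < 1 by linarith)
    (show 0 ≤ p / (p - q) by positivity) (show 0 ≤ -q / (p - q) from div_nonneg (by linarith) hs.le)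
    (by field_simp; ring) (by positivity)]
  refine setLIntegral_mono' measurableSet_Ioi fun t (ht : 0 < t) => ENNReal.ofReal_le_ofReal ?_
  have h := hdom t ht
  have hA := h.integral_left_pos.le
  rw [integralGini, if_neg hqp.ne']
  rw [integral_Ico_eq_integral_Ioo, integral_Ico_eq_integral_Ioo] at *
  exact div_rpow_le_of_powerMean_le hp0 hp hq hqp hA ht (weightedAverage_pos hf hp ht)
    (weightedAverage_pos hf (by linarith) ht)
    (integral_rpow_le_of_nonneg hf hp0 hp ht (h.integrable_left.mono_set Ioo_subset_Ico_self))
    (le_integral_rpow_of_nonpos hf hq ht (h.integrable_right.mono_set Ioo_subset_Ico_self))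

theorem mem_integralHardyBounds_zero_zero :
    ENNReal.ofReal (Real.exp 1) ∈ integralHardyBounds 0 0 := by
  intro f hf hdom
  rw [← lintegral_linearComb_weightedAverage hf one_pos one_pos zero_le_one le_rfl (add_zero 1)
    (Real.exp_pos 1).le]
  refine setLIntegral_mono' measurableSet_Ioi fun t (ht : 0 < t) => ENNReal.ofReal_le_ofReal ?_
  have hl := (hdom t ht).2.2.2.2 rfl
  simp only [Real.rpow_zero, one_mul] at hl
  have hW := weightedAverage_pos hf one_pos ht
  have h := integral_log_le hf ht (hl.mono_set Ioo_subset_Ico_self)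
  rw [integralGini, if_pos rfl, integral_Ico_eq_integral_Ioo, integral_Ico_eq_integral_Ioo]
  simp only [Real.rpow_zero, one_mul, zero_mul, add_zero]
  rw [← Real.exp_log hW, ← Real.exp_add]
  gcongr
  rw [setIntegral_const, smul_eq_mul, mul_one, Real.volume_real_Ioo_of_le ht.le, sub_zero,
    div_le_iff₀ ht, mul_comm]
  exact h

/-! ### Nonpositive parameters: comparison with the geometric mean -/

/-- A Gini mean with nonpositive parameters is dominated by the geometric mean. -/
lemma giniDom.zero_zero {J : Set ℝ} {f : ℝ → ℝ} (hp : p ≤ 0) (hq : q ≤ 0)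
    (h : giniDom p q J f) : giniDom 0 0 J f := by
  have hlog : IntegrableOn (fun t => Real.log (f t)) J := by
    -- `log f` lies between two integrable functions: `log f ≤ f` from above and `-log f ≤ f^r /
    -- (-r)` from below.
    have key (r : ℝ) (hr : r < 0) (hfr : IntegrableOn (fun t => f t ^ r) J) :
        IntegrableOn (fun t => Real.log (f t)) J := by
      refine Integrable.mono' (h.2.1.1.add (hfr.const_mul (-r)⁻¹))
        (Real.measurable_log.comp_aemeasurable
          h.2.1.1.aestronglyMeasurable.aemeasurable).aestronglyMeasurable ?_
      refine (ae_restrict_iff' h.1.measurableSet).2 (ae_of_all _ fun t ht => ?_)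
      have hft := h.pos t ht
      have hr' : 0 < -r := by linarith
      have hfr := Real.rpow_pos_of_pos hft r
      have h1 := Real.log_le_sub_one_of_pos hft
      have h2 := Real.log_le_sub_one_of_pos hfr
      rw [Real.log_rpow hft] at h2
      have h3 : -Real.log (f t) ≤ (-r)⁻¹ * f t ^ r := by
        rw [inv_mul_eq_div, le_div_iff₀ hr']
        linarith
      have h4 : 0 < (-r)⁻¹ * f t ^ r := by positivity
      rw [Real.norm_eq_abs, Pi.add_apply]
      exact abs_le.2 ⟨by linarith, by linarith⟩
    rcases hp.lt_or_eq with hp | rfl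
    · exact key p hp h.integrable_left
    · rcases hq.lt_or_eq with hq | rfl
      · exact key q hq h.integrable_right
      · simpa using h.2.2.2.2 rfl
  refine ⟨h.1, h.2.1, ?_, fun h0 => (h0 rfl).elim, fun _ => ?_⟩
  · simpa using (integrableOn_const h.1.volume_lt_top.ne : IntegrableOn (fun _ : ℝ => (1 : ℝ)) J)
  · simpa using hlog

/-- With `E` the geometric mean, `u = log (f / E)` has integral zero, so it suffices that `e^(pu) -
e^(qu) ≤ (p - q) u` pointwise. Indeed the left side is at most `e^(pu) (p - q) u`, and `u (e^(pu) -
1) ≤ 0` for `p ≤ 0`. -/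
lemma integralGini_le_zero_zero_of_lt {J : Set ℝ} {f : ℝ → ℝ} (hp : p ≤ 0) (hqp : q < p)
    (h : giniDom p q J f) : integralGini p q J f ≤ integralGini 0 0 J f := by
  have h0 := h.zero_zero hp (hqp.le.trans hp)
  have hl := h0.2.2.2.2 rfl
  have hone := h0.integral_left_pos
  have hE := integralGini_pos h0
  set E := integralGini 0 0 J f with hEdef
  have hlogE : Real.log E = (∫ t in J, Real.log (f t)) / ∫ _ in J, (1 : ℝ) := by
    rw [hEdef, integralGini, if_pos rfl, Real.log_exp]
    simp
  simp only [Real.rpow_zero, one_mul] at hl hone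
  have hc : IntegrableOn (fun _ : ℝ => Real.log E) J := integrableOn_const h.1.volume_lt_top.ne
  have hzero : ∫ t in J, (p - q) * (Real.log (f t) - Real.log E) = 0 := by
    rw [integral_const_mul, integral_sub hl hc, ← mul_one (Real.log E), integral_const_mul, hlogE,
      div_mul_cancel₀ _ hone.ne', sub_self, mul_zero]
  have hle : E ^ (-p) * (∫ t in J, f t ^ p) - E ^ (-q) * ∫ t in J, f t ^ q ≤ 0 := by
    rw [← hzero, ← integral_const_mul, ← integral_const_mul,
      ← integral_sub (h.integrable_left.const_mul _) (h.integrable_right.const_mul _)]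
    refine setIntegral_mono_on
      ((h.integrable_left.const_mul _).sub (h.integrable_right.const_mul _))
      ((hl.sub hc).const_mul _) h.1.measurableSet fun t ht => ?_
    have hft := h.pos t ht
    have e (r : ℝ) : E ^ (-r) * f t ^ r = Real.exp (r * (Real.log (f t) - Real.log E)) := by
      rw [Real.rpow_def_of_pos hE, Real.rpow_def_of_pos hft, ← Real.exp_add]; ring_nf
    rw [e, e]
    set u := Real.log (f t) - Real.log E with hu
    have h1 := Real.add_one_le_exp ((q - p) * u)
    have h2 : Real.exp (q * u) = Real.exp (p * u) * Real.exp ((q - p) * u) := by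
      rw [← Real.exp_add]; ring_nf
    have h3 : u * (Real.exp (p * u) - 1) ≤ 0 := by
      rcases le_total 0 u with hu0 | hu0
      · exact mul_nonpos_of_nonneg_of_nonpos hu0
          (sub_nonpos.2 (Real.exp_le_one_iff.2 (mul_nonpos_of_nonpos_of_nonneg hp hu0)))
      · exact mul_nonpos_of_nonpos_of_nonneg hu0
          (sub_nonneg.2 (Real.one_le_exp (mul_nonneg_of_nonpos_of_nonpos hp hu0)))
    have h4 := mul_le_mul_of_nonneg_left h1 (Real.exp_pos (p * u)).le
    have h5 := mul_nonpos_of_nonneg_of_nonpos (sub_pos.2 hqp).le h3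
    rw [h2]
    linarith
  have hB := h.integral_right_pos
  have hs := sub_pos.2 hqp
  rw [integralGini, if_neg hqp.ne']
  calc _ ≤ (E ^ (p - q)) ^ (1 / (p - q)) := by
        have hA := h.integral_left_pos
        gcongr
        rw [div_le_iff₀ hB]
        have hEp := Real.rpow_pos_of_pos hE p
        have e1 : E ^ p * E ^ (-p) = 1 := by rw [← Real.rpow_add hE]; simp
        have e2 : E ^ p * E ^ (-q) = E ^ (p - q) := by rw [← Real.rpow_add hE]; ring_nf
        have := mul_nonpos_of_nonneg_of_nonpos hEp.le hle
        rw [mul_sub, ← mul_assoc, ← mul_assoc, e1, e2] at this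
        linarith
    _ = E := by rw [← Real.rpow_mul hE.le, mul_one_div_cancel hs.ne', Real.rpow_one]

/-- Chebyshev's argument: for `p ≤ 0` the weight `f^p` decreases in `u = log f`, so `(u - L) (e^(pu)
- e^(pL)) ≤ 0`, where `L` is the average of `u`. -/
lemma integralGini_self_le_zero_zero {J : Set ℝ} {f : ℝ → ℝ} (hp : p ≤ 0)
    (h : giniDom p p J f) : integralGini p p J f ≤ integralGini 0 0 J f := by
  have h0 := h.zero_zero hp hp
  have hl := h0.2.2.2.2 rfl
  have hone := h0.integral_left_pos
  have hA := h.integral_left_pos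
  rw [integralGini, if_pos rfl, integralGini, if_pos rfl]
  refine Real.exp_le_exp.2 ?_
  simp only [Real.rpow_zero, one_mul] at hl hone ⊢
  set L := (∫ t in J, Real.log (f t)) / ∫ _ in J, (1 : ℝ) with hL
  have hc (c : ℝ) : IntegrableOn (fun _ : ℝ => c) J := integrableOn_const h.1.volume_lt_top.ne
  have hzero : ∫ t in J, Real.exp (p * L) * (Real.log (f t) - L) = 0 := by
    rw [integral_const_mul, integral_sub hl (hc L), ← mul_one L, integral_const_mul, mul_one, hL,
      div_mul_cancel₀ _ hone.ne', sub_self, mul_zero]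
  have hle : (∫ t in J, f t ^ p * Real.log (f t)) - L * ∫ t in J, f t ^ p ≤ 0 := by
    rw [← hzero, ← integral_const_mul,
      ← integral_sub (h.2.2.2.2 rfl) (h.integrable_left.const_mul _)]
    refine setIntegral_mono_on ((h.2.2.2.2 rfl).sub (h.integrable_left.const_mul _))
      ((hl.sub (hc L)).const_mul _) h.1.measurableSet fun t ht => ?_
    have hft := h.pos t ht
    rw [Real.rpow_def_of_pos hft]
    set u := Real.log (f t)
    have : (u - L) * (Real.exp (u * p) - Real.exp (p * L)) ≤ 0 := by
      rcases le_total L u with hu | hu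
      · refine mul_nonpos_of_nonneg_of_nonpos (sub_nonneg.2 hu) (sub_nonpos.2 ?_)
        gcongr 1
        nlinarith
      · refine mul_nonpos_of_nonpos_of_nonneg (sub_nonpos.2 hu) (sub_nonneg.2 ?_)
        gcongr 1
        nlinarith
    linarith
  rw [div_le_iff₀ hA]
  linarith

lemma integralGini_le_zero_zero {J : Set ℝ} {f : ℝ → ℝ} (hp : p ≤ 0) (hq : q ≤ 0)
    (h : giniDom p q J f) : integralGini p q J f ≤ integralGini 0 0 J f := by
  rcases lt_trichotomy p q with hpq | rfl | hpq
  · rw [integralGini_comm h]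
    exact integralGini_le_zero_zero_of_lt hq hpq h.symm
  · exact integralGini_self_le_zero_zero hp h
  · exact integralGini_le_zero_zero_of_lt hp hpq h

theorem exp_one_mem_integralHardyBounds (hp : p ≤ 0) (hq : q ≤ 0) :
    ENNReal.ofReal (Real.exp 1) ∈ integralHardyBounds p q := fun f hf hdom =>
  (setLIntegral_mono' measurableSet_Ioi fun t ht => ENNReal.ofReal_le_ofReal
    (integralGini_le_zero_zero hp hq (hdom t ht))).trans
    (mem_integralHardyBounds_zero_zero f hf fun t ht => (hdom t ht).zero_zero hp hq)

lemma lintegral_ofReal_ne_zero {f : ℝ → ℝ} (hf : InL (Ioi 0) (Ici 0) f) :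
    ∫⁻ t in Ioi (0 : ℝ), ENNReal.ofReal (f t) ≠ 0 := by
  have hm : AEMeasurable (fun t => ENNReal.ofReal (f t)) (volume.restrict (Ioi 0)) :=
    (hf.1.mono_set Ioi_subset_Ici_self).aestronglyMeasurable.aemeasurable.ennreal_ofReal
  rw [Ne, lintegral_eq_zero_iff' hm]
  intro h
  have h1 : ∀ᵐ t ∂volume.restrict (Ioi (0 : ℝ)), False := by
    filter_upwards [h, ae_restrict_mem measurableSet_Ioi] with t ht ht0
    have : 0 < f t := hf.2 (mem_Ici.2 (mem_Ioi.1 ht0).le)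
    exact absurd (ENNReal.ofReal_eq_zero.1 ht) (not_le.2 this)
  have : (ae (volume.restrict (Ioi (0 : ℝ)))).NeBot := ae_restrict_neBot.2 (by simp)
  exact h1.exists.elim fun _ => id

lemma lintegral_ofReal_ne_top {f : ℝ → ℝ} (hf : InL (Ioi 0) (Ici 0) f) :
    ∫⁻ t in Ioi (0 : ℝ), ENNReal.ofReal (f t) ≠ ⊤ :=
  (hf.1.mono_set Ioi_subset_Ici_self).lintegral_lt_top.ne

lemma top_mem_integralHardyBounds (p q : ℝ) : ⊤ ∈ integralHardyBounds p q := fun f hf _ => by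
  rw [ENNReal.top_mul (lintegral_ofReal_ne_zero hf)]
  exact le_top

/-- Since the integral of `f` is neither zero nor infinite, each instance of the inequality is a
lower bound on `H` by a quotient, and such conditions pass to the infimum. -/
lemma sInf_mem_integralHardyBounds (p q : ℝ) :
    sInf (integralHardyBounds p q) ∈ integralHardyBounds p q := fun f hf hdom => by
  have h0 := lintegral_ofReal_ne_zero hf
  have h1 := lintegral_ofReal_ne_top hf
  rw [← ENNReal.div_le_iff h0 h1]
  refine le_sInf fun H hH => ?_
  rw [ENNReal.div_le_iff h0 h1]
  exact hH f hf hdom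

theorem exists_isIntegralHardyConst_le_exp_one (h : max p q ≤ 0) :
    ∃ C : ℝ≥0∞, C ≤ ENNReal.ofReal (Real.exp 1) ∧ C < ⊤ ∧
      IsIntegralHardyConst (Ioi 0) (giniDom p q) (integralGini p q) C := by
  obtain ⟨hp, hq⟩ := max_le_iff.1 h
  have hle := sInf_le (exp_one_mem_integralHardyBounds hp hq)
  exact ⟨_, hle, hle.trans_lt ENNReal.ofReal_lt_top, sInf_mem_integralHardyBounds p q,
    fun _ hH => sInf_le hH⟩

end IntegralUpper

/-! ### Lower bounds for the integral Hardy constant -/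

section IntegralLower

variable {p q a : ℝ}

/-- A function on `[0, ∞)` that is `s ^ (-a)` on `(0, 1)` and integrable at infinity. -/
noncomputable def powerTest (a s : ℝ) : ℝ :=
  -- The value at `0` only ensures positivity on `Ici 0`; the tail `s^(-2)` contributes `1` to the
  -- total integral.
  if s ≤ 0 then 1 else if s < 1 then s ^ (-a) else s ^ (-2 : ℝ)

lemma powerTest_of_mem_Ioo {s : ℝ} (hs : s ∈ Ioo (0 : ℝ) 1) : powerTest a s = s ^ (-a) := by
  rw [powerTest, if_neg (not_le.2 hs.1), if_pos hs.2]

lemma powerTest_of_one_le {s : ℝ} (hs : 1 ≤ s) : powerTest a s = s ^ (-2 : ℝ) := by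
  rw [powerTest, if_neg (by linarith), if_neg (not_lt.2 hs)]

lemma powerTest_pos (a s : ℝ) : 0 < powerTest a s := by
  unfold powerTest
  split_ifs with h1
  · exact one_pos
  · exact Real.rpow_pos_of_pos (not_le.1 h1) _
  · exact Real.rpow_pos_of_pos (not_le.1 h1) _

/-- Only the singularity at `0` requires a hypothesis: on `[1, t]` the composition is continuous,
and `{0}` is null. -/
lemma integrableOn_comp_powerTest {φ : ℝ → ℝ} (hφ : ContinuousOn φ (Ioi 0))
    (h : IntegrableOn (fun s => φ (s ^ (-a))) (Ioo 0 1)) (t : ℝ) :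
    IntegrableOn (fun s => φ (powerTest a s)) (Ico 0 t) := by
  have h0 : IntegrableOn (fun s => φ (powerTest a s)) {(0 : ℝ)} :=
    integrableOn_singleton (by simp) (by simp)
  have h1 : IntegrableOn (fun s => φ (powerTest a s)) (Ioo 0 1) :=
    h.congr_fun (fun s hs => by simp only [powerTest_of_mem_Ioo hs]) measurableSet_Ioo
  have h2 : IntegrableOn (fun s => φ (powerTest a s)) (Icc 1 t) := by
    have : ContinuousOn (fun s : ℝ => φ (s ^ (-2 : ℝ))) (Icc 1 t) := by
      refine hφ.comp (continuousOn_id.rpow_const fun s hs => Or.inl ?_) fun s hs => ?_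
      · exact (zero_lt_one.trans_le hs.1).ne'
      · exact Real.rpow_pos_of_pos (zero_lt_one.trans_le hs.1) _
    exact this.integrableOn_Icc.congr_fun
      (fun s hs => by simp only [powerTest_of_one_le hs.1]) measurableSet_Icc
  refine ((h0.union h1).union h2).mono_set fun s hs => ?_
  rcases hs.1.eq_or_lt with h | h
  · exact Or.inl (Or.inl h.symm)
  · rcases lt_or_ge s 1 with h' | h'
    · exact Or.inl (Or.inr ⟨h, h'⟩)
    · exact Or.inr ⟨h', hs.2.le⟩

lemma integrableOn_powerTest_rpow {r : ℝ} (hr : r * a < 1) (t : ℝ) :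
    IntegrableOn (fun s => powerTest a s ^ r) (Ico 0 t) := by
  refine integrableOn_comp_powerTest (φ := (· ^ r)) (contDiffOn_rpow r).continuousOn ?_ t
  refine (integrableOn_Ioo_rpow (r := -(r * a)) (by linarith) one_pos).congr_fun (fun s hs => ?_)
    measurableSet_Ioo
  simp only
  rw [← Real.rpow_mul hs.1.le]
  ring_nf

lemma inL_powerTest (ha : a < 1) : InL (Ioi 0) (Ici 0) (powerTest a) := by
  refine ⟨?_, fun s _ => powerTest_pos a s⟩
  have h1 : IntegrableOn (powerTest a) (Ico 0 2) := by
    simpa using integrableOn_powerTest_rpow (r := 1) (a := a) (by linarith) 2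
  have h2 : IntegrableOn (powerTest a) (Ioi 1) :=
    (integrableOn_Ioi_rpow_of_lt (a := -2) (by norm_num) one_pos).congr_fun
      (fun s hs => (powerTest_of_one_le (le_of_lt hs)).symm) measurableSet_Ioi
  refine (h1.union h2).mono_set fun s hs => ?_
  rcases lt_or_ge s 2 with h | h
  · exact Or.inl ⟨hs, h⟩
  · exact Or.inr (by linarith [mem_Ioi.1 (lt_of_lt_of_le one_lt_two h)] : (1 : ℝ) < s)

lemma giniDom_powerTest (hpq : p ≠ q) (ha : a < 1) (hp : p * a < 1) (hq : q * a < 1) {t : ℝ}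
    (ht : 0 < t) : giniDom p q (Ico 0 t) (powerTest a) :=
  ⟨isBddInterval_Ico ht, ⟨(inL_powerTest ha).1.mono_set Ico_subset_Ici_self,
    fun s _ => powerTest_pos a s⟩, integrableOn_powerTest_rpow hp t,
    fun _ => integrableOn_powerTest_rpow hq t, fun h => (hpq h).elim⟩

lemma giniDom_zero_zero_powerTest (ha : a < 1) {t : ℝ} (ht : 0 < t) :
    giniDom 0 0 (Ico 0 t) (powerTest a) := by
  refine ⟨isBddInterval_Ico ht, ⟨(inL_powerTest ha).1.mono_set Ico_subset_Ici_self,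
    fun s _ => powerTest_pos a s⟩, integrableOn_powerTest_rpow (by linarith) t,
    fun h => (h rfl).elim, fun _ => ?_⟩
  refine integrableOn_comp_powerTest (contDiffOn_rpow_mul_log 0).continuousOn ?_ t
  have h : IntegrableOn (fun s => -a * Real.log s) (Ioo 0 1) :=
    (integrableOn_Ioo_log one_pos).const_mul (-a)
  refine h.congr_fun (fun s hs => ?_) measurableSet_Ioo
  simp only [Real.rpow_zero, one_mul]
  rw [Real.log_rpow hs.1]

lemma lintegral_Ioo_powerTest (ha : a < 1) :
    ∫⁻ s in Ioo (0 : ℝ) 1, ENNReal.ofReal (powerTest a s) = ENNReal.ofReal (1 / (1 - a)) := by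
  rw [← ofReal_integral_eq_lintegral_ofReal
    ((inL_powerTest ha).1.mono_set fun s hs => mem_Ici.2 hs.1.le)
    (ae_of_all _ fun s => (powerTest_pos a s).le),
    setIntegral_congr_fun measurableSet_Ioo fun s hs => powerTest_of_mem_Ioo hs,
    integral_Ioo_rpow (by linarith) one_pos, Real.one_rpow, neg_add_eq_sub]

lemma lintegral_powerTest_le (ha : a < 1) :
    ∫⁻ s in Ioi (0 : ℝ), ENNReal.ofReal (powerTest a s) ≤
      ENNReal.ofReal ((2 - a) / (1 - a)) := by
  have h1 : 0 < 1 - a := by linarith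
  have h2 : ∫⁻ s in Ici (1 : ℝ), ENNReal.ofReal (powerTest a s) = ENNReal.ofReal 1 := by
    rw [setLIntegral_congr Ioi_ae_eq_Ici.symm, ← ofReal_integral_eq_lintegral_ofReal
      ((inL_powerTest ha).1.mono_set (Ioi_subset_Ici zero_le_one))
      (ae_of_all _ fun s => (powerTest_pos a s).le),
      setIntegral_congr_fun measurableSet_Ioi fun s hs => powerTest_of_one_le (le_of_lt hs),
      integral_Ioi_rpow_of_lt (by norm_num) one_pos]
    norm_num
  calc _ ≤ ∫⁻ s in Ioo (0 : ℝ) 1 ∪ Ici 1, ENNReal.ofReal (powerTest a s) :=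
        lintegral_mono_set fun s hs => (lt_or_ge s 1).imp (fun h => ⟨hs, h⟩) id
    _ ≤ _ := lintegral_union_le _ _ _
    _ = ENNReal.ofReal ((2 - a) / (1 - a)) := by
        rw [lintegral_Ioo_powerTest ha, h2, ← ENNReal.ofReal_add (by positivity) zero_le_one]
        congr 1
        field_simp
        ring

/-- A lower bound for the Hardy constant from a power function whose means are multiples of it. -/
lemma le_of_mem_integralHardyBounds {H : ℝ≥0∞} (hH : H ∈ integralHardyBounds p q) (ha : a < 1)
    (hdom : ∀ t : ℝ, 0 < t → giniDom p q (Ico 0 t) (powerTest a)) {c : ℝ} (hc : 0 ≤ c)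
    (hG : ∀ t ∈ Ioo (0 : ℝ) 1, integralGini p q (Ico 0 t) (powerTest a) = c * t ^ (-a)) :
    ENNReal.ofReal (c / (2 - a)) ≤ H := by
  have h1 : 0 < 1 - a := by linarith
  have h2 : 0 < 2 - a := by linarith
  rcases eq_or_ne H ⊤ with rfl | hHtop
  · exact le_top
  obtain ⟨h, hh, rfl⟩ : ∃ h : ℝ, 0 ≤ h ∧ H = ENNReal.ofReal h :=
    ⟨H.toReal, ENNReal.toReal_nonneg, (ENNReal.ofReal_toReal hHtop).symm⟩
  -- Means over `[0, t)` with `t ≥ 1` are discarded. The right side carries the tail: `1 / (1 - a) +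
  -- 1 = (2 - a) / (1 - a)`.
  have key : ENNReal.ofReal (c * (1 / (1 - a))) ≤ ENNReal.ofReal (h * ((2 - a) / (1 - a))) := by
    rw [ENNReal.ofReal_mul hc, ENNReal.ofReal_mul hh, ← lintegral_Ioo_powerTest ha,
      ← lintegral_const_mul' _ _ ENNReal.ofReal_ne_top]
    calc _ = ∫⁻ t in Ioo (0 : ℝ) 1, ENNReal.ofReal (integralGini p q (Ico 0 t) (powerTest a)) :=
          setLIntegral_congr_fun measurableSet_Ioo fun t ht => by
            rw [hG t ht, ← ENNReal.ofReal_mul hc, powerTest_of_mem_Ioo ht]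
      _ ≤ ∫⁻ t in Ioi (0 : ℝ), ENNReal.ofReal (integralGini p q (Ico 0 t) (powerTest a)) :=
          lintegral_mono_set Ioo_subset_Ioi_self
      _ ≤ ENNReal.ofReal h * ∫⁻ t in Ioi (0 : ℝ), ENNReal.ofReal (powerTest a t) :=
          hH _ (inL_powerTest ha) hdom
      _ ≤ _ := by
          gcongr
          exact lintegral_powerTest_le ha
  have h3 := (ENNReal.ofReal_le_ofReal_iff (by positivity)).1 key
  refine ENNReal.ofReal_le_ofReal ?_
  rw [div_le_iff₀ h2]
  have h4 := mul_le_mul_of_nonneg_right h3 h1.le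
  field_simp at h4
  exact h4

lemma integral_powerTest_rpow {r t : ℝ} (hr : r * a < 1) (ht : t ∈ Ioo (0 : ℝ) 1) :
    ∫ s in Ico 0 t, powerTest a s ^ r = t ^ (1 - r * a) / (1 - r * a) := by
  have h : EqOn (fun s => powerTest a s ^ r) (fun s => s ^ (-(r * a))) (Ioo 0 t) := fun s hs => by
    simp only
    rw [powerTest_of_mem_Ioo ⟨hs.1, hs.2.trans ht.2⟩, ← Real.rpow_mul hs.1.le]
    ring_nf
  rw [integral_Ico_eq_integral_Ioo, setIntegral_congr_fun measurableSet_Ioo h,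
    integral_Ioo_rpow (by linarith) ht.1, neg_add_eq_sub]

lemma integralGini_powerTest (hqp : q < p) (hp : p * a < 1) (hq : q * a < 1) {t : ℝ}
    (ht : t ∈ Ioo (0 : ℝ) 1) :
    integralGini p q (Ico 0 t) (powerTest a) =
      ((1 - q * a) / (1 - p * a)) ^ (1 / (p - q)) * t ^ (-a) := by
  have h1 : 0 < 1 - p * a := by linarith
  have h2 : 0 < 1 - q * a := by linarith
  have ht0 := ht.1
  have hs : p - q ≠ 0 := (sub_pos.2 hqp).ne'
  have e : t ^ (1 - p * a) / (1 - p * a) / (t ^ (1 - q * a) / (1 - q * a)) =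
      (1 - q * a) / (1 - p * a) * t ^ (-(a * (p - q))) := by
    have : t ^ (1 - p * a) = t ^ (1 - q * a) * t ^ (-(a * (p - q))) := by
      rw [← Real.rpow_add ht0]; ring_nf
    rw [this]
    have := Real.rpow_pos_of_pos ht0 (1 - q * a)
    field_simp
  rw [integralGini, if_neg hqp.ne', integral_powerTest_rpow hp ht, integral_powerTest_rpow hq ht,
    e, Real.mul_rpow (by positivity) (by positivity), ← Real.rpow_mul ht0.le]
  congr 2
  field_simp

lemma integralGini_zero_zero_powerTest {t : ℝ} (ht : t ∈ Ioo (0 : ℝ) 1) :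
    integralGini 0 0 (Ico 0 t) (powerTest a) = Real.exp a * t ^ (-a) := by
  have ht0 := ht.1
  have h : EqOn (fun s => Real.log (powerTest a s)) (fun s => -a * Real.log s) (Ioo 0 t) :=
    fun s hs => by
      simp only
      rw [powerTest_of_mem_Ioo ⟨hs.1, hs.2.trans ht.2⟩, Real.log_rpow hs.1]
  rw [integralGini, if_pos rfl]
  simp only [Real.rpow_zero, one_mul]
  rw [integral_Ico_eq_integral_Ioo, setIntegral_congr_fun measurableSet_Ioo h,
    integral_const_mul, integral_Ioo_log ht0, setIntegral_const, smul_eq_mul, mul_one,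
    Real.volume_real_Ico_of_le ht0.le, sub_zero, Real.rpow_def_of_pos ht0, ← Real.exp_add]
  congr 1
  field_simp
  ring

lemma le_integralHardyBounds (hq : q ≤ 0) (hqp : q < p) {H : ℝ≥0∞}
    (hH : H ∈ integralHardyBounds p q) (ha0 : 0 < a) (ha : a < 1) (hpa : p * a < 1) :
    ENNReal.ofReal (((1 - q * a) / (1 - p * a)) ^ (1 / (p - q)) / (2 - a)) ≤ H := by
  have hqa : q * a < 1 := (mul_nonpos_of_nonpos_of_nonneg hq ha0.le).trans_lt one_pos
  refine le_of_mem_integralHardyBounds hH ha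
    (fun t ht => giniDom_powerTest hqp.ne' ha hpa hqa ht) ?_
    fun t ht => integralGini_powerTest hqp hpa hqa ht
  exact Real.rpow_nonneg (div_pos (by linarith) (by linarith)).le _

lemma eventually_nhdsLT_one_mem_Ioo : ∀ᶠ a : ℝ in 𝓝[<] 1, 0 < a ∧ a < 1 :=
  Ioo_mem_nhdsLT zero_lt_one

/-- Let `a → 1` from below: the integral near `0` diverges, so the tail loses its influence and `2 -
a` tends to `1`. -/
theorem le_of_mem_integralHardyBounds_of_lt_one (hp0 : 0 ≤ p) (hp : p < 1) (hq : q ≤ 0)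
    (hqp : q < p) {H : ℝ≥0∞} (hH : H ∈ integralHardyBounds p q) :
    ENNReal.ofReal (((1 - q) / (1 - p)) ^ (1 / (p - q))) ≤ H := by
  have h1 : 0 < 1 - p := by linarith
  have h2 : 0 < 1 - q := by linarith
  have hcont : ContinuousAt
      (fun a : ℝ => ((1 - q * a) / (1 - p * a)) ^ (1 / (p - q)) / (2 - a)) 1 := by
    refine ContinuousAt.div (ContinuousAt.rpow_const (ContinuousAt.div (by fun_prop) (by fun_prop)
      (by simpa using h1.ne')) (Or.inl ?_)) (by fun_prop) (by norm_num)
    simpa using (div_pos h2 h1).ne'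
  have hlim := (ENNReal.continuous_ofReal.tendsto _).comp
    (hcont.tendsto.mono_left (nhdsWithin_le_nhds (s := Iio 1)))
  rw [mul_one, mul_one, show (2 : ℝ) - 1 = 1 by norm_num, div_one] at hlim
  refine le_of_tendsto hlim ?_
  filter_upwards [eventually_nhdsLT_one_mem_Ioo] with a ha
  exact le_integralHardyBounds hq hqp hH ha.1 ha.2
    ((mul_le_of_le_one_right hp0 ha.2.le).trans_lt hp)

theorem exp_one_le_of_mem_integralHardyBounds {H : ℝ≥0∞} (hH : H ∈ integralHardyBounds 0 0) :
    ENNReal.ofReal (Real.exp 1) ≤ H := by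
  have hcont : ContinuousAt (fun a : ℝ => Real.exp a / (2 - a)) 1 :=
    ContinuousAt.div (by fun_prop) (by fun_prop) (by norm_num)
  have hlim := (ENNReal.continuous_ofReal.tendsto _).comp
    (hcont.tendsto.mono_left (nhdsWithin_le_nhds (s := Iio 1)))
  rw [show (2 : ℝ) - 1 = 1 by norm_num, div_one] at hlim
  refine le_of_tendsto hlim ?_
  filter_upwards [eventually_nhdsLT_one_mem_Ioo] with a ha
  exact le_of_mem_integralHardyBounds hH ha.2
    (fun t ht => giniDom_zero_zero_powerTest ha.2 ht) (Real.exp_pos a).le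
    fun t ht => integralGini_zero_zero_powerTest ht

theorem eq_top_of_mem_integralHardyBounds_of_one_le (hp : 1 ≤ p) (hq : q ≤ 0) {H : ℝ≥0∞}
    (hH : H ∈ integralHardyBounds p q) : H = ⊤ := by
  have hp0 : 0 < p := by linarith
  have hqp : q < p := by linarith
  have hs : 0 < p - q := sub_pos.2 hqp
  have hbase : Tendsto (fun n : ℕ => (n : ℝ) + 2) atTop atTop :=
    tendsto_natCast_atTop_atTop.atTop_add tendsto_const_nhds
  have hlim : Tendsto (fun n : ℕ => ((n : ℝ) + 2) ^ (1 / (p - q)) / 2) atTop atTop :=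
    ((tendsto_rpow_atTop (one_div_pos.2 hs)).comp hbase).atTop_div_const two_pos
  refine top_le_iff.1 (le_of_tendsto' (ENNReal.tendsto_ofReal_atTop.comp hlim) fun n => ?_)
  have hn : (0 : ℝ) < n + 2 := by positivity
  have hn1 : 1 / ((n : ℝ) + 2) < 1 := by
    rw [div_lt_one hn]; linarith [(Nat.cast_nonneg n : (0 : ℝ) ≤ n)]
  have hn0 : 0 < 1 / ((n : ℝ) + 2) := by positivity
  -- The exponent approaches `1 / p` from below, which makes `1 - p * a = 1 / (n + 2)` and sends the
  -- constant to infinity; `p ≥ 1` keeps `a < 1`.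
  set a := (1 - 1 / ((n : ℝ) + 2)) / p with hadef
  have hpa : p * a = 1 - 1 / ((n : ℝ) + 2) := by rw [hadef]; field_simp
  have ha0 : 0 < a := div_pos (by linarith) hp0
  have ha1 : a < 1 := by rw [hadef, div_lt_one hp0]; linarith
  refine le_trans (ENNReal.ofReal_le_ofReal ?_)
    (le_integralHardyBounds hq hqp hH ha0 ha1 (by rw [hpa]; linarith))
  have hqa : q * a ≤ 0 := mul_nonpos_of_nonpos_of_nonneg hq ha0.le
  have hge : (n : ℝ) + 2 ≤ (1 - q * a) / (1 - p * a) := by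
    rw [hpa, sub_sub_cancel, div_div_eq_mul_div, div_one]
    nlinarith
  have h2a : 0 < 2 - a := by linarith
  calc ((n : ℝ) + 2) ^ (1 / (p - q)) / 2 ≤ ((n : ℝ) + 2) ^ (1 / (p - q)) / (2 - a) := by
        gcongr
        linarith
    _ ≤ _ := by gcongr

/-- If the means of an integrable function stay away from zero, no finite constant is admissible. -/
lemma eq_top_of_mem_integralHardyBounds_of_tendsto {H : ℝ≥0∞} (hH : H ∈ integralHardyBounds p q)
    {f : ℝ → ℝ} (hf : InL (Ioi 0) (Ici 0) f) (hdom : ∀ t : ℝ, 0 < t → giniDom p q (Ico 0 t) f)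
    {m : ℝ} (hm : 0 < m)
    (hM : Tendsto (fun t => integralGini p q (Ico 0 t) f) atTop (𝓝 m)) : H = ⊤ := by
  by_contra hHtop
  have h1 := ne_top_of_le_ne_top (ENNReal.mul_ne_top hHtop (lintegral_ofReal_ne_top hf))
    (hH f hf hdom)
  obtain ⟨T, hT⟩ := eventually_atTop.1 ((hM.eventually_const_lt (half_lt_self hm)).and
    (eventually_gt_atTop (0 : ℝ)))
  refine h1 (top_le_iff.1 ?_)
  calc ⊤ = ∫⁻ _ in Ici T, ENNReal.ofReal (m / 2) := by
        rw [setLIntegral_const, Real.volume_Ici, ENNReal.mul_top]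
        exact (ENNReal.ofReal_pos.2 (half_pos hm)).ne'
    _ ≤ ∫⁻ t in Ici T, ENNReal.ofReal (integralGini p q (Ico 0 t) f) :=
        setLIntegral_mono' measurableSet_Ici fun t ht =>
          ENNReal.ofReal_le_ofReal (hT t ht).1.le
    _ ≤ _ := lintegral_mono_set fun t ht => (hT t ht).2

lemma tendsto_integral_Ico {h : ℝ → ℝ} (hh : IntegrableOn h (Ioi 0)) :
    Tendsto (fun t => ∫ s in Ico 0 t, h s) atTop (𝓝 (∫ s in Ioi 0, h s)) := by
  refine (intervalIntegral_tendsto_integral_Ioi 0 hh tendsto_id).congr' ?_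
  filter_upwards [eventually_ge_atTop (0 : ℝ)] with t ht
  rw [id, intervalIntegral.integral_of_le ht, integral_Ico_eq_integral_Ioo,
    integral_Ioc_eq_integral_Ioo]

theorem eq_top_of_mem_integralHardyBounds_of_pos (hp : 0 < p) (hq : 0 < q) {H : ℝ≥0∞}
    (hH : H ∈ integralHardyBounds p q) : H = ⊤ := by
  -- The continuous analogue of the geometric sequence: all positive powers, and `f^p log f`, are
  -- integrable on `(0, ∞)`, so the means converge to a positive limit.
  let f : ℝ → ℝ := fun s => Real.exp (-s)
  have hfpos (s : ℝ) : 0 < f s := Real.exp_pos _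
  have hfr (r s : ℝ) : f s ^ r = Real.exp (-r * s) := by
    rw [← Real.exp_mul]; ring_nf
  have hfl : (fun s => f s ^ p * Real.log (f s)) = fun s => -(s * Real.exp (-p * s)) := by
    ext s; rw [hfr, Real.log_exp]; ring
  have hi (r : ℝ) (hr : 0 < r) : IntegrableOn (fun s => f s ^ r) (Ioi 0) := by
    simp_rw [hfr]
    exact exp_neg_integrableOn_Ioi 0 hr
  have hl : IntegrableOn (fun s => f s ^ p * Real.log (f s)) (Ioi 0) := by
    rw [hfl]
    have := (integrableOn_rpow_mul_exp_neg_mul_rpow (s := 1) (by norm_num) one_pos hp).neg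
    simpa using this
  have hIci {h : ℝ → ℝ} (hh : IntegrableOn h (Ioi 0)) : IntegrableOn h (Ici 0) :=
    (integrableOn_Ici_iff_integrableOn_Ioi (by simp)).2 hh
  have hf : InL (Ioi 0) (Ici 0) f := ⟨hIci (by simpa using hi 1 one_pos), fun s _ => hfpos s⟩
  have hdom (t : ℝ) (ht : 0 < t) : giniDom p q (Ico 0 t) f :=
    ⟨isBddInterval_Ico ht, ⟨hf.1.mono_set Ico_subset_Ici_self, fun s _ => hfpos s⟩,
      (hIci (hi p hp)).mono_set Ico_subset_Ici_self,
      fun _ => (hIci (hi q hq)).mono_set Ico_subset_Ici_self,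
      fun _ => (hIci hl).mono_set Ico_subset_Ici_self⟩
  have hpos (r : ℝ) (hr : 0 < r) : 0 < ∫ s in Ioi 0, f s ^ r := by
    rw [setIntegral_pos_iff_support_of_nonneg_ae _ (hi r hr)]
    · have : Function.support (fun s => f s ^ r) = univ :=
        eq_univ_of_forall fun s => (Real.rpow_pos_of_pos (hfpos s) r).ne'
      rw [this, univ_inter]
      simp
    · exact ae_of_all _ fun s => (Real.rpow_pos_of_pos (hfpos s) r).le
  by_cases hpq : p = q
  · subst hpq
    have hlim := (Real.continuous_exp.tendsto _).comp
      ((tendsto_integral_Ico hl).div (tendsto_integral_Ico (hi p hp)) (hpos p hp).ne')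
    refine eq_top_of_mem_integralHardyBounds_of_tendsto hH hf hdom (Real.exp_pos _)
      (hlim.congr fun t => ?_)
    rw [integralGini, if_pos rfl]
    rfl
  · have h0 := div_pos (hpos p hp) (hpos q hq)
    refine eq_top_of_mem_integralHardyBounds_of_tendsto hH hf hdom
      (Real.rpow_pos_of_pos h0 (1 / (p - q))) ?_
    simp only [integralGini, if_neg hpq]
    exact ((tendsto_integral_Ico (hi p hp)).div (tendsto_integral_Ico (hi q hq))
      (hpos q hq).ne').rpow_const (Or.inl h0.ne')

lemma integralHardyBounds_comm (p q : ℝ) : integralHardyBounds p q = integralHardyBounds q p := by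
  have h (p q : ℝ) : integralHardyBounds p q ⊆ integralHardyBounds q p := fun H hH f hf hdom => by
    refine le_trans (le_of_eq ?_) (hH f hf fun t ht => (hdom t ht).symm)
    exact setLIntegral_congr_fun measurableSet_Ioi fun t ht => by
      simp only [integralGini_comm (hdom t ht)]
  exact (h p q).antisymm (h q p)

lemma isIntegralHardyConst_iff {C : ℝ≥0∞} :
    IsIntegralHardyConst (Ioi 0) (giniDom p q) (integralGini p q) C ↔
      IsLeast (integralHardyBounds p q) C := Iff.rfl

/-- The integral Hardy constant of a Gini mean with `p ≠ q`, `min p q ≤ 0 ≤ max p q < 1`. -/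
theorem isIntegralHardyConst_integralGini (hpq : p ≠ q) (hmin : min p q ≤ 0)
    (hmax0 : 0 ≤ max p q) (hmax : max p q < 1) :
    IsIntegralHardyConst (Ioi 0) (giniDom p q) (integralGini p q)
      (ENNReal.ofReal (((1 - q) / (1 - p)) ^ (1 / (p - q)))) := by
  rw [isIntegralHardyConst_iff]
  rcases lt_or_gt_of_ne hpq with h | h
  · rw [min_eq_left h.le] at hmin
    rw [max_eq_right h.le] at hmax0 hmax
    rw [integralHardyBounds_comm, div_one_sub_rpow_comm (h.trans hmax) hmax]
    exact ⟨mem_integralHardyBounds hmax0 hmax hmin h,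
      fun _ hH => le_of_mem_integralHardyBounds_of_lt_one hmax0 hmax hmin h hH⟩
  · rw [min_eq_right h.le] at hmin
    rw [max_eq_left h.le] at hmax0 hmax
    exact ⟨mem_integralHardyBounds hmax0 hmax hmin h,
      fun _ hH => le_of_mem_integralHardyBounds_of_lt_one hmax0 hmax hmin h hH⟩

theorem isIntegralHardyConst_integralGini_zero_zero :
    IsIntegralHardyConst (Ioi 0) (giniDom 0 0) (integralGini 0 0)
      (ENNReal.ofReal (Real.exp 1)) :=
  ⟨mem_integralHardyBounds_zero_zero, fun _ hH => exp_one_le_of_mem_integralHardyBounds hH⟩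

theorem isIntegralHardyConst_integralGini_top (h : 0 < min p q ∨ 1 ≤ max p q) :
    IsIntegralHardyConst (Ioi 0) (giniDom p q) (integralGini p q) ⊤ := by
  rw [isIntegralHardyConst_iff]
  refine ⟨top_mem_integralHardyBounds p q, fun H hH => top_le_iff.2 ?_⟩
  by_cases hmin : 0 < min p q
  · exact eq_top_of_mem_integralHardyBounds_of_pos (lt_min_iff.1 hmin).1 (lt_min_iff.1 hmin).2 hH
  · replace h := h.resolve_left hmin
    rw [not_lt] at hmin
    rcases le_total p q with hpq | hpq
    · rw [min_eq_left hpq] at hmin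
      rw [max_eq_right hpq] at h
      rw [integralHardyBounds_comm] at hH
      exact eq_top_of_mem_integralHardyBounds_of_one_le h hmin hH
    · rw [min_eq_right hpq] at hmin
      rw [max_eq_left hpq] at h
      exact eq_top_of_mem_integralHardyBounds_of_one_le h hmin hH

end IntegralLower

end GiniHardy

theorem mainTheorem4 :
    -- the explicit integral Gini means are integral means on `(0, ∞)`, and they are given by the
    -- weighted Gini means on simple functions
    (∀ p q : ℝ,
      GiniHardy.IsIntegralMean (Ioi 0) (GiniHardy.giniDom p q) (GiniHardy.integralGini p q) ∧
      ∀ (J : Set ℝ) (g : ℝ → ℝ) (n : ℕ) (c : Fin (n + 1) → ℝ) (v : Fin n → ℝ),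
        GiniHardy.IsBddInterval J → MapsTo g J (Ioi 0) → GiniHardy.IsSimpleOn J g n c v →
        GiniHardy.giniDom p q J g ∧
        GiniHardy.integralGini p q J g = GiniHardy.gini p q n v (GiniHardy.lengths c)) ∧
    -- existence, uniqueness and form of the extension
    (∀ (p q : ℝ) (N : Set ℝ → (ℝ → ℝ) → ℝ),
      GiniHardy.IsContinuousExtension p q N ↔
        ∀ J f, GiniHardy.giniDom p q J f → N J f = GiniHardy.integralGini p q J f) ∧
    -- the discrete and the integral Hardy constants are equal, and their values
    (∀ p q : ℝ, p ≠ q → min p q ≤ 0 → 0 ≤ max p q → max p q < 1 →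
      GiniHardy.IsHardyConst (Ioi 0) (GiniHardy.gini p q)
        (ENNReal.ofReal (((1 - q) / (1 - p)) ^ (1 / (p - q)))) ∧
      GiniHardy.IsIntegralHardyConst (Ioi 0) (GiniHardy.giniDom p q) (GiniHardy.integralGini p q)
        (ENNReal.ofReal (((1 - q) / (1 - p)) ^ (1 / (p - q))))) ∧
    (GiniHardy.IsHardyConst (Ioi 0) (GiniHardy.gini 0 0) (ENNReal.ofReal (Real.exp 1)) ∧
      GiniHardy.IsIntegralHardyConst (Ioi 0) (GiniHardy.giniDom 0 0) (GiniHardy.integralGini 0 0)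
        (ENNReal.ofReal (Real.exp 1))) ∧
    (∀ p q : ℝ, 0 < min p q ∨ 1 ≤ max p q →
      GiniHardy.IsHardyConst (Ioi 0) (GiniHardy.gini p q) ⊤ ∧
      GiniHardy.IsIntegralHardyConst (Ioi 0) (GiniHardy.giniDom p q) (GiniHardy.integralGini p q)
        ⊤) ∧
    -- the bound in the remaining range; in particular these integral means are Hardy
    (∀ p q : ℝ, max p q ≤ 0 →
      ∃ C : ENNReal, C ≤ ENNReal.ofReal (Real.exp 1) ∧ C < ⊤ ∧
        GiniHardy.IsIntegralHardyConst (Ioi 0) (GiniHardy.giniDom p q)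
          (GiniHardy.integralGini p q) C) := by
  refine ⟨fun p q => ⟨GiniHardy.isIntegralMean_integralGini p q, fun J g n c v hJ hg h =>
      ⟨h.giniDom p q hJ hg, h.integralGini_eq p q hJ⟩⟩,
    GiniHardy.isContinuousExtension_iff,
    fun p q hpq hmin hmax0 hmax => ⟨GiniHardy.isHardyConst_gini hpq hmin hmax0 hmax,
      GiniHardy.isIntegralHardyConst_integralGini hpq hmin hmax0 hmax⟩,
    ⟨GiniHardy.isHardyConst_gini_zero_zero,
      GiniHardy.isIntegralHardyConst_integralGini_zero_zero⟩,
    fun p q h => ⟨GiniHardy.isHardyConst_gini_top h,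
      GiniHardy.isIntegralHardyConst_integralGini_top h⟩,
    fun p q h => GiniHardy.exists_isIntegralHardyConst_le_exp_one h⟩
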